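/- **Theorem.** (a) For every finite field $K$, the proof system Ext-PC over $K$ p-simulates the proof system Hitting. (b) Every Extended Frege system p-simulates Hitting. **Definitions.** A *refutation system* specifies which strings $\pi$ are refutations of which CNF formulas $F$. A system $B$ *p-simulates* a system $A$ if there is a polynomial-time computable function $f$ such that, for every CNF formula $F$ and every $A$-refutation $\pi$ of $F$, $f(F,\pi)$ is a $B$-refutation of $F$. The variables of CNF formulas are $x_0,x_1,\dots$ with indices written in binary; clauses are treated as sets of literals. *Hitting.* A CNF formula $H=C_1\land\dots\land C_m$ is a *hitting formula* if for all $i\neq j$ there is a literal $\ell$ with $\ell\in C_i$ and $\bar\ell\in C_j$. A Hitting refutation of $F$ is an unsatisfiable hitting formula $H$ such that every clause $C$ of $H$ contains a clause $C'\subseteq C$ of $F$. *Ext-PC over $K$.* The polynomials are over $K$, in the variables $x_i$, their duals $x_i^R$, and extension variables $y_j$; they are written as sums of monomials with coefficients. A CNF formula $F$ is translated into the polynomials $x_i^2-x_i$ and $x_i+x_i^R-1$ (for all $i$) together with, for each clause $C$ of $F$, the monomial that is the product of the $x_i$ with $\neg x_i\in C$ and the $x_i^R$ with $x_i\in C$.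 An Ext-PC refutation of $F$ consists of a sequence of definitions $y_{j_1}=q_1,\dots,y_{j_s}=q_s$, where the $y_{j_k}$ are distinct extension variables and $q_k$ is a polynomial in the variables $x_i,x_i^R$ and $y_{j_1},\dots,y_{j_{k-1}}$, and of a Polynomial Calculus refutation of the translation of $F$ together with the polynomials $y_{j_k}-q_k$: a sequence of polynomials that ends in $1$, each of which belongs to this set, or is a $K$-linear combination of two earlier ones, or is the product of an earlier one by a variable. *Extended Frege.* Boolean formulas are built from variables by $\top,\bot,\neg,\land,\lor,\to,\leftrightarrow,\oplus$. A *Frege system* is a finite set of sound rule schemas that is implicationally complete: whenever formulas $A_1,\dots,A_k$ semantically imply $A$, then $A$ is derivable from $A_1,\dots,A_k$ by instances of the rules. In the corresponding *Extended Frege system*, a refutation of a CNF formula $F$ is a sequence of formulas that ends in $\bot$, each of which is a clause of $F$ (a disjunction of literals), or follows from earlier ones by an instance of a rule, or is an extension axiom $y\leftrightarrow A$, where $y$ is a new variable: it occurs neither in $F$, nor in $A$, nor in the earlier lines. -/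

import Mathlib

namespace HitSim

/-! ### Data, programs, polynomial time

Data are binary trees. Programs are those of a small structured tree-processing language, and every
operation is charged at least the size of the data that it reads, so that no datum that occurs in a
run is larger than the cost of the run. Hence the cost agrees with the running time of (multitape)
Turing machines up to a polynomial, and `PolyTime` below is the usual class of polynomial-time
computable functions. -/

/-- Binary trees. `nil` plays the role of "false" in tests. -/
inductive BTree : Type
  | nil : BTree
  | node : BTree → BTree → BTree
  deriving DecidableEq

namespace BTree

/-- The number of nodes, leaves included. -/
def size : BTree → ℕ
  | nil => 1
  | node l r => l.size + r.size + 1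

def hd : BTree → BTree
  | nil => nil
  | node l _ => l

def tl : BTree → BTree
  | nil => nil
  | node _ r => r

end BTree

/-- Programs; each computes a partial function from trees to trees. -/
inductive Prog : Type
  /-- constant `nil` -/
  | nil : Prog
  /-- identity -/
  | id : Prog
  /-- left subtree -/
  | hd : Prog
  /-- right subtree -/
  | tl : Prog
  /-- test whether the two immediate subtrees of the input are equal -/
  | eq : Prog
  /-- run both programs on the input and pair the results -/
  | pair (p q : Prog) : Prog
  /-- first `p`, then `q` on the result -/
  | seq (p q : Prog) : Prog
  /-- run `c` on the input; then `p` on the input if the result is not `nil`, and `q` otherwise -/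
  | ite (c p q : Prog) : Prog
  /-- while the result of `c` on the current value is not `nil`, replace that value by the result
  of `p` on it -/
  | loop (c p : Prog) : Prog

/-- `Runs c x y t`: on input `x` the program `c` halts with output `y`, at cost `t`. -/
inductive Runs : Prog → BTree → BTree → ℕ → Prop
  | nil (x : BTree) : Runs Prog.nil x BTree.nil x.size
  | id (x : BTree) : Runs Prog.id x x x.size
  | hd (x : BTree) : Runs Prog.hd x x.hd x.size
  | tl (x : BTree) : Runs Prog.tl x x.tl x.size
  | eq (x : BTree) :
      Runs Prog.eq x (if x.hd = x.tl then BTree.node BTree.nil BTree.nil else BTree.nil) (x.size + 2)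
  | pair {p q : Prog} {x y z : BTree} {s t : ℕ} :
      Runs p x y s → Runs q x z t → Runs (Prog.pair p q) x (BTree.node y z) (x.size + s + t)
  | seq {p q : Prog} {x y z : BTree} {s t : ℕ} :
      Runs p x y s → Runs q y z t → Runs (Prog.seq p q) x z (x.size + s + t)
  | ite_true {c p q : Prog} {x y z : BTree} {s t : ℕ} :
      Runs c x y s → y ≠ BTree.nil → Runs p x z t → Runs (Prog.ite c p q) x z (x.size + s + t)
  | ite_false {c p q : Prog} {x z : BTree} {s t : ℕ} :
      Runs c x BTree.nil s → Runs q x z t → Runs (Prog.ite c p q) x z (x.size + s + t)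
  | loop_stop {c p : Prog} {x : BTree} {s : ℕ} :
      Runs c x BTree.nil s → Runs (Prog.loop c p) x x (x.size + s)
  | loop_step {c p : Prog} {x y x' z : BTree} {s t u : ℕ} :
      Runs c x y s → y ≠ BTree.nil → Runs p x x' t → Runs (Prog.loop c p) x' z u →
      Runs (Prog.loop c p) x z (x.size + s + t + u)

/-- An injective coding of the objects of a type by trees. -/
class TreeCode (α : Type*) where
  code : α → BTree
  inj : Function.Injective code

/-- `f` is computable in polynomial time, in the size of the code of the input. -/
def PolyTime {α β : Type*} [TreeCode α] [TreeCode β] (f : α → β) : Prop :=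
  ∃ (c : Prog) (p : Polynomial ℕ), ∀ a : α, ∃ t : ℕ,
    Runs c (TreeCode.code a) (TreeCode.code (f a)) t ∧ t ≤ p.eval (TreeCode.code a).size

/-! ### Codings -/

instance : TreeCode Bool where
  code b := if b then BTree.node BTree.nil BTree.nil else BTree.nil
  inj := by intro a b; cases a <;> cases b <;> simp

instance {α β : Type*} [TreeCode α] [TreeCode β] : TreeCode (α × β) where
  code p := BTree.node (TreeCode.code p.1) (TreeCode.code p.2)
  inj := by
    rintro ⟨a, b⟩ ⟨c, d⟩ h
    simp only [BTree.node.injEq] at h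
    rw [TreeCode.inj h.1, TreeCode.inj h.2]

/-- The code of a list: its elements along the right spine of the tree. -/
def codeList {α : Type*} [TreeCode α] : List α → BTree
  | [] => BTree.nil
  | a :: l => BTree.node (TreeCode.code a) (codeList l)

instance {α : Type*} [TreeCode α] : TreeCode (List α) where
  code := codeList
  inj := by
    intro l
    induction l with
    | nil => intro m h; cases m with
      | nil => rfl
      | cons b m => simp [codeList] at h
    | cons a l ih => intro m h; cases m with
      | nil => simp [codeList] at h
      | cons b m =>
        simp only [codeList, BTree.node.injEq] at h
        rw [TreeCode.inj h.1, ih h.2]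

theorem bits_injective : Function.Injective Nat.bits := by
  intro a b h
  apply Nat.eq_of_testBit_eq
  intro i
  rw [Nat.testBit_eq_inth, Nat.testBit_eq_inth, h]

/-- Natural numbers are coded in binary, least significant bit first. -/
instance : TreeCode ℕ where
  code n := TreeCode.code n.bits
  inj := fun _ _ h => bits_injective (TreeCode.inj h)

/-! ### Formulas in conjunctive normal form, and the proof system Hitting -/

/-- A literal: the variable `x_var` if `pos` is true, and its negation otherwise. -/
structure Lit where
  var : ℕ
  pos : Bool
  deriving DecidableEq

namespace Lit

/-- The contrary literal. -/
def neg (l : Lit) : Lit := ⟨l.var, !l.pos⟩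

/-- Truth of a literal under an assignment. -/
def Holds (l : Lit) (a : ℕ → Bool) : Prop := a l.var = l.pos

end Lit

instance : TreeCode Lit where
  code l := TreeCode.code (l.var, l.pos)
  inj := by
    rintro ⟨a, b⟩ ⟨c, d⟩ h
    simpa using TreeCode.inj h

/-- A clause: the disjunction of its literals. Only the set of its literals matters. -/
abbrev Clause := List Lit

/-- A formula in CNF: the conjunction of its clauses. -/
abbrev CNF := List Clause

def Clause.Holds (C : Clause) (a : ℕ → Bool) : Prop := ∃ l ∈ C, Lit.Holds l a

def CNF.Unsat (F : CNF) : Prop := ∀ a : ℕ → Bool, ¬ ∀ C ∈ F, Clause.Holds C a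

/-- Every two clauses of `H` contain contrary literals. -/
def CNF.IsHitting (H : CNF) : Prop := H.Pairwise fun C D => ∃ l ∈ C, l.neg ∈ D

/-- `H` is a refutation of `F` in the proof system Hitting: `H` is an unsatisfiable hitting formula
each of whose clauses has a strengthening among the clauses of `F`. -/
def IsHittingRefutation (F H : CNF) : Prop :=
  H.IsHitting ∧ H.Unsat ∧ ∀ C ∈ H, ∃ C' ∈ F, C' ⊆ C

/-! ### Proof systems and p-simulation -/

/-- A system for refuting formulas in CNF. -/
structure ProofSystem where
  /-- the candidate proofs -/
  Proof : Type
  /-- how they are written down -/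
  [coded : TreeCode Proof]
  /-- the second argument is a refutation of the first -/
  IsRefutation : CNF → Proof → Prop

attribute [instance] ProofSystem.coded

/-- `B` p-simulates `A`: some polynomial-time computable function turns every refutation of a CNF
`F` in `A` into a refutation of `F` in `B`. -/
def PSimulates (B A : ProofSystem) : Prop :=
  ∃ f : CNF × A.Proof → B.Proof, PolyTime f ∧
    ∀ (F : CNF) (π : A.Proof), A.IsRefutation F π → B.IsRefutation F (f (F, π))

/-- The proof system Hitting. -/
def hitting : ProofSystem where
  Proof := CNF
  IsRefutation := IsHittingRefutation

/-! ### Extension Polynomial Calculus -/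

/-- Variables of polynomials: the original variable `x_i`, its dual variable `x_i^R` (which stands
for `1 - x_i`), and the extension variables `y_j`. -/
inductive PVar : Type
  | orig (i : ℕ) : PVar
  | dual (i : ℕ) : PVar
  | ext (j : ℕ) : PVar
  deriving DecidableEq

instance : TreeCode PVar where
  code v := match v with
    | .orig i => TreeCode.code (0, i)
    | .dual i => TreeCode.code (1, i)
    | .ext j => TreeCode.code (2, j)
  inj := by
    intro v w h
    cases v <;> cases w <;> simpa using TreeCode.inj h

/-- A monomial with its coefficient; the monomial is written as the list of its variables, with
repetitions. -/
structure Term (K : Type) where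
  coeff : K
  mono : List PVar

/-- A polynomial written out as a sum of monomials with coefficients. -/
abbrev Poly (K : Type) := List (Term K)

/-- The elements of the (fixed) finite field `K` are coded by the numbers below its cardinality. -/
noncomputable instance {K : Type} [Finite K] : TreeCode (Term K) where
  code t := TreeCode.code ((Finite.equivFin K t.coeff : ℕ), t.mono)
  inj := by
    rintro ⟨a, m⟩ ⟨b, n⟩ h
    have h' := TreeCode.inj h
    simp only [Prod.mk.injEq, Fin.val_inj, EmbeddingLike.apply_eq_iff_eq] at h'
    rw [h'.1, h'.2]

section ExtPC

variable {K : Type} [Field K]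

open MvPolynomial in
noncomputable def Term.toMv (t : Term K) : MvPolynomial PVar K :=
  C t.coeff * (t.mono.map X).prod

/-- The polynomial that is written by the sum `p`. -/
noncomputable def Poly.toMv (p : Poly K) : MvPolynomial PVar K := (p.map Term.toMv).sum

/-- The variable that is the translation of a literal inside a clause: it is zero iff the literal is
true. -/
def Lit.toPVar (l : Lit) : PVar := if l.pos then PVar.dual l.var else PVar.orig l.var

/-- The translation of a clause: a monomial that vanishes iff the clause holds. -/
noncomputable def Clause.toMv (K : Type) [Field K] (C : Clause) : MvPolynomial PVar K :=
  ∏ l ∈ C.toFinset, MvPolynomial.X l.toPVar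

/-- The polynomials that translate the formula `F`, for Boolean variables with duals: the
translations of the clauses, `x_i ^ 2 - x_i`, and `x_i + x_i^R - 1`. -/
inductive CNFAxiom (K : Type) [Field K] (F : CNF) : MvPolynomial PVar K → Prop
  | clause (C : Clause) : C ∈ F → CNFAxiom K F (C.toMv K)
  | boolean (i : ℕ) :
      CNFAxiom K F (MvPolynomial.X (PVar.orig i) ^ 2 - MvPolynomial.X (PVar.orig i))
  | dual (i : ℕ) :
      CNFAxiom K F (MvPolynomial.X (PVar.orig i) + MvPolynomial.X (PVar.dual i) - 1)

/-- `ds` is a list of definitions `y = q` of extension variables, where every `y` is new, and `q`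
uses only (original and dual variables and) extension variables that are in `known` or have been
defined before. -/
def ExtDefs : List ℕ → List (ℕ × Poly K) → Prop
  | _, [] => True
  | known, (y, q) :: ds =>
      y ∉ known ∧ (∀ t ∈ q, ∀ j, PVar.ext j ∈ t.mono → j ∈ known) ∧ ExtDefs (y :: known) ds

/-- The rules of Polynomial Calculus: `p` is one of the axioms `Ax`, or a linear combination of two
of the polynomials in `prev`, or the product of one of them by a variable. -/
def PCStep (Ax : MvPolynomial PVar K → Prop) (prev : List (Poly K)) (p : Poly K) : Prop :=
  Ax p.toMv ∨
  (∃ q ∈ prev, ∃ r ∈ prev, ∃ a b : K,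
    p.toMv = MvPolynomial.C a * q.toMv + MvPolynomial.C b * r.toMv) ∨
  (∃ q ∈ prev, ∃ v : PVar, p.toMv = MvPolynomial.X v * q.toMv)

/-- A refutation in Polynomial Calculus of the set of polynomials `Ax`: a derivation of `1`. -/
def IsPCRefutation (Ax : MvPolynomial PVar K → Prop) (lines : List (Poly K)) : Prop :=
  (∀ pre p post, lines = pre ++ p :: post → PCStep Ax pre p) ∧
  ∃ p, lines.getLast? = some p ∧ p.toMv = 1

/-- A refutation of `F` in Ext-PC: definitions of extension variables, and a refutation in
Polynomial Calculus of the translation of `F` together with the polynomials `y - q` for these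
definitions `y = q`. -/
def IsExtPCRefutation (F : CNF) (π : List (ℕ × Poly K) × List (Poly K)) : Prop :=
  ExtDefs [] π.1 ∧
  IsPCRefutation
    (fun p => CNFAxiom K F p ∨ ∃ d ∈ π.1, p = MvPolynomial.X (PVar.ext d.1) - d.2.toMv) π.2

end ExtPC

/-- The proof system Ext-PC over the finite field `K`. -/
noncomputable def extPC (K : Type) [Field K] [Finite K] : ProofSystem where
  Proof := List (ℕ × Poly K) × List (Poly K)
  IsRefutation := IsExtPCRefutation

/-! ### Frege and Extended Frege systems -/

/-- Boolean formulas with variables from `V`. -/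
inductive Fml (V : Type) : Type
  | var (v : V) : Fml V
  | tt : Fml V
  | ff : Fml V
  | neg (A : Fml V) : Fml V
  | and (A B : Fml V) : Fml V
  | or (A B : Fml V) : Fml V
  | imp (A B : Fml V) : Fml V
  | iff (A B : Fml V) : Fml V
  | xor (A B : Fml V) : Fml V

namespace Fml

variable {V W : Type}

def eval (a : V → Bool) : Fml V → Bool
  | var v => a v
  | tt => true
  | ff => false
  | neg A => !(A.eval a)
  | and A B => A.eval a && B.eval a
  | or A B => A.eval a || B.eval a
  | imp A B => !(A.eval a) || B.eval a
  | iff A B => A.eval a == B.eval a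
  | xor A B => Bool.xor (A.eval a) (B.eval a)

def subst (σ : V → Fml W) : Fml V → Fml W
  | var v => σ v
  | tt => tt
  | ff => ff
  | neg A => neg (A.subst σ)
  | and A B => and (A.subst σ) (B.subst σ)
  | or A B => or (A.subst σ) (B.subst σ)
  | imp A B => imp (A.subst σ) (B.subst σ)
  | iff A B => iff (A.subst σ) (B.subst σ)
  | xor A B => xor (A.subst σ) (B.subst σ)

/-- The variable `v` occurs in the formula. -/
def Occurs (v : V) : Fml V → Prop
  | var w => v = w
  | tt => False
  | ff => False
  | neg A => A.Occurs v
  | and A B => A.Occurs v ∨ B.Occurs v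
  | or A B => A.Occurs v ∨ B.Occurs v
  | imp A B => A.Occurs v ∨ B.Occurs v
  | iff A B => A.Occurs v ∨ B.Occurs v
  | xor A B => A.Occurs v ∨ B.Occurs v

/-- The premises `Γ` semantically imply `A`. -/
def Entails (Γ : List (Fml V)) (A : Fml V) : Prop :=
  ∀ a : V → Bool, (∀ B ∈ Γ, B.eval a = true) → A.eval a = true

/-- The code of a formula: the parse tree, with a number at every node that tells the connective. -/
def toTree [TreeCode V] : Fml V → BTree
  | var v => BTree.node (TreeCode.code 0) (TreeCode.code v)
  | tt => BTree.node (TreeCode.code 1) BTree.nil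
  | ff => BTree.node (TreeCode.code 2) BTree.nil
  | neg A => BTree.node (TreeCode.code 3) A.toTree
  | and A B => BTree.node (TreeCode.code 4) (BTree.node A.toTree B.toTree)
  | or A B => BTree.node (TreeCode.code 5) (BTree.node A.toTree B.toTree)
  | imp A B => BTree.node (TreeCode.code 6) (BTree.node A.toTree B.toTree)
  | iff A B => BTree.node (TreeCode.code 7) (BTree.node A.toTree B.toTree)
  | xor A B => BTree.node (TreeCode.code 8) (BTree.node A.toTree B.toTree)

instance [TreeCode V] : TreeCode (Fml V) where
  code := toTree
  inj := by
    have key : ∀ m n : ℕ, TreeCode.code m = TreeCode.code n ↔ m = n :=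
      fun m n => TreeCode.inj.eq_iff
    have keyV : ∀ m n : V, TreeCode.code m = TreeCode.code n ↔ m = n :=
      fun m n => TreeCode.inj.eq_iff
    intro A
    induction A with
    | var v => intro B h; cases B <;> simp [toTree, key, keyV] at h ⊢; exact h
    | tt => intro B h; cases B <;> simp [toTree, key] at h ⊢
    | ff => intro B h; cases B <;> simp [toTree, key] at h ⊢
    | neg A ih => intro B h; cases B <;> simp [toTree, key] at h ⊢; exact ih h
    | and A A' ih ih' | or A A' ih ih' | imp A A' ih ih' | iff A A' ih ih' | xor A A' ih ih' =>
      intro B h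
      cases B <;> simp [toTree, key] at h ⊢; exact ⟨ih h.1, ih' h.2⟩

end Fml

/-- A rule schema: premises and conclusion, whose variables are the meta-variables. -/
structure Rule where
  prem : List (Fml ℕ)
  concl : Fml ℕ

/-- `A` follows by an instance of one of the rules from formulas in `prev`. -/
def FregeStep {V : Type} (rules : List Rule) (prev : List (Fml V)) (A : Fml V) : Prop :=
  ∃ R ∈ rules, ∃ σ : ℕ → Fml V, A = R.concl.subst σ ∧ ∀ P ∈ R.prem, P.subst σ ∈ prev

/-- `A` has a derivation by the rules from the hypotheses `Γ`. -/
def FregeDerives {V : Type} (rules : List Rule) (Γ : List (Fml V)) (A : Fml V) : Prop :=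
  ∃ lines : List (Fml V),
    (∀ pre B post, lines = pre ++ B :: post → B ∈ Γ ∨ FregeStep rules pre B) ∧
    lines.getLast? = some A

/-- A Frege system: finitely many sound rule schemas that are implicationally complete. -/
structure FregeSystem where
  rules : List Rule
  sound : ∀ R ∈ rules, Fml.Entails R.prem R.concl
  complete : ∀ (Γ : List (Fml ℕ)) (A : Fml ℕ), Fml.Entails Γ A → FregeDerives rules Γ A

/-- Variables of Extended Frege proofs: the original variables `x_i`, and an infinite supply of
names `y_j` for extension variables. -/
inductive EVar : Type
  | orig (i : ℕ) : EVar
  | ext (j : ℕ) : EVar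
  deriving DecidableEq

instance : TreeCode EVar where
  code v := match v with
    | .orig i => TreeCode.code (0, i)
    | .ext j => TreeCode.code (1, j)
  inj := by
    intro v w h
    cases v <;> cases w <;> simpa using TreeCode.inj h

def Lit.toFml (l : Lit) : Fml EVar :=
  if l.pos then Fml.var (EVar.orig l.var) else Fml.neg (Fml.var (EVar.orig l.var))

/-- The clause as a Boolean formula. -/
def Clause.toFml (C : Clause) : Fml EVar := C.foldr (fun l A => Fml.or l.toFml A) Fml.ff

/-- An extension axiom `y ↔ A`, where `y` occurs neither in `A` nor in the lines before it. -/
def ExtAxiom (prev : List (Fml EVar)) (B : Fml EVar) : Prop :=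
  ∃ (y : ℕ) (A : Fml EVar), B = Fml.iff (Fml.var (EVar.ext y)) A ∧
    ¬ A.Occurs (EVar.ext y) ∧ ∀ D ∈ prev, ¬ D.Occurs (EVar.ext y)

/-- The Extended Frege system of the Frege system `S`: a refutation of `F` derives the constant
false from the clauses of `F` by the rules of `S` and extension axioms. -/
def extFrege (S : FregeSystem) : ProofSystem where
  Proof := List (Fml EVar)
  IsRefutation F lines :=
    (∀ pre B post, lines = pre ++ B :: post →
      (∃ C ∈ F, B = Clause.toFml C) ∨ FregeStep S.rules pre B ∨ ExtAxiom pre B) ∧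
    lines.getLast? = some Fml.ff

end HitSim

namespace HitSim

/-! ### Resource bounds -/

/-! Drop the tautological clauses of the hitting formula `H` and put the empty clause `C_0` in front
of the others, `C_1, …, C_m`. Give a clause the value 1 where it is falsified and 0 where it holds.
Contrary literals allow at most one falsified clause among `C_1, …, C_m`, and unsatisfiability
forces at least one, so their values sum to 1, the value of `C_0`, over every field (`clauses_sum`).

The value of a clause is a product of one factor (a `mask`) for each variable. This is a sum of
read-once products, and the identity is certified by a width reduction that goes variable by
variable. At level `k` there is a square matrix `lev K H k`, with columns indexed by the clauses,
whose rows span the vectors of partial products over the first `k` variables. To pass to level `k +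
1`, every row is multiplied entrywise by the masks for both values of the next variable, and
Gaussian elimination (`elim`) shrinks the doubled list to `m + 1` rows while recording coordinates.
Elimination only forms combinations, so a functional that vanishes on the vectors of full products
vanishes on the last rows; applied to the weights `(-1, 1, …, 1)` this gives `sum_entry_lev_last`:
in the last matrix the columns of `C_1, …, C_m` add up to that of `C_0`.

The proof systems follow this with extension variables `y_{k,j}`, the coordinates of the vector of
partial products in the rows of level `k`. The recorded coordinates define `y_{k+1,j}` from the
`y_{k,j'}` and `x_k`. Then one derives, for every clause and level, that the linear form given by
the clause's column is the partial product (`toMv_prodLine_succ`; for Frege, `derives_combLines` and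
`derives_splitLines`). At the last level the form of `C_0` is 1, the forms of the other clauses are
0 because each contains a clause of `F`, and the column identity turns this into `1 = 0`.

Extended Frege carries this out over the field with two elements, with linear forms as chains of
exclusive ors. Each inference is an instance of one of finitely many sound schemas, whose
derivations exist by implicational completeness and are constants of the algorithm. Since `K` is
finite, matrix entries have bounded size, so elimination and the writing of the proof take
polynomial time. -/

theorem eval_mono (p : Polynomial ℕ) {m n : ℕ} (h : m ≤ n) : p.eval m ≤ p.eval n := by
  rw [Polynomial.eval_eq_sum_range, Polynomial.eval_eq_sum_range]
  gcongr

theorem BTree.one_le_size (x : BTree) : 1 ≤ x.size := by cases x <;> simp [BTree.size]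

/-- Every operation is charged for what it reads, so a time bound is also a size bound. Composition
of polynomial-time functions rests on this. -/
theorem Runs.size_le {c : Prog} {x y : BTree} {t : ℕ} (h : Runs c x y t) : y.size ≤ t := by
  induction h with
  | nil x => simpa [BTree.size] using x.one_le_size
  | id x => exact le_rfl
  | hd x => cases x <;> simp [BTree.hd, BTree.size]; omega
  | tl x => cases x <;> simp [BTree.tl, BTree.size]; omega
  | eq x => split <;> simp [BTree.size]; exact x.one_le_size
  | @pair _ _ x _ _ _ _ _ _ ih ih' => have := x.one_le_size; simp only [BTree.size]; omega
  | seq => omega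
  | ite_true => omega
  | ite_false => omega
  | loop_stop => omega
  | loop_step => omega

/-- The size of the code. -/
def sz {α : Type*} [TreeCode α] (a : α) : ℕ := (TreeCode.code a).size

/-- `n` is bounded by a polynomial in the size of the code of the argument. -/
def PolyBdd {α : Type*} [TreeCode α] (n : α → ℕ) : Prop :=
  ∃ p : Polynomial ℕ, ∀ a, n a ≤ p.eval (sz a)

section

variable {α β γ σ : Type*} [TreeCode α] [TreeCode β] [TreeCode γ] [TreeCode σ]

theorem one_le_sz (a : α) : 1 ≤ sz a := BTree.one_le_size _

theorem sz_prod (a : α) (b : β) : sz (a, b) = sz a + sz b + 1 := rfl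

theorem sz_nil : sz ([] : List α) = 1 := rfl

theorem sz_cons (a : α) (l : List α) : sz (a :: l) = sz a + sz l + 1 := rfl

theorem sz_append (l m : List α) : sz (l ++ m) + 1 = sz l + sz m := by
  induction l with
  | nil => simp [sz_nil, add_comm]
  | cons a l ih => simp only [List.cons_append, sz_cons]; omega

theorem length_lt_sz (l : List α) : l.length < sz l := by
  induction l with
  | nil => simp [sz_nil]
  | cons a l ih => simp only [List.length_cons, sz_cons]; omega

theorem sz_reverse (l : List α) : sz l.reverse = sz l := by
  induction l with
  | nil => rfl
  | cons a l ih =>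
    have := sz_append l.reverse [a]
    simp only [List.reverse_cons, sz_cons, sz_nil] at *; omega

theorem sz_prefix_le {l m : List α} (h : l <+: m) : sz l ≤ sz m := by
  obtain ⟨r, rfl⟩ := h
  have := sz_append l r
  have := one_le_sz r
  omega

theorem sz_suffix_le {l m : List α} (h : l <:+ m) : sz l ≤ sz m := by
  obtain ⟨r, rfl⟩ := h
  have := sz_append r l
  have := one_le_sz r
  omega

theorem sz_le_of_mem {a : α} {l : List α} (h : a ∈ l) : sz a ≤ sz l := by
  induction l with
  | nil => simp at h
  | cons b l ih =>
    rw [sz_cons]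
    rcases List.mem_cons.1 h with rfl | h
    · omega
    · have := ih h; omega

theorem sz_list_le {l : List α} {N : ℕ} (h : ∀ a ∈ l, sz a ≤ N) :
    sz l ≤ l.length * (N + 1) + 1 := by
  induction l with
  | nil => simp [sz_nil]
  | cons a l ih =>
    have h1 := ih fun b hb => h b (List.mem_cons_of_mem _ hb)
    have h2 := h a List.mem_cons_self
    rw [sz_cons, List.length_cons]
    linarith [add_mul l.length 1 (N + 1)]

namespace PolyBdd

theorem mono {m n : α → ℕ} (h : PolyBdd n) (hmn : ∀ a, m a ≤ n a) : PolyBdd m :=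
  let ⟨p, hp⟩ := h
  ⟨p, fun a => (hmn a).trans (hp a)⟩

theorem const (k : ℕ) : PolyBdd fun _ : α => k := ⟨Polynomial.C k, fun _ => by simp⟩

theorem size : PolyBdd fun a : α => sz a := ⟨Polynomial.X, fun _ => by simp⟩

theorem add {m n : α → ℕ} (hm : PolyBdd m) (hn : PolyBdd n) : PolyBdd fun a => m a + n a :=
  let ⟨p, hp⟩ := hm
  let ⟨q, hq⟩ := hn
  ⟨p + q, fun a => by rw [Polynomial.eval_add]; exact add_le_add (hp a) (hq a)⟩

theorem mul {m n : α → ℕ} (hm : PolyBdd m) (hn : PolyBdd n) : PolyBdd fun a => m a * n a :=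
  let ⟨p, hp⟩ := hm
  let ⟨q, hq⟩ := hn
  ⟨p * q, fun a => by rw [Polynomial.eval_mul]; exact Nat.mul_le_mul (hp a) (hq a)⟩

end PolyBdd

namespace PolyTime

/-! ### Basic closure properties of polynomial time -/

/-- Programs see only codes, so changing the type under a fixed code is free. Constructors and
projections of structures that are coded as tuples are handled in this way. -/
theorem of_code_eq {f : α → β} {g : α → γ} (hg : PolyTime g)
    (h : ∀ a, TreeCode.code (f a) = TreeCode.code (g a)) : PolyTime f := by
  obtain ⟨c, p, hc⟩ := hg
  exact ⟨c, p, fun a => by rw [h a]; exact hc a⟩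

theorem of_code_eq' {f : α → γ} {g : β → γ} (hg : PolyTime g) (e : α → β)
    (h : ∀ a, TreeCode.code a = TreeCode.code (e a)) (hfg : ∀ a, f a = g (e a)) : PolyTime f := by
  obtain ⟨c, p, hc⟩ := hg
  exact ⟨c, p, fun a => by rw [h a, hfg a]; exact hc (e a)⟩

theorem size_bdd {f : α → β} (hf : PolyTime f) : PolyBdd fun a => sz (f a) := by
  obtain ⟨c, p, hc⟩ := hf
  refine ⟨p, fun a => ?_⟩
  obtain ⟨t, h, ht⟩ := hc a
  exact h.size_le.trans ht

theorem id : PolyTime fun a : α => a := ⟨Prog.id, Polynomial.X, fun _ => ⟨_, .id _, by simp⟩⟩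

theorem comp {g : β → γ} {f : α → β} (hg : PolyTime g) (hf : PolyTime f) :
    PolyTime fun a => g (f a) := by
  obtain ⟨c, p, hc⟩ := hf
  obtain ⟨d, q, hd⟩ := hg
  refine ⟨.seq c d, Polynomial.X + p + q.comp p, fun a => ?_⟩
  obtain ⟨s, h, hs⟩ := hc a
  obtain ⟨t, h', ht⟩ := hd (f a)
  refine ⟨_, .seq h h', ?_⟩
  simp only [Polynomial.eval_add, Polynomial.eval_X, Polynomial.eval_comp]
  have := eval_mono q (h.size_le.trans hs)
  omega

theorem prodMk {f : α → β} {g : α → γ} (hf : PolyTime f) (hg : PolyTime g) :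
    PolyTime fun a => (f a, g a) := by
  obtain ⟨c, p, hc⟩ := hf
  obtain ⟨d, q, hd⟩ := hg
  refine ⟨.pair c d, Polynomial.X + p + q, fun a => ?_⟩
  obtain ⟨s, h, hs⟩ := hc a
  obtain ⟨t, h', ht⟩ := hd a
  refine ⟨_, .pair h h', ?_⟩
  simp only [Polynomial.eval_add, Polynomial.eval_X]
  omega

theorem fst {f : α → β × γ} (hf : PolyTime f) : PolyTime fun a => (f a).1 :=
  comp (g := Prod.fst) ⟨.hd, .X, fun _ => ⟨_, .hd _, by simp⟩⟩ hf

theorem snd {f : α → β × γ} (hf : PolyTime f) : PolyTime fun a => (f a).2 :=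
  comp (g := Prod.snd) ⟨.tl, .X, fun _ => ⟨_, .tl _, by simp⟩⟩ hf

theorem const_tree (y : BTree) : ∃ (c : Prog) (k : ℕ), ∀ x, ∃ t, Runs c x y t ∧ t ≤ k * x.size := by
  induction y with
  | nil => exact ⟨.nil, 1, fun x => ⟨_, .nil x, by simp⟩⟩
  | node l r ihl ihr =>
    obtain ⟨c, j, hc⟩ := ihl
    obtain ⟨d, k, hd⟩ := ihr
    refine ⟨.pair c d, 1 + j + k, fun x => ?_⟩
    obtain ⟨s, h, hs⟩ := hc x
    obtain ⟨t, h', ht⟩ := hd x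
    exact ⟨_, .pair h h', by linarith⟩

theorem const (b : β) : PolyTime fun _ : α => b := by
  obtain ⟨c, k, hc⟩ := const_tree (TreeCode.code b)
  refine ⟨c, .C k * .X, fun a => ?_⟩
  simpa using hc _

theorem decide_eq [DecidableEq β] {f g : α → β} (hf : PolyTime f) (hg : PolyTime g) :
    PolyTime fun a => decide (f a = g a) := by
  refine comp (g := fun p : β × β => decide (p.1 = p.2)) (f := fun a => (f a, g a)) ?_ (prodMk hf hg)
  refine ⟨.eq, .X + 2, fun p => ⟨(TreeCode.code p).size + 2, ?_, by simp⟩⟩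
  have h : (TreeCode.code (decide (p.1 = p.2)) : BTree) =
      if (TreeCode.code p).hd = (TreeCode.code p).tl then BTree.node BTree.nil BTree.nil
      else BTree.nil := by
    have : (TreeCode.code p).hd = (TreeCode.code p).tl ↔ p.1 = p.2 := TreeCode.inj.eq_iff
    by_cases hp : p.1 = p.2
    · rw [if_pos (this.2 hp)]; simp [hp, TreeCode.code]
    · rw [if_neg (mt this.1 hp)]; simp [hp, TreeCode.code]
  exact h ▸ .eq _

theorem ite {P : α → Prop} [DecidablePred P] {f g : α → β} (hP : PolyTime fun a => decide (P a))
    (hf : PolyTime f) (hg : PolyTime g) : PolyTime fun a => if P a then f a else g a := by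
  obtain ⟨c, p, hc⟩ := hP
  obtain ⟨d, q, hd⟩ := hf
  obtain ⟨e, r, he⟩ := hg
  refine ⟨.ite c d e, .X + p + q + r, fun a => ?_⟩
  obtain ⟨s, h, hs⟩ := hc a
  simp only [Polynomial.eval_add, Polynomial.eval_X]
  by_cases ha : P a
  · obtain ⟨t, h', ht⟩ := hd a
    rw [if_pos ha]
    refine ⟨_, .ite_true h ?_ h', by omega⟩
    simp [ha, TreeCode.code]
  · obtain ⟨t, h', ht⟩ := he a
    rw [if_neg ha]
    refine ⟨_, .ite_false (s := s) ?_ h', by omega⟩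
    simpa [ha, TreeCode.code] using h

/-- One program for each `i` is hard-wired behind a chain of equality tests. No uniformity in `i` is
needed, so this covers field arithmetic as well as derivations that are merely chosen. -/
theorem finite_dom {ι : Type*} [TreeCode ι] [Finite ι] {f : ι → α → β} (hf : ∀ i, PolyTime (f i)) :
    PolyTime fun p : ι × α => f p.1 p.2 := by
  classical
  rcases isEmpty_or_nonempty ι with hι | ⟨⟨i₀⟩⟩
  · exact ⟨.nil, 0, fun p => hι.elim p.1⟩
  have key : ∀ s : Set ι, s.Finite →
      ∃ g : ι × α → β, PolyTime g ∧ ∀ i ∈ s, ∀ a, g (i, a) = f i a := by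
    intro s hs
    induction s, hs using Set.Finite.induction_on with
    | empty => exact ⟨fun p => f i₀ p.2, comp (hf i₀) (snd id), by simp⟩
    | @insert i s _ _ ih =>
      obtain ⟨g, hg, hgs⟩ := ih
      refine ⟨fun p => if p.1 = i then f i p.2 else g p,
        ite (decide_eq (fst id) (const i)) (comp (hf i) (snd id)) hg, ?_⟩
      intro j hj a
      by_cases hji : j = i
      · simp [hji]
      · simp only [hji, if_false]
        exact hgs j (hj.resolve_left hji) a
  obtain ⟨g, hg, h⟩ := key Set.univ Set.finite_univ
  have : (fun p : ι × α => f p.1 p.2) = g := by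
    funext ⟨i, a⟩; exact (h i trivial a).symm
  rw [this]; exact hg

theorem finite_case {ι : Type*} [TreeCode ι] [Finite ι] {f : ι → α → β} {e : α → ι}
    (he : PolyTime e) (hf : ∀ i, PolyTime (f i)) : PolyTime fun a => f (e a) a :=
  comp (g := fun p : ι × α => f p.1 p.2) (f := fun a => (e a, a)) (finite_dom hf) (prodMk he id)

theorem finite_fun {ι : Type*} [TreeCode ι] [Finite ι] (g : ι → β) {e : α → ι}
    (he : PolyTime e) : PolyTime fun a => g (e a) :=
  finite_case (f := fun i _ => g i) he fun i => const (g i)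

theorem not {P : α → Prop} [DecidablePred P] (hP : PolyTime fun a => decide (P a)) :
    PolyTime fun a => decide (¬ P a) := by
  have := finite_fun (fun b : Bool => !b) hP
  simpa using this

/-! ### Loops -/

/-- A round costs at most `T` each for reading the state, the test and the body; the final failing
test is counted as one more round. -/
theorem runs_loop {c p : Prog} {T : ℕ} (N : ℕ) (x : ℕ → BTree)
    (hc : ∀ i < N, ∃ y t, Runs c (x i) y t ∧ y ≠ .nil ∧ t ≤ T)
    (hp : ∀ i < N, ∃ t, Runs p (x i) (x (i + 1)) t ∧ t ≤ T)
    (hN : ∃ t, Runs c (x N) .nil t ∧ t ≤ T) (hx : ∀ i ≤ N, (x i).size ≤ T) :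
    ∃ t, Runs (.loop c p) (x 0) (x N) t ∧ t ≤ (N + 1) * (3 * T) := by
  induction N generalizing x with
  | zero =>
    obtain ⟨t, h, ht⟩ := hN
    have := hx 0 le_rfl
    exact ⟨_, by constructor; exact h, by omega⟩
  | succ N ih =>
    obtain ⟨y, t, h, hy, ht⟩ := hc 0 (by omega)
    obtain ⟨u, h', hu⟩ := hp 0 (by omega)
    obtain ⟨v, h'', hv⟩ := ih (fun i => x (i + 1)) (fun i hi => hc _ (by omega))
      (fun i hi => hp _ (by omega)) hN (fun i hi => hx _ (by omega))
    have := hx 0 (by omega)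
    refine ⟨_, .loop_step h hy h' h'', ?_⟩
    linarith [add_mul (N + 1) 1 (3 * T)]

/-- The loop state consists of the parameter, the rest of the list and the accumulator. The bound on
all intermediate accumulators cannot be dropped: a polynomial-time step may double the size in every
round. -/
theorem foldl {l : α → List β} {s : α → σ} {g : α → σ → β → σ} (hl : PolyTime l) (hs : PolyTime s)
    (hg : PolyTime fun p : α × σ × β => g p.1 p.2.1 p.2.2) (n : α → ℕ) (hn : PolyBdd n)
    (hb : ∀ a l', l' <+: l a → sz (l'.foldl (g a) (s a)) ≤ n a) :
    PolyTime fun a => (l a).foldl (g a) (s a) := by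
  -- The body is stated for a pair of head and tail, which has the same code as a nonempty list; the
  -- loop test guarantees nonemptiness.
  have h1 : PolyTime fun q : α × (β × List β) × σ => (q.1, q.2.1.2, g q.1 q.2.2 q.2.1.1) :=
    prodMk (fst id) (prodMk (snd (fst (snd id)))
      (comp hg (prodMk (fst id) (prodMk (snd (snd id)) (fst (fst (snd id)))))))
  have h2 : PolyTime fun q : α × List β × σ => q.2.1 := fst (snd id)
  obtain ⟨p, P, hp⟩ := h1
  obtain ⟨c, C, hc⟩ := h2
  have hS : PolyTime fun a => (a, l a, s a) := prodMk id (prodMk hl hs)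
  obtain ⟨d, E, hd⟩ := snd (snd (id (α := α × List β × σ)))
  obtain ⟨Q, hQ⟩ := (PolyBdd.size.add (hl.size_bdd.add (hn.add (PolyBdd.const 2))))
  have hlp := hl.size_bdd
  obtain ⟨Ln, hLn⟩ := hlp
  obtain ⟨e, G, he⟩ := hS
  refine ⟨.seq e (.seq (.loop c p) d), .X + G + (G + (Ln + 1) * (3 * (P.comp Q + C.comp Q + Q)) +
    E.comp Q), fun a => ?_⟩
  set N := (l a).length with hNdef
  set x : ℕ → α × List β × σ := fun i => (a, (l a).drop i, ((l a).take i).foldl (g a) (s a)) with hx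
  have hsz : ∀ i, sz (x i) ≤ Q.eval (sz a) := by
    intro i
    refine le_trans ?_ (hQ a)
    have h1 := hb a ((l a).take i) (List.take_prefix _ _)
    have h2 := sz_suffix_le (List.drop_suffix i (l a))
    simp only [hx, sz_prod]
    omega
  set T := (P.comp Q + C.comp Q + Q).eval (sz a) with hT
  have hT' : T = P.eval (Q.eval (sz a)) + C.eval (Q.eval (sz a)) + Q.eval (sz a) := by simp [hT]
  have hbound : ∀ (R : Polynomial ℕ) i, R.eval (TreeCode.code (x i)).size ≤ R.eval (Q.eval (sz a)) :=
    fun R i => eval_mono R (hsz i)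
  obtain ⟨t, ht, htT⟩ := runs_loop (c := c) (p := p) (T := T) N (fun i => TreeCode.code (x i))
    (by
      intro i hi
      obtain ⟨t, h, ht⟩ := hc (x i)
      refine ⟨_, t, h, ?_, ?_⟩
      · simp only [hx]
        rw [List.drop_eq_getElem_cons hi]
        simp [TreeCode.code, codeList]
      · have := hbound C i; omega)
    (by
      intro i hi
      obtain ⟨t, h, ht⟩ := hp (a, ((l a)[i], (l a).drop (i + 1)), ((l a).take i).foldl (g a) (s a))
      have e1 : TreeCode.code (a, ((l a)[i], (l a).drop (i + 1)),
          ((l a).take i).foldl (g a) (s a)) = TreeCode.code (x i) := by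
        simp only [hx]
        rw [List.drop_eq_getElem_cons hi]
        rfl
      have e2 : (a, (l a).drop (i + 1), g a (((l a).take i).foldl (g a) (s a)) (l a)[i]) =
          x (i + 1) := by
        simp only [hx]
        rw [List.take_add_one, List.foldl_append, List.getElem?_eq_getElem hi]
        simp
      rw [e1] at h ht
      rw [← e2]
      refine ⟨t, h, ?_⟩
      have := hbound P i; omega)
    (by
      obtain ⟨t, h, ht⟩ := hc (x N)
      have : (x N).2.1 = [] := by simp [hx, hNdef]
      simp only [this] at h
      exact ⟨t, h, by have := hbound C N; omega⟩)
    (fun i _ => (hsz i).trans (by omega))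
  obtain ⟨u, hu, huE⟩ := hd (x N)
  obtain ⟨v, hv, hvG⟩ := he a
  have e0 : (a, l a, s a) = x 0 := by simp [hx]
  have eN : (x N).2.2 = (l a).foldl (g a) (s a) := by simp [hx, hNdef]
  simp only [e0] at hv
  simp only [eN] at hu
  refine ⟨_, .seq hv (.seq ht hu), ?_⟩
  have h3 : (N + 1) * (3 * T) ≤ (Ln.eval (sz a) + 1) * (3 * T) := by
    gcongr
    have := length_lt_sz (l a)
    have : sz (l a) ≤ Ln.eval (sz a) := hLn a
    omega
  have h4 := hbound E N
  have h5 := hv.size_le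
  simp only [Polynomial.eval_add, Polynomial.eval_X, Polynomial.eval_mul, Polynomial.eval_one,
    Polynomial.eval_ofNat, Polynomial.eval_comp] at *
  unfold sz at *
  rw [← hT'] 
  omega

/-! ### Lists -/

theorem cons {f : α → β} {l : α → List β} (hf : PolyTime f) (hl : PolyTime l) :
    PolyTime fun a => f a :: l a :=
  of_code_eq (prodMk hf hl) fun _ => rfl

theorem reverse {l : α → List β} (hl : PolyTime l) : PolyTime fun a => (l a).reverse := by
  have : (fun a => (l a).reverse) = fun a => (l a).foldl (fun s b => b :: s) [] := by
    funext a; simp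
  rw [this]
  refine foldl (g := fun _ s b => b :: s) hl (const []) (cons (snd (snd id)) (fst (snd id)))
    _ hl.size_bdd fun a l' h => ?_
  have : l'.foldl (fun s b => b :: s) [] = l'.reverse := by simp
  rw [this, sz_reverse]
  exact sz_prefix_le h

theorem append {l m : α → List β} (hl : PolyTime l) (hm : PolyTime m) :
    PolyTime fun a => l a ++ m a := by
  have : (fun a => l a ++ m a) = fun a => (l a).reverse.foldl (fun s b => b :: s) (m a) := by
    funext a; simp
  rw [this]
  refine foldl (g := fun _ s b => b :: s) (reverse hl) hm (cons (snd (snd id)) (fst (snd id)))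
    _ (hl.size_bdd.add hm.size_bdd) fun a l' h => ?_
  have h1 : l'.foldl (fun s b => b :: s) (m a) = l'.reverse ++ m a := by simp
  have h2 := sz_append l'.reverse (m a)
  have h3 := sz_prefix_le h
  rw [sz_reverse] at h2 h3
  rw [h1]
  omega

theorem map {l : α → List β} {g : α → β → γ} (hl : PolyTime l)
    (hg : PolyTime fun p : α × β => g p.1 p.2) : PolyTime fun a => (l a).map (g a) := by
  have key : ∀ a (l' : List β), l'.foldl (fun s b => g a b :: s) [] = (l'.map (g a)).reverse := by
    intro a l'
    induction l' using List.reverseRecOn with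
    | nil => rfl
    | append_singleton l b ih => simp [ih]
  have : (fun a => (l a).map (g a)) =
      fun a => ((l a).foldl (fun s b => g a b :: s) []).reverse := by
    funext a; simp [key]
  rw [this]
  refine reverse ?_
  obtain ⟨p, hp⟩ := hg.size_bdd
  have hb : PolyBdd fun a => sz (l a) * (p.eval (sz a + sz (l a) + 1) + 1) + 1 := by
    refine .add (.mul hl.size_bdd (.add ?_ (.const 1))) (.const 1)
    obtain ⟨q, hq⟩ := (PolyBdd.size.add hl.size_bdd).add (PolyBdd.const 1)
    exact ⟨p.comp q, fun a => by rw [Polynomial.eval_comp]; exact eval_mono p (hq a)⟩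
  refine foldl (g := fun a s b => g a b :: s) hl (const [])
    (cons (comp hg (prodMk (fst id) (snd (snd id)))) (fst (snd id))) _ hb fun a l' h => ?_
  rw [key, sz_reverse]
  refine (sz_list_le (N := p.eval (sz a + sz (l a) + 1)) ?_).trans ?_
  · intro c hc
    obtain ⟨b, hb, rfl⟩ := List.mem_map.1 hc
    refine (hp (a, b)).trans (eval_mono p ?_)
    have := sz_le_of_mem (h.subset hb)
    rw [sz_prod]; omega
  · rw [List.length_map]
    have := length_lt_sz (l a)
    have := h.length_le
    gcongr
    omega

theorem flatten {l : α → List (List β)} (hl : PolyTime l) : PolyTime fun a => (l a).flatten := by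
  have key : ∀ l' : List (List β), l'.foldl (fun s b => s ++ b) [] = l'.flatten := by
    intro l'
    induction l' using List.reverseRecOn with
    | nil => rfl
    | append_singleton l b ih => simp [ih]
  have hsz : ∀ l' : List (List β), sz l'.flatten ≤ sz l' := by
    intro l'
    induction l' with
    | nil => exact le_rfl
    | cons b l' ih =>
      have := sz_append b l'.flatten
      rw [List.flatten_cons, sz_cons]; omega
  have : (fun a => (l a).flatten) = fun a => (l a).foldl (fun s b => s ++ b) [] := by
    funext a; rw [key]
  rw [this]
  refine foldl (g := fun _ s b => s ++ b) hl (const []) (append (fst (snd id)) (snd (snd id)))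
    _ hl.size_bdd fun a l' h => ?_
  rw [key]
  exact (hsz l').trans (sz_prefix_le h)

theorem flatMap {l : α → List β} {g : α → β → List γ} (hl : PolyTime l)
    (hg : PolyTime fun p : α × β => g p.1 p.2) : PolyTime fun a => (l a).flatMap (g a) := by
  simp only [List.flatMap_def]
  exact flatten (map hl hg)

theorem filter {l : α → List β} {P : α → β → Prop} [∀ a b, Decidable (P a b)] (hl : PolyTime l)
    (hP : PolyTime fun p : α × β => decide (P p.1 p.2)) :
    PolyTime fun a => (l a).filter (P a ·) := by
  have : (fun a => (l a).filter (P a ·)) =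
      fun a => (l a).flatMap fun b => if P a b then [b] else [] := by
    funext a
    induction l a with
    | nil => rfl
    | cons b l ih =>
      by_cases h : P a b <;> simp [h, ih]
  rw [this]
  exact flatMap hl (ite hP (cons (snd id) (const [])) (const []))

theorem tail {l : α → List β} (hl : PolyTime l) : PolyTime fun a => (l a).tail := by
  refine comp (g := List.tail) ⟨.tl, .X, fun l => ?_⟩ hl
  refine ⟨(TreeCode.code l).size, ?_, by simp⟩
  have : TreeCode.code l.tail = (TreeCode.code l).tl := by cases l <;> rfl
  rw [this]; exact .tl _

theorem headD {l : α → List β} {b : α → β} (hl : PolyTime l) (hb : PolyTime b) :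
    PolyTime fun a => (l a).headD (b a) := by
  obtain ⟨c, p, hc⟩ := hl
  obtain ⟨d, q, hd⟩ := hb
  refine ⟨.ite c (.seq c .hd) d, .X + .X + p + p + p + q, fun a => ?_⟩
  obtain ⟨s, h, hs⟩ := hc a
  obtain ⟨t, h', ht⟩ := hd a
  simp only [Polynomial.eval_add, Polynomial.eval_X]
  cases hla : l a with
  | nil =>
    rw [hla] at h
    exact ⟨_, .ite_false h h', by omega⟩
  | cons b' l' =>
    rw [hla] at h
    refine ⟨_, .ite_true h (by simp [TreeCode.code, codeList]) (.seq h (.hd _)), ?_⟩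
    have := h.size_le
    omega

theorem any {l : α → List β} {P : α → β → Prop} [∀ a b, Decidable (P a b)] (hl : PolyTime l)
    (hP : PolyTime fun p : α × β => decide (P p.1 p.2)) :
    PolyTime fun a => decide (∃ b ∈ l a, P a b) := by
  have h : PolyTime fun a => (l a).foldl (fun s b => s || decide (P a b)) false := by
    refine foldl (g := fun a s b => s || decide (P a b)) hl (const false)
      (finite_fun (fun b : Bool × Bool => b.1 || b.2)
        (prodMk (fst (snd id)) (comp hP (prodMk (fst id) (snd (snd id)))))) _ (.const 3)
      fun a l' _ => ?_
    generalize List.foldl _ _ _ = b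
    cases b <;> simp [sz, TreeCode.code, BTree.size]
  convert h using 2 with a
  have key : ∀ (l : List β) (s : Bool), l.foldl (fun s b => s || decide (P a b)) s =
      (s || decide (∃ b ∈ l, P a b)) := by
    intro l
    induction l with
    | nil => simp
    | cons b l ih => intro s; rw [List.foldl_cons, ih]; simp [Bool.or_assoc]
  simp [key]

theorem mem [DecidableEq β] {f : α → β} {l : α → List β} (hf : PolyTime f) (hl : PolyTime l) :
    PolyTime fun a => decide (f a ∈ l a) := by
  have := any (P := fun a b => f a = b) hl (decide_eq (comp hf (fst id)) (snd id))
  simpa using this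

theorem all {l : α → List β} {P : α → β → Prop} [∀ a b, Decidable (P a b)] (hl : PolyTime l)
    (hP : PolyTime fun p : α × β => decide (P p.1 p.2)) :
    PolyTime fun a => decide (∀ b ∈ l a, P a b) := by
  have := not (any (P := fun a b => ¬ P a b) hl (not hP))
  simpa using this

end PolyTime

end

attribute [fun_prop] PolyTime PolyTime.id PolyTime.const PolyTime.comp PolyTime.fst PolyTime.snd
  PolyTime.prodMk PolyTime.cons PolyTime.append PolyTime.map PolyTime.flatMap PolyTime.ite
  PolyTime.reverse PolyTime.tail PolyTime.headD PolyTime.flatten PolyTime.decide_eq PolyTime.mem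
  PolyTime.not PolyTime.any PolyTime.all PolyTime.filter

/-! ### Numbers in unary -/

/-- Natural numbers, to be coded in unary. -/
structure Unary where
  val : ℕ
  deriving DecidableEq

/-- The tree of a number in unary. -/
def unaryTree : ℕ → BTree
  | 0 => .nil
  | n + 1 => .node .nil (unaryTree n)

theorem unaryTree_size (n : ℕ) : (unaryTree n).size = 2 * n + 1 := by
  induction n with
  | zero => rfl
  | succ n ih => simp only [unaryTree, BTree.size, ih]; omega

/-- The number `n`, to be coded in unary. -/
def un (n : ℕ) : Unary := ⟨n⟩

@[simp]
theorem un_val (n : ℕ) : (un n).val = n := rfl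

instance : TreeCode Unary where
  code n := unaryTree n.val
  inj := by
    rintro ⟨m⟩ ⟨n⟩ h
    have := congrArg BTree.size h
    simp only [unaryTree_size] at this
    congr 1
    omega

theorem sz_unary (n : ℕ) : sz (un n) = 2 * n + 1 := unaryTree_size n

/-- The list of the values of `f` at the numbers below `n`. -/
def tab {β : Type*} (n : ℕ) (f : ℕ → β) : List β := (List.range n).map f

/-- The concatenation of the values of `f` at the numbers below `n`. -/
def ftab {β : Type*} (n : ℕ) (f : ℕ → List β) : List β := (List.range n).flatMap f

section

variable {α β γ σ : Type*} [TreeCode α] [TreeCode β] [TreeCode γ] [TreeCode σ]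

namespace PolyTime

/-- A number that can be written in unary is polynomially bounded, and so may serve as a loop count
or a dimension. This is why indices are kept in unary, while variables stay in binary. -/
theorem bdd_unary {n : α → ℕ} (hn : PolyTime fun a => un (n a)) : PolyBdd n :=
  hn.size_bdd.mono fun a => by rw [sz_unary]; omega

@[fun_prop]
theorem unary_val {u : α → Unary} (hu : PolyTime u) : PolyTime fun a => un (u a).val := hu

theorem unary_const (n : ℕ) : PolyTime fun _ : α => un n := const _

@[fun_prop]
theorem unary_succ {n : α → ℕ} (hn : PolyTime fun a => un (n a)) :
    PolyTime fun a => un (n a + 1) :=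
  of_code_eq (prodMk (const ([] : List Bool)) hn) fun _ => rfl

theorem code_replicate (n : ℕ) :
    TreeCode.code (List.replicate n ([] : List Bool)) = TreeCode.code (un n) := by
  induction n with
  | zero => rfl
  | succ n ih =>
    have : TreeCode.code (un (n + 1)) = .node .nil (TreeCode.code (un n)) := rfl
    rw [this, ← ih]
    rfl

/-- A unary number has the code of a list of empty lists, so iteration is a fold that ignores the
list elements. -/
theorem iterate {n : α → ℕ} {s : α → σ} {g : α → σ → σ} (hn : PolyTime fun a => un (n a))
    (hs : PolyTime s) (hg : PolyTime fun p : α × σ => g p.1 p.2) (b : α → ℕ) (hb : PolyBdd b)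
    (h : ∀ a, ∀ i ≤ n a, sz ((g a)^[i] (s a)) ≤ b a) : PolyTime fun a => (g a)^[n a] (s a) := by
  have hl : PolyTime fun a => List.replicate (n a) ([] : List Bool) :=
    of_code_eq hn fun a => code_replicate _
  have key : ∀ a (l : List (List Bool)), l.foldl (fun s _ => g a s) (s a) =
      (g a)^[l.length] (s a) := by
    intro a l
    induction l using List.reverseRecOn with
    | nil => rfl
    | append_singleton l b ih =>
      rw [List.foldl_append, ih, List.length_append, List.length_singleton,
        Function.iterate_succ_apply']
      rfl
  have := foldl (g := fun a s _ => g a s) hl hs (by fun_prop) b hb fun a l' hl' => by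
    rw [key]
    exact h a _ (by simpa using hl'.length_le)
  simpa [key] using this

@[fun_prop]
theorem unary_pred {n : α → ℕ} (hn : PolyTime fun a => un (n a)) :
    PolyTime fun a => un (n a - 1) := by
  refine comp (g := fun u : Unary => un (u.val - 1)) ⟨.tl, .X, fun u => ?_⟩ hn
  refine ⟨(TreeCode.code u).size, ?_, by simp⟩
  have : TreeCode.code (un (u.val - 1)) = (TreeCode.code u).tl := by
    obtain ⟨_ | n⟩ := u <;> rfl
  rw [this]; exact .tl _

@[fun_prop]
theorem unary_eq_zero {n : α → ℕ} (hn : PolyTime fun a => un (n a)) :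
    PolyTime fun a => decide (n a = 0) := by
  have h : ∀ n : ℕ, n = 0 ↔ un n = un 0 := fun n => ⟨fun h => by rw [h], congrArg Unary.val⟩
  simp only [h]
  exact decide_eq hn (const _)

@[fun_prop]
theorem unary_length {l : α → List β} (hl : PolyTime l) :
    PolyTime fun a => un (l a).length := by
  have key : ∀ l : List β, un l.length =
      l.foldl (fun s _ => un (s.val + 1)) (un 0) := by
    intro l
    induction l using List.reverseRecOn with
    | nil => rfl
    | append_singleton l b ih =>
      rw [List.foldl_append, ← ih, List.length_append]
      rfl
  simp only [key]
  refine foldl (g := fun _ s _ => un (s.val + 1)) hl (const _) (by fun_prop)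
    (fun a => 2 * sz (l a) + 1) (((PolyBdd.const 2).mul hl.size_bdd).add (.const 1)) fun a l' h => ?_
  rw [← key, sz_unary]
  have := h.length_le
  have := length_lt_sz (l a)
  omega

@[fun_prop]
theorem drop {l : α → List β} {n : α → ℕ} (hl : PolyTime l)
    (hn : PolyTime fun a => un (n a)) : PolyTime fun a => (l a).drop (n a) := by
  have key : ∀ (i : ℕ) (l : List β), l.drop i = List.tail^[i] l := by
    intro i
    induction i with
    | zero => intro l; rfl
    | succ i ih => intro l; rw [Function.iterate_succ_apply, ← ih, List.drop_tail]
  simp only [key]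
  refine iterate (g := fun _ l => l.tail) hn hl (by fun_prop) _ hl.size_bdd fun a i _ => ?_
  rw [← key]
  exact sz_suffix_le (List.drop_suffix _ _)

@[fun_prop]
theorem getD {l : α → List β} {n : α → ℕ} {b : α → β} (hl : PolyTime l)
    (hn : PolyTime fun a => un (n a)) (hb : PolyTime b) :
    PolyTime fun a => (l a).getD (n a) (b a) := by
  have : (fun a => (l a).getD (n a) (b a)) = fun a => ((l a).drop (n a)).headD (b a) := by
    funext a
    simp [List.headD_eq_head?_getD]
  rw [this]
  fun_prop

theorem unary_range {n : α → ℕ} (hn : PolyTime fun a => un (n a)) :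
    PolyTime fun a => (List.range (n a)).map un := by
  -- The range grows at its front: increment all entries, then prepend zero.
  have key : ∀ i : ℕ, (List.range i).map un =
      (fun s : List Unary => un 0 :: s.map fun u => un (u.val + 1))^[i] [] := by
    intro i
    induction i with
    | zero => rfl
    | succ i ih =>
      rw [Function.iterate_succ_apply', ← ih, List.range_succ_eq_map]
      simp [Function.comp_def]
  simp only [key]
  refine iterate (g := fun _ s => un 0 :: s.map fun u => un (u.val + 1)) hn (const [])
    (by fun_prop) (fun a => n a * (2 * n a + 1 + 1) + 1) ?_ fun a i hi => ?_
  · have h := bdd_unary hn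
    exact (h.mul ((((PolyBdd.const 2).mul h).add (.const 1)).add (.const 1))).add (.const 1)
  · rw [← key]
    refine (sz_list_le (N := 2 * n a + 1) fun u hu => ?_).trans ?_
    · obtain ⟨j, hj, rfl⟩ := List.mem_map.1 hu
      have := List.mem_range.1 hj
      rw [sz_unary]; omega
    · simp only [List.length_map, List.length_range]
      gcongr

@[fun_prop]
theorem tab {n : α → ℕ} {f : α → ℕ → β} (hn : PolyTime fun a => un (n a))
    (hf : PolyTime fun p : α × Unary => f p.1 p.2.val) :
    PolyTime fun a => HitSim.tab (n a) (f a) := by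
  have : (fun a => HitSim.tab (n a) (f a)) =
      fun a => ((List.range (n a)).map un).map fun u => f a u.val := by
    funext a; simp [HitSim.tab]
  rw [this]
  exact map (unary_range hn) hf

@[fun_prop]
theorem ftab {n : α → ℕ} {f : α → ℕ → List β} (hn : PolyTime fun a => un (n a))
    (hf : PolyTime fun p : α × Unary => f p.1 p.2.val) :
    PolyTime fun a => HitSim.ftab (n a) (f a) := by
  simp only [HitSim.ftab, List.flatMap_def]
  exact flatten (tab hn hf)

theorem foldl_range {n : α → ℕ} {s : α → σ} {g : α → σ → ℕ → σ}
    (hn : PolyTime fun a => un (n a)) (hs : PolyTime s)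
    (hg : PolyTime fun p : α × σ × Unary => g p.1 p.2.1 p.2.2.val) (b : α → ℕ) (hb : PolyBdd b)
    (h : ∀ a, ∀ i ≤ n a, sz ((List.range i).foldl (g a) (s a)) ≤ b a) :
    PolyTime fun a => (List.range (n a)).foldl (g a) (s a) := by
  have := foldl (g := fun a s (u : Unary) => g a s u.val) (unary_range hn) hs hg b hb
    fun a l' hl' => by
      have : l' = (List.range l'.length).map un := by
        have h1 := List.prefix_iff_eq_take.1 hl'
        have h2 : l'.length ≤ n a := by simpa using hl'.length_le
        rw [← List.map_take, List.take_range, min_eq_left h2] at h1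
        exact h1
      rw [this, List.foldl_map]
      exact h a _ (by simpa using hl'.length_le)
  simpa [List.foldl_map] using this

/-! ### Numbers in binary, finite types -/

theorem code_two_mul (n : ℕ) (hn : n ≠ 0) :
    TreeCode.code (2 * n) = TreeCode.code (false, n) := by
  have : (2 * n).bits = false :: n.bits := Nat.bit0_bits n hn
  change TreeCode.code (2 * n).bits = _
  rw [this]
  rfl

theorem two_mul {n : α → ℕ} (hn : PolyTime n) : PolyTime fun a => 2 * n a := by
  refine comp (g := fun n => 2 * n) ?_ hn
  obtain ⟨c, p, hc⟩ := prodMk (const (α := ℕ) false) id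
  -- Doubling prefixes a zero bit, except that zero is the empty bit string and must remain so;
  -- hence the test.
  refine ⟨.ite .id c .id, .X + .X + .X + p, fun n => ?_⟩
  simp only [Polynomial.eval_add, Polynomial.eval_X]
  by_cases h : n = 0
  · subst h
    exact ⟨_, .ite_false (.id _) (.id _), by omega⟩
  · obtain ⟨t, ht, hp⟩ := hc n
    have h0 : TreeCode.code n ≠ .nil := TreeCode.inj.ne (a₂ := (0 : ℕ)) h
    rw [code_two_mul n h]
    exact ⟨_, .ite_true (.id _) h0 ht, by omega⟩

@[fun_prop]
theorem two_mul_add_one {n : α → ℕ} (hn : PolyTime n) : PolyTime fun a => 2 * n a + 1 := by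
  refine of_code_eq (prodMk (const true) hn) fun a => ?_
  have : (2 * n a + 1).bits = true :: (n a).bits := Nat.bit1_bits _
  change TreeCode.code (2 * n a + 1).bits = _
  rw [this]
  rfl

theorem sz_two_pow_mul (i n : ℕ) : sz (2 ^ i * n) ≤ sz n + 2 * i := by
  induction i with
  | zero => simp
  | succ i ih =>
    rw [pow_succ', mul_assoc]
    by_cases h : 2 ^ i * n = 0
    · rw [h]
      have := one_le_sz n
      have : sz (2 * 0) = 1 := rfl
      omega
    · have h1 : sz (2 * (2 ^ i * n)) = sz (false, 2 ^ i * n) :=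
        congrArg BTree.size (code_two_mul _ h)
      have h2 : sz false = 1 := rfl
      rw [h1, sz_prod]
      omega

@[fun_prop]
theorem two_pow_mul {i n : α → ℕ} (hi : PolyTime fun a => un (i a)) (hn : PolyTime n) :
    PolyTime fun a => 2 ^ i a * n a := by
  have key : ∀ i n : ℕ, 2 ^ i * n = (fun m => 2 * m)^[i] n := by
    intro i n
    induction i with
    | zero => simp
    | succ i ih => rw [Function.iterate_succ_apply', ← ih]; ring
  simp only [key]
  refine iterate (g := fun _ m => 2 * m) hi hn (two_mul (snd id)) _
    (hn.size_bdd.add ((PolyBdd.const 2).mul (bdd_unary hi))) fun a j hj => ?_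
  rw [← key]
  have := sz_two_pow_mul j (n a)
  omega

theorem sz_finite_le (K : Type*) [TreeCode K] [Finite K] : ∃ N, ∀ k : K, sz k ≤ N := by
  cases nonempty_fintype K
  exact ⟨∑ k : K, sz k, fun k => Finset.single_le_sum (f := sz) (fun _ _ => Nat.zero_le _)
    (Finset.mem_univ k)⟩

/-! ### Arithmetic of a finite field, by table lookup -/

section Field

variable {K : Type} [Field K] [Finite K] [TreeCode K] {f g : α → K}

@[fun_prop]
theorem field_add (hf : PolyTime f) (hg : PolyTime g) : PolyTime fun a => f a + g a :=
  finite_fun (fun p : K × K => p.1 + p.2) (prodMk hf hg)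

@[fun_prop]
theorem field_sub (hf : PolyTime f) (hg : PolyTime g) : PolyTime fun a => f a - g a :=
  finite_fun (fun p : K × K => p.1 - p.2) (prodMk hf hg)

@[fun_prop]
theorem field_mul (hf : PolyTime f) (hg : PolyTime g) : PolyTime fun a => f a * g a :=
  finite_fun (fun p : K × K => p.1 * p.2) (prodMk hf hg)

@[fun_prop]
theorem field_neg (hf : PolyTime f) : PolyTime fun a => -f a :=
  finite_fun (fun k => -k) hf

@[fun_prop]
theorem field_inv (hf : PolyTime f) : PolyTime fun a => (f a)⁻¹ :=
  finite_fun (fun k => k⁻¹) hf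

@[fun_prop]
theorem field_sum {n : α → ℕ} {f : α → ℕ → K} (hn : PolyTime fun a => un (n a))
    (hf : PolyTime fun p : α × Unary => f p.1 p.2.val) :
    PolyTime fun a => ∑ i ∈ Finset.range (n a), f a i := by
  have key : ∀ (n : ℕ) (f : ℕ → K), ∑ i ∈ Finset.range n, f i =
      (List.range n).foldl (fun s i => s + f i) 0 := by
    intro n f
    induction n with
    | zero => rfl
    | succ n ih => rw [Finset.sum_range_succ, ih, List.range_succ, List.foldl_append]; rfl
  simp only [key]
  obtain ⟨N, hN⟩ := sz_finite_le K
  exact foldl_range (g := fun a s i => s + f a i) hn (const 0)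
    (field_add (fst (snd id)) (comp hf (prodMk (fst id) (snd (snd id))))) _ (.const N)
    fun a i _ => hN _

end Field

/-! ### Literals, variables, monomials and formulas -/

@[fun_prop]
theorem lit_var {l : α → Lit} (hl : PolyTime l) : PolyTime fun a => (l a).var :=
  comp (g := Lit.var) (of_code_eq' (fst id) (fun l : Lit => (l.var, l.pos)) (fun _ => rfl)
    fun _ => rfl) hl

@[fun_prop]
theorem lit_pos {l : α → Lit} (hl : PolyTime l) : PolyTime fun a => (l a).pos :=
  comp (g := Lit.pos) (of_code_eq' (snd id) (fun l : Lit => (l.var, l.pos)) (fun _ => rfl)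
    fun _ => rfl) hl

@[fun_prop]
theorem lit_mk {v : α → ℕ} {p : α → Bool} (hv : PolyTime v) (hp : PolyTime p) :
    PolyTime fun a => Lit.mk (v a) (p a) :=
  of_code_eq (prodMk hv hp) fun _ => rfl

@[fun_prop]
theorem bool_not {b : α → Bool} (hb : PolyTime b) : PolyTime fun a => !b a :=
  finite_fun (fun b => !b) hb

@[fun_prop]
theorem lit_neg {l : α → Lit} (hl : PolyTime l) : PolyTime fun a => (l a).neg := by
  unfold Lit.neg
  fun_prop

@[fun_prop]
theorem pvar_orig {i : α → ℕ} (hi : PolyTime i) : PolyTime fun a => PVar.orig (i a) :=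
  of_code_eq (prodMk (const 0) hi) fun _ => rfl

@[fun_prop]
theorem pvar_dual {i : α → ℕ} (hi : PolyTime i) : PolyTime fun a => PVar.dual (i a) :=
  of_code_eq (prodMk (const 1) hi) fun _ => rfl

@[fun_prop]
theorem pvar_ext {i : α → ℕ} (hi : PolyTime i) : PolyTime fun a => PVar.ext (i a) :=
  of_code_eq (prodMk (const 2) hi) fun _ => rfl

@[fun_prop]
theorem lit_toPVar {l : α → Lit} (hl : PolyTime l) : PolyTime fun a => (l a).toPVar := by
  unfold Lit.toPVar
  have : PolyTime fun a => decide ((l a).pos = true) := decide_eq (by fun_prop) (const _)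
  fun_prop

@[fun_prop]
theorem term_mk {K : Type} [Finite K] [TreeCode K] {k : α → K} {m : α → List PVar}
    (hk : PolyTime k) (hm : PolyTime m) : PolyTime fun a => Term.mk (k a) (m a) :=
  of_code_eq (prodMk (finite_fun (fun k => (Finite.equivFin K k : ℕ)) hk) hm) fun _ => rfl

@[fun_prop]
theorem evar_orig {i : α → ℕ} (hi : PolyTime i) : PolyTime fun a => EVar.orig (i a) :=
  of_code_eq (prodMk (const 0) hi) fun _ => rfl

@[fun_prop]
theorem evar_ext {i : α → ℕ} (hi : PolyTime i) : PolyTime fun a => EVar.ext (i a) :=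
  of_code_eq (prodMk (const 1) hi) fun _ => rfl

variable {V : Type} [TreeCode V] {A B : α → Fml V}

@[fun_prop]
theorem fml_var {v : α → V} (hv : PolyTime v) : PolyTime fun a => Fml.var (v a) :=
  of_code_eq (prodMk (const 0) hv) fun _ => rfl

@[fun_prop]
theorem fml_neg (hA : PolyTime A) : PolyTime fun a => Fml.neg (A a) :=
  of_code_eq (prodMk (const 3) hA) fun _ => rfl

@[fun_prop]
theorem fml_and (hA : PolyTime A) (hB : PolyTime B) : PolyTime fun a => Fml.and (A a) (B a) :=
  of_code_eq (prodMk (const 4) (prodMk hA hB)) fun _ => rfl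

@[fun_prop]
theorem fml_or (hA : PolyTime A) (hB : PolyTime B) : PolyTime fun a => Fml.or (A a) (B a) :=
  of_code_eq (prodMk (const 5) (prodMk hA hB)) fun _ => rfl

@[fun_prop]
theorem fml_imp (hA : PolyTime A) (hB : PolyTime B) : PolyTime fun a => Fml.imp (A a) (B a) :=
  of_code_eq (prodMk (const 6) (prodMk hA hB)) fun _ => rfl

@[fun_prop]
theorem fml_iff (hA : PolyTime A) (hB : PolyTime B) : PolyTime fun a => Fml.iff (A a) (B a) :=
  of_code_eq (prodMk (const 7) (prodMk hA hB)) fun _ => rfl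

@[fun_prop]
theorem fml_xor (hA : PolyTime A) (hB : PolyTime B) : PolyTime fun a => Fml.xor (A a) (B a) :=
  of_code_eq (prodMk (const 8) (prodMk hA hB)) fun _ => rfl

@[fun_prop]
theorem lit_toFml {l : α → Lit} (hl : PolyTime l) : PolyTime fun a => (l a).toFml := by
  unfold Lit.toFml
  have : PolyTime fun a => decide ((l a).pos = true) := decide_eq (by fun_prop) (const _)
  fun_prop

/-- By `hk` the operation adds only a constant to the total size of its arguments, so the folded
formula is linear in the size of the list and the start formula. -/
theorem foldl_fml {op : Fml V → Fml V → Fml V} {l : α → List (Fml V)} {s : α → Fml V}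
    (hop : PolyTime fun p : Fml V × Fml V => op p.1 p.2) (k : ℕ)
    (hk : ∀ A B, sz (op A B) ≤ sz A + sz B + k) (hl : PolyTime l) (hs : PolyTime s) :
    PolyTime fun a => (l a).foldl op (s a) := by
  have key : ∀ (l : List (Fml V)) s, sz (l.foldl op s) ≤ sz s + (sz l + l.length * k) := by
    intro l
    induction l with
    | nil => intro s; simp
    | cons A l ih =>
      intro s
      have h1 := ih (op s A)
      have h2 := hk s A
      rw [List.foldl_cons, sz_cons, List.length_cons]
      linarith [add_mul l.length 1 k]
  refine foldl (g := fun _ s A => op s A) hl hs (comp hop (snd id))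
    (fun a => sz (s a) + (sz (l a) + sz (l a) * k))
    (hs.size_bdd.add (hl.size_bdd.add (hl.size_bdd.mul (.const k)))) fun a l' h => ?_
  refine (key l' (s a)).trans ?_
  have := sz_prefix_le h
  have := length_lt_sz l'
  gcongr
  omega

theorem sz_xor (A B : Fml V) : sz (A.xor B) = sz A + sz B + (sz 8 + 2) := by
  change sz (8, (A, B)) = _
  simp only [sz_prod]; ring

theorem sz_or (A B : Fml V) : sz (A.or B) = sz A + sz B + (sz 5 + 2) := by
  change sz (5, (A, B)) = _
  simp only [sz_prod]; ring

@[fun_prop]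
theorem foldl_xor {l : α → List (Fml V)} {s : α → Fml V} (hl : PolyTime l) (hs : PolyTime s) :
    PolyTime fun a => (l a).foldl Fml.xor (s a) :=
  foldl_fml (by fun_prop) _ (fun A B => (sz_xor A B).le) hl hs

@[fun_prop]
theorem clause_toFml {C : α → Clause} (hC : PolyTime C) : PolyTime fun a => (C a).toFml := by
  have : (fun a => (C a).toFml) =
      fun a => ((C a).reverse.map Lit.toFml).foldl (fun A B => Fml.or B A) Fml.ff := by
    funext a
    rw [Clause.toFml, List.foldl_map, List.foldl_reverse]
  rw [this]
  exact foldl_fml (by fun_prop) _ (fun A B => by rw [sz_or, add_comm (sz B)]) (by fun_prop) (const _)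

/-- The schema `A` is fixed and only the substituents are input, so the induction on `A` builds the
program and is not executed by it. -/
theorem subst {σ : α → List (Fml V)} (hσ : PolyTime σ) (A : Fml ℕ) :
    PolyTime fun a => A.subst fun n => (σ a).getD n Fml.ff := by
  induction A with
  | var n => exact getD hσ (unary_const n) (const _)
  | tt => exact const _
  | ff => exact const _
  | neg A ih => exact fml_neg ih
  | and A B ih ih' => exact fml_and ih ih'
  | or A B ih ih' => exact fml_or ih ih'
  | imp A B ih ih' => exact fml_imp ih ih'
  | iff A B ih ih' => exact fml_iff ih ih'
  | xor A B ih ih' => exact fml_xor ih ih'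

theorem map_subst {σ : α → List (Fml V)} (hσ : PolyTime σ) (l : List (Fml ℕ)) :
    PolyTime fun a => l.map fun A => A.subst fun n => (σ a).getD n Fml.ff := by
  induction l with
  | nil => exact const _
  | cons A l ih => exact cons (subst hσ A) ih

end PolyTime

end

/-- A list with the same elements, without repetitions. -/
def nub {β : Type*} [DecidableEq β] (l : List β) : List β :=
  l.foldl (fun s b => if b ∈ s then s else b :: s) []

theorem nub_spec {β : Type*} [DecidableEq β] (l : List β) :
    (nub l).Nodup ∧ ∀ b, b ∈ nub l ↔ b ∈ l := by
  induction l using List.reverseRecOn with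
  | nil => simp [nub]
  | append_singleton l b ih =>
    have : nub (l ++ [b]) = if b ∈ nub l then nub l else b :: nub l := by
      rw [nub, List.foldl_append]; rfl
    rw [this]
    split_ifs with h
    · refine ⟨ih.1, fun c => ?_⟩
      rw [ih.2, List.mem_append, List.mem_singleton]
      refine ⟨Or.inl, ?_⟩
      rintro (h' | rfl)
      exacts [h', (ih.2 _).1 h]
    · refine ⟨List.nodup_cons.2 ⟨h, ih.1⟩, fun c => ?_⟩
      rw [List.mem_cons, ih.2, List.mem_append, List.mem_singleton, or_comm]

@[fun_prop]
theorem PolyTime.nub {α β : Type*} [TreeCode α] [TreeCode β] [DecidableEq β] {l : α → List β}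
    (hl : PolyTime l) : PolyTime fun a => nub (l a) := by
  have key : ∀ l : List β, sz (HitSim.nub l) ≤ sz l := by
    intro l
    induction l using List.reverseRecOn with
    | nil => exact le_rfl
    | append_singleton l b ih =>
      have h1 : HitSim.nub (l ++ [b]) =
          if b ∈ HitSim.nub l then HitSim.nub l else b :: HitSim.nub l := by
        rw [HitSim.nub, List.foldl_append]; rfl
      have h2 := sz_append l [b]
      rw [sz_cons, sz_nil] at h2
      rw [h1]
      split_ifs
      · omega
      · rw [sz_cons]; omega
  exact foldl (g := fun _ s b => if b ∈ s then s else b :: s) hl (const []) (by fun_prop) _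
    hl.size_bdd fun a l' h => (key l').trans (sz_prefix_le h)

theorem length_tab {β : Type*} (n : ℕ) (f : ℕ → β) : (tab n f).length = n := by simp [tab]

theorem getD_tab {β : Type*} {n i : ℕ} (hi : i < n) (f : ℕ → β) (b : β) :
    (tab n f).getD i b = f i := by
  simp [tab, List.getD_eq_getElem?_getD, hi]

theorem getD_map_of_lt {β γ : Type*} {l : List β} {i : ℕ} (hi : i < l.length) (f : β → γ) (b : β)
    (c : γ) : (l.map f).getD i c = f (l.getD i b) := by
  simp [List.getD_eq_getElem?_getD, hi]

theorem getD_mem {β : Type*} {l : List β} {i : ℕ} (hi : i < l.length) (b : β) : l.getD i b ∈ l := by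
  simp [List.getD_eq_getElem?_getD, hi]

theorem exists_getD_of_mem {β : Type*} {l : List β} {c : β} (h : c ∈ l) (b : β) :
    ∃ i < l.length, l.getD i b = c := by
  obtain ⟨i, hi, rfl⟩ := List.getElem_of_mem h
  exact ⟨i, hi, by simp [List.getD_eq_getElem?_getD, hi]⟩

/-! ### Gaussian elimination -/

section Elim

variable {K : Type} [Field K] [DecidableEq K]

/-- The component of a pair that is selected by a truth value. -/
def sel {β : Type*} (b : Bool) (p : β × β) : β := cond b p.1 p.2

/-- The first of the vectors with a nonzero entry at `j`, normalised; zero if there is none. -/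
def pivRow (D : ℕ) (vs : List (List K × List K)) (j : ℕ) : List K :=
  tab D fun i =>
    ((((vs.map Prod.fst ++ vs.map Prod.snd).filter fun v => v.getD j 0 ≠ 0).headD []).getD j 0)⁻¹ *
      (((vs.map Prod.fst ++ vs.map Prod.snd).filter fun v => v.getD j 0 ≠ 0).headD []).getD i 0

/-- One round of elimination: the entries at `j` are made zero. -/
def reduce (D : ℕ) (vs : List (List K × List K)) (j : ℕ) : List (List K × List K) :=
  vs.map fun p => (tab D fun i => p.1.getD i 0 - p.1.getD j 0 * (pivRow D vs j).getD i 0,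
    tab D fun i => p.2.getD i 0 - p.2.getD j 0 * (pivRow D vs j).getD i 0)

/-- The vectors after `j` rounds of elimination. -/
def reduced (D : ℕ) (vs : List (List K × List K)) (j : ℕ) : List (List K × List K) :=
  (List.range j).foldl (reduce D) vs

/-- The rows that span the given vectors, and the coordinates of the vectors in these rows. -/
def elim (D : ℕ) (vs : List (List K × List K)) : List (List K × List (K × K)) :=
  tab D fun j => (pivRow D (reduced D vs j) j,
    (reduced D vs j).map fun p => (p.1.getD j 0, p.2.getD j 0))

theorem reduced_succ (D : ℕ) (vs : List (List K × List K)) (j : ℕ) :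
    reduced D vs (j + 1) = reduce D (reduced D vs j) j := by
  rw [reduced, List.range_succ, List.foldl_append]
  rfl

theorem length_reduced (D : ℕ) (vs : List (List K × List K)) (j : ℕ) :
    (reduced D vs j).length = vs.length := by
  induction j with
  | zero => rfl
  | succ j ih => rw [reduced_succ, reduce, List.length_map, ih]

/-- The entries of a list of pairs of vectors. -/
def ent (vs : List (List K × List K)) (s : ℕ) (b : Bool) (i : ℕ) : K :=
  (sel b (vs.getD s ([], []))).getD i 0

theorem ent_reduced_succ {D : ℕ} {vs : List (List K × List K)} {s i : ℕ} (j : ℕ)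
    (hs : s < vs.length) (b : Bool) (hi : i < D) :
    ent (reduced D vs (j + 1)) s b i = ent (reduced D vs j) s b i -
      ent (reduced D vs j) s b j * (pivRow D (reduced D vs j) j).getD i 0 := by
  rw [reduced_succ]
  unfold ent reduce
  rw [getD_map_of_lt (by rwa [length_reduced]) _ ([], [])]
  cases b <;> exact getD_tab hi _ _

/-- All that is used of a pivot row: it lies in the span of the vectors, being a multiple of one of
them, and subtracting it clears column `j`. If the column is already clear, the row is zero. -/
theorem pivRow_spec (D : ℕ) (vs : List (List K × List K)) (j : ℕ) (hj : j < D) :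
    (∃ c s b, s < vs.length ∧ (∀ i < D, (pivRow D vs j).getD i 0 = c * ent vs s b i) ∧
      (pivRow D vs j).getD j 0 = 1) ∨
    ((∀ i < D, (pivRow D vs j).getD i 0 = 0) ∧ ∀ s b, s < vs.length → ent vs s b j = 0) := by
  set l := (vs.map Prod.fst ++ vs.map Prod.snd).filter fun v => v.getD j 0 ≠ 0 with hl
  have hrow : ∀ i < D, (pivRow D vs j).getD i 0 =
      ((l.headD []).getD j 0)⁻¹ * (l.headD []).getD i 0 := fun i hi => getD_tab hi _ _
  have hmem : ∀ s b, s < vs.length →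
      sel b (vs.getD s ([], [])) ∈ vs.map Prod.fst ++ vs.map Prod.snd := by
    intro s b hs
    have := getD_mem hs ([], [])
    cases b
    · exact List.mem_append_right _ (List.mem_map_of_mem this)
    · exact List.mem_append_left _ (List.mem_map_of_mem this)
  rcases h : l with _ | ⟨v, l'⟩
  · right
    refine ⟨fun i hi => by rw [hrow i hi, h]; simp, fun s b hs => ?_⟩
    by_contra hne
    have : sel b (vs.getD s ([], [])) ∈ l :=
      List.mem_filter.2 ⟨hmem s b hs, by simpa [ent] using hne⟩
    rw [h] at this
    simp at this
  · left
    have hv : v ∈ l := by rw [h]; exact List.mem_cons_self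
    obtain ⟨hv1, hv2⟩ := List.mem_filter.1 hv
    have hv2 : v.getD j 0 ≠ 0 := by simpa using hv2
    have hhead : l.headD [] = v := by rw [h]; rfl
    rw [hhead] at hrow
    have : ∃ s b, s < vs.length ∧ sel b (vs.getD s ([], [])) = v := by
      rcases List.mem_append.1 hv1 with h' | h' <;> obtain ⟨p, hp, rfl⟩ := List.mem_map.1 h' <;>
        obtain ⟨s, hs, rfl⟩ := exists_getD_of_mem hp ([], [])
      exacts [⟨s, true, hs, rfl⟩, ⟨s, false, hs, rfl⟩]
    obtain ⟨s, b, hs, rfl⟩ := this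
    exact ⟨_, s, b, hs, hrow, by rw [hrow j hj, inv_mul_cancel₀ hv2]⟩

/-- A cleared column stays clear, because later pivot rows are multiples of vectors that vanish
there. With `j = D` nothing remains of the vectors. -/
theorem ent_reduced_eq_zero {D : ℕ} {vs : List (List K × List K)} {s : ℕ} (hs : s < vs.length)
    (b : Bool) {j : ℕ} (hj : j ≤ D) {l : ℕ} (hl : l < j) : ent (reduced D vs j) s b l = 0 := by
  induction j generalizing s b l with
  | zero => omega
  | succ j ih =>
    rw [ent_reduced_succ j hs b (by omega)]
    rcases pivRow_spec D (reduced D vs j) j (by omega) with ⟨c, s', b', hs', hrow, h1⟩ | ⟨h1, h2⟩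
    · rw [length_reduced] at hs'
      rcases (Nat.lt_succ_iff_lt_or_eq.1 hl) with hlj | rfl
      · rw [hrow l (by omega), ih hs b (by omega) hlj, ih hs' b' (by omega) hlj]
        ring
      · rw [h1]; ring
    · rw [h1 l (by omega)]
      rcases (Nat.lt_succ_iff_lt_or_eq.1 hl) with hlj | rfl
      · rw [ih hs b (by omega) hlj]; ring
      · rw [h2 s b (by rwa [length_reduced])]; ring

/-- The entries of a matrix with coordinates. -/
def entry (L : List (List K × List (K × K))) (j i : ℕ) : K := (L.getD j ([], [])).1.getD i 0

/-- The coordinates of a matrix with coordinates. -/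
def coef (L : List (List K × List (K × K))) (j' j : ℕ) : K × K :=
  (L.getD j' ([], [])).2.getD j (0, 0)

theorem sum_coef_mul_entry_elim {D : ℕ} {vs : List (List K × List K)} {s i : ℕ} (b : Bool)
    (hs : s < vs.length) (hi : i < D) :
    ∑ j ∈ Finset.range D, sel b (coef (elim D vs) j s) * entry (elim D vs) j i = ent vs s b i := by
  -- The invariant: what the first `j` rounds subtracted, plus the remainder, is the original
  -- vector. The coordinate in row `j` is the entry at `j` just before round `j`.
  have key : ∀ j ≤ D, ∑ j ∈ Finset.range j, sel b (coef (elim D vs) j s) * entry (elim D vs) j i +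
      ent (reduced D vs j) s b i = ent vs s b i := by
    intro j hj
    induction j with
    | zero => simp [reduced]
    | succ j ih =>
      have h1 : entry (elim D vs) j i = (pivRow D (reduced D vs j) j).getD i 0 := by
        unfold entry elim
        rw [getD_tab (by omega)]
      have h2 : sel b (coef (elim D vs) j s) = ent (reduced D vs j) s b j := by
        unfold coef elim ent
        rw [getD_tab (by omega)]
        dsimp only
        rw [getD_map_of_lt (by rwa [length_reduced]) _ ([], [])]
        cases b <;> rfl
      rw [← ih (by omega), Finset.sum_range_succ, ent_reduced_succ j hs b hi, h1, h2]
      ring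
  rw [← key D le_rfl, ent_reduced_eq_zero hs b le_rfl hi, add_zero]

/-- The new rows lie in the span of the old vectors. Only this dual form, about annihilating
functionals `u`, is needed. -/
theorem sum_mul_entry_elim_eq_zero {D : ℕ} {vs : List (List K × List K)} (u : ℕ → K)
    (h : ∀ s b, s < vs.length → ∑ i ∈ Finset.range D, u i * ent vs s b i = 0) {j : ℕ} (hj : j < D) :
    ∑ i ∈ Finset.range D, u i * entry (elim D vs) j i = 0 := by
  have hp : ∀ j < D, (∀ s b, s < vs.length →
      ∑ i ∈ Finset.range D, u i * ent (reduced D vs j) s b i = 0) →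
      ∑ i ∈ Finset.range D, u i * (pivRow D (reduced D vs j) j).getD i 0 = 0 := by
    intro j hj hr
    rcases pivRow_spec D (reduced D vs j) j hj with ⟨c, s, b, hs, hrow, -⟩ | ⟨h1, -⟩
    · rw [length_reduced] at hs
      have : ∑ i ∈ Finset.range D, u i * (pivRow D (reduced D vs j) j).getD i 0 =
          c * ∑ i ∈ Finset.range D, u i * ent (reduced D vs j) s b i := by
        rw [Finset.mul_sum]
        exact Finset.sum_congr rfl fun i hi => by rw [hrow i (Finset.mem_range.1 hi)]; ring
      rw [this, hr s b hs, mul_zero]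
    · exact Finset.sum_eq_zero fun i hi => by rw [h1 i (Finset.mem_range.1 hi), mul_zero]
  have hr : ∀ j ≤ D, ∀ s b, s < vs.length →
      ∑ i ∈ Finset.range D, u i * ent (reduced D vs j) s b i = 0 := by
    intro j
    induction j with
    | zero => exact fun _ => h
    | succ j ih =>
      intro hj s b hs
      have h1 := ih (by omega) s b hs
      have h2 := hp j (by omega) (ih (by omega))
      calc ∑ i ∈ Finset.range D, u i * ent (reduced D vs (j + 1)) s b i
          = ∑ i ∈ Finset.range D, u i * ent (reduced D vs j) s b i -
            ent (reduced D vs j) s b j *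
              ∑ i ∈ Finset.range D, u i * (pivRow D (reduced D vs j) j).getD i 0 := by
            rw [Finset.mul_sum, ← Finset.sum_sub_distrib]
            refine Finset.sum_congr rfl fun i hi => ?_
            rw [ent_reduced_succ j hs b (Finset.mem_range.1 hi)]
            ring
        _ = 0 := by rw [h1, h2]; ring
  have := hp j hj (hr j hj.le)
  unfold entry elim
  rwa [getD_tab hj]

end Elim

/-! ### The matrices of a hitting formula -/

/-- The clauses of a formula without the tautological ones, preceded by the empty clause. -/
def clauses (H : CNF) : List Clause := [] :: H.filter fun C => ¬ ∃ l ∈ C, l.neg ∈ C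

/-- The `i`-th clause. -/
def cl (H : CNF) (i : ℕ) : Clause := (clauses H).getD i []

/-- The variables of a formula. -/
def vars (H : CNF) : List ℕ := nub (H.flatten.map Lit.var)

/-- The `k`-th variable. -/
def xv (H : CNF) (k : ℕ) : ℕ := (vars H).getD k 0

/-- The value at `x = b` of the part of the translation of `C` that concerns `x`. -/
def mask (K : Type) [Field K] (x : ℕ) (b : Bool) (C : Clause) : K := if Lit.mk x b ∈ C then 0 else 1

section Levels

variable (K : Type) [Field K] [DecidableEq K] (H : CNF)

/-- The rows, multiplied by the masks of both values of the variable `x`. -/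
def masked (x : ℕ) (L : List (List K × List (K × K))) : List (List K × List K) :=
  L.map fun r => (tab (clauses H).length fun i => mask K x true (cl H i) * r.1.getD i 0,
    tab (clauses H).length fun i => mask K x false (cl H i) * r.1.getD i 0)

/-- The matrix after `k` variables. -/
def lev (k : ℕ) : List (List K × List (K × K)) :=
  (List.range k).foldl (fun L k => elim (clauses H).length (masked K H (xv H k) L))
    (tab (clauses H).length fun j => (tab (clauses H).length fun _ => if j = 0 then 1 else 0, []))

theorem lev_succ (k : ℕ) :
    lev K H (k + 1) = elim (clauses H).length (masked K H (xv H k) (lev K H k)) := by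
  rw [lev, List.range_succ, List.foldl_append]
  rfl

theorem length_lev (k : ℕ) : (lev K H k).length = (clauses H).length := by
  cases k with
  | zero => exact length_tab _ _
  | succ k => rw [lev_succ]; exact length_tab _ _

variable {K H}

omit [DecidableEq K] in
theorem ent_masked {x s i : ℕ} {L : List (List K × List (K × K))} (b : Bool) (hs : s < L.length)
    (hi : i < (clauses H).length) :
    ent (masked K H x L) s b i = mask K x b (cl H i) * entry L s i := by
  unfold ent masked entry
  rw [getD_map_of_lt hs _ ([], [])]
  cases b <;> exact getD_tab hi _ _

/-- Row `j` of level `k`, restricted to the value `b` of the next variable, is expanded in the rows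
of level `k + 1`. These coordinates become the coefficients in the definitions of the extension
variables. -/
theorem sum_coef_mul_entry_lev (k : ℕ) {i j : ℕ} (b : Bool) (hj : j < (clauses H).length)
    (hi : i < (clauses H).length) :
    ∑ j' ∈ Finset.range (clauses H).length,
      sel b (coef (lev K H (k + 1)) j' j) * entry (lev K H (k + 1)) j' i =
    mask K (xv H k) b (cl H i) * entry (lev K H k) j i := by
  rw [lev_succ, sum_coef_mul_entry_elim b (by rwa [masked, List.length_map, length_lev]) hi,
    ent_masked b (by rwa [length_lev]) hi]

/-- Before any variable is read, all partial products are the empty product, so one row of ones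
suffices; the zero rows pad the matrix to the common size. -/
theorem entry_lev_zero {i j : ℕ} (hj : j < (clauses H).length) (hi : i < (clauses H).length) :
    entry (lev K H 0) j i = if j = 0 then 1 else 0 := by
  have : lev K H 0 = tab (clauses H).length fun j =>
    (tab (clauses H).length fun _ => if j = 0 then 1 else 0, []) := rfl
  rw [entry, this, getD_tab hj]
  exact getD_tab hi _ _

/-- The induction moves masks from the functional to the rows: on the rows of level `k`, the
functional weighted by the masks of the remaining variables vanishes. At level 0 this is the
hypothesis, at level `n` the claim. Assignments are indexed here by the position of a variable. -/
theorem sum_mul_entry_lev_eq_zero (u : ℕ → K) (n : ℕ)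
    (h : ∀ a : ℕ → Bool, ∑ i ∈ Finset.range (clauses H).length,
      u i * ∏ t ∈ Finset.range n, mask K (xv H t) (a t) (cl H i) = 0)
    {j : ℕ} (hj : j < (clauses H).length) :
    ∑ i ∈ Finset.range (clauses H).length, u i * entry (lev K H n) j i = 0 := by
  have key : ∀ k ≤ n, ∀ (a : ℕ → Bool), ∀ j < (clauses H).length,
      ∑ i ∈ Finset.range (clauses H).length,
        (u i * ∏ t ∈ Finset.Ico k n, mask K (xv H t) (a t) (cl H i)) * entry (lev K H k) j i
      = 0 := by
    intro k
    induction k with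
    | zero =>
      intro _ a j hj
      by_cases h0 : j = 0
      · rw [← h a, Finset.range_eq_Ico]
        refine Finset.sum_congr rfl fun i hi => ?_
        rw [entry_lev_zero hj (Finset.mem_Ico.1 hi).2, if_pos h0, mul_one, Finset.range_eq_Ico]
      · refine Finset.sum_eq_zero fun i hi => ?_
        rw [entry_lev_zero hj (Finset.mem_range.1 hi), if_neg h0, mul_zero]
    | succ k ih =>
      intro hk a j hj
      rw [lev_succ]
      refine sum_mul_entry_elim_eq_zero
        (fun i => u i * ∏ t ∈ Finset.Ico (k + 1) n, mask K (xv H t) (a t) (cl H i)) ?_ hj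
      intro s b hs
      rw [masked, List.length_map, length_lev] at hs
      -- The masked rows carry the factor for value `b` at position `k`, so the induction hypothesis
      -- is taken for the assignment with this value there; later positions are unaffected.
      rw [← ih (by omega) (Function.update a k b) s hs]
      refine Finset.sum_congr rfl fun i hi => ?_
      rw [ent_masked b (by rwa [length_lev]) (Finset.mem_range.1 hi),
        Finset.prod_eq_prod_Ico_succ_bot (a := k) (by omega), Function.update_self]
      have : ∏ t ∈ Finset.Ico (k + 1) n, mask K (xv H t) (Function.update a k b t) (cl H i) =
          ∏ t ∈ Finset.Ico (k + 1) n, mask K (xv H t) (a t) (cl H i) := by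
        refine Finset.prod_congr rfl fun t ht => ?_
        rw [Function.update_of_ne (by have := (Finset.mem_Ico.1 ht).1; omega)]
      rw [this]
      ring
  simpa using key n le_rfl (fun _ => false) j hj

end Levels

/-! ### The identity satisfied by an unsatisfiable hitting formula -/

section Hitting

variable {H : CNF}

theorem mem_clauses {C : Clause} (h : C ∈ clauses H) :
    (∀ l ∈ C, l.neg ∉ C) ∧ ∀ l ∈ C, l.var ∈ vars H := by
  rcases List.mem_cons.1 h with rfl | h
  · simp
  · obtain ⟨h1, h2⟩ := List.mem_filter.1 h
    refine ⟨by simpa using h2, fun l hl => ?_⟩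
    exact ((nub_spec _).2 _).2 (List.mem_map_of_mem (List.mem_flatten_of_mem h1 hl))

theorem nodup_vars : (vars H).Nodup := (nub_spec _).1

theorem xv_inj {s t : ℕ} (hs : s < (vars H).length) (ht : t < (vars H).length)
    (h : xv H s = xv H t) : s = t := by
  have : ∀ t (ht : t < (vars H).length), xv H t = (vars H)[t] := fun t ht => by
    simp [xv, List.getD_eq_getElem?_getD, ht]
  rw [this s hs, this t ht] at h
  exact (nodup_vars.getElem_inj_iff).1 h

theorem prod_mask {K : Type} [Field K] {C : Clause} (hC : ∀ l ∈ C, l.var ∈ vars H)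
    (a : ℕ → Bool) [Decidable (C.Holds a)] :
    ∏ t ∈ Finset.range (vars H).length, mask K (xv H t) (a (xv H t)) C =
      if C.Holds a then 0 else 1 := by
  split_ifs with h
  · obtain ⟨l, hl, hla⟩ := h
    obtain ⟨t, ht, hlt⟩ := exists_getD_of_mem (hC l hl) 0
    refine Finset.prod_eq_zero (Finset.mem_range.2 ht) (if_pos ?_)
    have : Lit.mk (xv H t) (a (xv H t)) = l := by
      change xv H t = _ at hlt
      rw [hlt, hla]
    rwa [this]
  · refine Finset.prod_eq_one fun t _ => if_neg fun hl => h ⟨⟨xv H t, a (xv H t)⟩, hl, rfl⟩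

/-- Falsifying a clause makes the contrary literal true in every other clause, so at most one clause
is falsified. The sum is therefore 0 or 1 in any characteristic. -/
theorem sum_falsified {K : Type} [Field K] (hH : H.IsHitting) (a : ℕ → Bool)
    [∀ C : Clause, Decidable (C.Holds a)] :
    (H.map fun C => if C.Holds a then (0 : K) else 1).sum =
      if ∀ C ∈ H, C.Holds a then 0 else 1 := by
  induction H with
  | nil => simp
  | cons C H ih =>
    obtain ⟨h1, h2⟩ := List.pairwise_cons.1 hH
    rw [List.map_cons, List.sum_cons, ih h2]
    by_cases hC : C.Holds a
    · simp [hC]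
    · have : ∀ D ∈ H, D.Holds a := by
        intro D hD
        obtain ⟨l, hl, hl'⟩ := h1 D hD
        refine ⟨l.neg, hl', ?_⟩
        have : ¬ l.Holds a := fun h => hC ⟨l, hl, h⟩
        simpa [Lit.Holds, Lit.neg, Bool.eq_not] using this
      simp [hC, if_pos this]

/-- Tautological clauses hold everywhere, so discarding them preserves unsatisfiability: exactly one
of the remaining clauses is falsified. -/
theorem clauses_sum {K : Type} [Field K] (hH : H.IsHitting) (hU : H.Unsat) (a : ℕ → Bool)
    [∀ C : Clause, Decidable (C.Holds a)] :
    ((clauses H).tail.map fun C => if C.Holds a then (0 : K) else 1).sum = 1 := by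
  rw [clauses, List.tail_cons, sum_falsified (hH.sublist List.filter_sublist), if_neg]
  intro h
  refine hU a fun C hC => ?_
  by_cases ht : ∃ l ∈ C, l.neg ∈ C
  · obtain ⟨l, hl, hl'⟩ := ht
    by_cases hla : l.Holds a
    · exact ⟨l, hl, hla⟩
    · exact ⟨l.neg, hl', by simpa [Lit.Holds, Lit.neg, Bool.eq_not] using hla⟩
  · exact h C (List.mem_filter.2 ⟨hC, by simpa using ht⟩)

theorem sum_entry_lev_last {K : Type} [Field K] [DecidableEq K] (hH : H.IsHitting) (hU : H.Unsat)
    {j : ℕ} (hj : j < (clauses H).length) :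
    ∑ i ∈ Finset.range (clauses H).tail.length, entry (lev K H (vars H).length) j (i + 1) =
      entry (lev K H (vars H).length) j 0 := by
  classical
  have hlen : (clauses H).length = (clauses H).tail.length + 1 := rfl
  -- The weight -1 belongs to the empty clause, whose value is always 1 and balances the sum of the
  -- others.
  have key := sum_mul_entry_lev_eq_zero (K := K) (H := H) (fun i => if i = 0 then -1 else 1)
    (vars H).length ?_ hj
  · rw [hlen, Finset.sum_range_succ'] at key
    simp only [Nat.add_eq_zero_iff, one_ne_zero, and_false, if_false, one_mul, if_true] at key
    linear_combination key
  · intro a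
    -- An assignment to positions becomes one to variables, which is possible because the list of
    -- variables has no repetitions.
    set a' : ℕ → Bool := fun v => a ((vars H).idxOf v) with ha'
    have ha : ∀ t ∈ Finset.range (vars H).length, a t = a' (xv H t) := by
      intro t ht
      have ht := Finset.mem_range.1 ht
      have : xv H t = (vars H)[t] := by simp [xv, List.getD_eq_getElem?_getD, ht]
      rw [ha', this]
      dsimp only
      rw [nodup_vars.idxOf_getElem]
    have hprod : ∀ i < (clauses H).length,
        ∏ t ∈ Finset.range (vars H).length, mask K (xv H t) (a t) (cl H i) =
        if (cl H i).Holds a' then 0 else 1 := by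
      intro i hi
      rw [← prod_mask (C := cl H i) (mem_clauses (getD_mem hi [])).2]
      exact Finset.prod_congr rfl fun t ht => by rw [ha t ht]
    rw [Finset.sum_congr rfl fun i hi => by rw [hprod i (Finset.mem_range.1 hi)]]
    rw [hlen, Finset.sum_range_succ', ← Finset.sum_congr rfl fun i _ => by
      rw [if_neg (Nat.succ_ne_zero i), one_mul]]
    have h0 : ¬ (cl H 0).Holds a' := by
      rintro ⟨l, hl, -⟩
      simp [cl, clauses] at hl
    rw [if_neg h0, if_pos rfl]
    have hs := clauses_sum (K := K) hH hU a'
    have : ∀ l : List Clause, (l.map fun C => if C.Holds a' then (0 : K) else 1).sum =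
        ∑ i ∈ Finset.range l.length, if (l.getD i []).Holds a' then (0 : K) else 1 := by
      intro l
      induction l with
      | nil => simp
      | cons C l ih =>
        rw [List.map_cons, List.sum_cons, ih, List.length_cons, Finset.sum_range_succ', add_comm]
        simp
    rw [this] at hs
    have h2 : ∀ i, (clauses H).tail.getD i [] = cl H (i + 1) := fun i => by simp [cl, clauses]
    simp only [h2] at hs
    rw [hs]
    ring

end Hitting

/-! ### The matrices are computable in polynomial time -/

section PolyTime

variable {α β : Type*} [TreeCode α] [TreeCode β]

theorem sz_tab_le {n N : ℕ} {f : ℕ → β} (h : ∀ i < n, sz (f i) ≤ N) :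
    sz (tab n f) ≤ n * (N + 1) + 1 := by
  refine (sz_list_le (N := N) fun b hb => ?_).trans (by rw [length_tab])
  obtain ⟨i, hi, rfl⟩ := List.mem_map.1 hb
  exact h i (List.mem_range.1 hi)

namespace PolyTime

@[fun_prop]
theorem clauses {H : α → CNF} (hH : PolyTime H) : PolyTime fun a => clauses (H a) := by
  unfold HitSim.clauses
  exact cons (const _) (filter (P := fun _ C => ¬ ∃ l ∈ C, l.neg ∈ C) hH (by fun_prop))

@[fun_prop]
theorem vars {H : α → CNF} (hH : PolyTime H) : PolyTime fun a => vars (H a) := by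
  unfold HitSim.vars
  fun_prop

@[fun_prop]
theorem cl {H : α → CNF} {i : α → ℕ} (hH : PolyTime H) (hi : PolyTime fun a => un (i a)) :
    PolyTime fun a => cl (H a) (i a) := by
  unfold HitSim.cl
  fun_prop

@[fun_prop]
theorem xv {H : α → CNF} {i : α → ℕ} (hH : PolyTime H) (hi : PolyTime fun a => un (i a)) :
    PolyTime fun a => xv (H a) (i a) := by
  unfold HitSim.xv
  fun_prop

@[fun_prop]
theorem mask {K : Type} [Field K] [TreeCode K] {x : α → ℕ} {b : α → Bool} {C : α → Clause} (hx : PolyTime x) (hb : PolyTime b)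
    (hC : PolyTime C) : PolyTime fun a => mask K (x a) (b a) (C a) := by
  unfold HitSim.mask
  fun_prop

@[fun_prop]
theorem entry {K : Type} [Field K] [TreeCode K] {L : α → List (List K × List (K × K))} {j i : α → ℕ} (hL : PolyTime L)
    (hj : PolyTime fun a => un (j a)) (hi : PolyTime fun a => un (i a)) :
    PolyTime fun a => entry (L a) (j a) (i a) := by
  unfold HitSim.entry
  fun_prop

@[fun_prop]
theorem coef {K : Type} [Field K] [TreeCode K] {L : α → List (List K × List (K × K))} {j i : α → ℕ} (hL : PolyTime L)
    (hj : PolyTime fun a => un (j a)) (hi : PolyTime fun a => un (i a)) :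
    PolyTime fun a => coef (L a) (j a) (i a) := by
  unfold HitSim.coef
  fun_prop

/-- The uniform bound `N` on field elements excludes any growth of entries during elimination, so
the size depends on the dimensions alone. -/
theorem sz_reduced_le {K : Type} [Field K] [DecidableEq K] [TreeCode K] {N : ℕ} (hN : ∀ k : K, sz k ≤ N) (D : ℕ) (vs : List (List K × List K))
    (j : ℕ) : sz (reduced D vs j) ≤ sz vs + (vs.length * (2 * (D * (N + 1) + 1) + 1 + 1) + 1) := by
  cases j with
  | zero => exact Nat.le_add_right _ _
  | succ j =>
    refine le_trans ?_ (Nat.le_add_left _ _)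
    rw [reduced_succ, HitSim.reduce, ← length_reduced D vs j]
    refine (sz_list_le (N := 2 * (D * (N + 1) + 1) + 1) fun p hp => ?_).trans
      (by rw [List.length_map])
    obtain ⟨q, -, rfl⟩ := List.mem_map.1 hp
    rw [sz_prod, _root_.two_mul]
    exact Nat.add_le_add_right (Nat.add_le_add (sz_tab_le fun i _ => hN _)
      (sz_tab_le fun i _ => hN _)) 1

variable {K : Type} [Field K] [DecidableEq K] [Finite K] [TreeCode K]

@[fun_prop]
theorem pivRow {D j : α → ℕ} {vs : α → List (List K × List K)} (hD : PolyTime fun a => un (D a))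
    (hvs : PolyTime vs) (hj : PolyTime fun a => un (j a)) :
    PolyTime fun a => pivRow (D a) (vs a) (j a) := by
  have hv : PolyTime fun p : Unary × List (List K × List K) × Unary =>
      ((p.2.1.map Prod.fst ++ p.2.1.map Prod.snd).filter
        fun v => v.getD p.2.2.val 0 ≠ 0).headD [] :=
    headD (filter (P := fun p (v : List K) => v.getD (Unary.val (Prod.snd (Prod.snd p))) 0 ≠ 0)
      (by fun_prop) (by fun_prop)) (const _)
  have : PolyTime fun p : Unary × List (List K × List K) × Unary =>
      HitSim.pivRow p.1.val p.2.1 p.2.2.val := by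
    unfold HitSim.pivRow
    fun_prop
  have h := comp this (prodMk hD (prodMk hvs hj))
  exact h

@[fun_prop]
theorem reduce {D j : α → ℕ} {vs : α → List (List K × List K)} (hD : PolyTime fun a => un (D a))
    (hvs : PolyTime vs) (hj : PolyTime fun a => un (j a)) :
    PolyTime fun a => reduce (D a) (vs a) (j a) := by
  have : PolyTime fun p : Unary × List (List K × List K) × Unary =>
      HitSim.reduce p.1.val p.2.1 p.2.2.val := by
    unfold HitSim.reduce
    fun_prop
  have h := comp this (prodMk hD (prodMk hvs hj))
  exact h

@[fun_prop]
theorem reduced {D j : α → ℕ} {vs : α → List (List K × List K)} (hD : PolyTime fun a => un (D a))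
    (hvs : PolyTime vs) (hj : PolyTime fun a => un (j a)) :
    PolyTime fun a => reduced (D a) (vs a) (j a) := by
  obtain ⟨N, hN⟩ := sz_finite_le K
  have hl : PolyBdd fun a => (vs a).length := hvs.size_bdd.mono fun a => (length_lt_sz _).le
  refine foldl_range (g := fun a s j => HitSim.reduce (D a) s j) hj hvs
    (reduce (comp (g := fun a => un (D a)) hD (fst id)) (fst (snd id)) (snd (snd id)))
    (fun a => sz (vs a) + ((vs a).length * (2 * (D a * (N + 1) + 1) + 1 + 1) + 1)) ?_
    fun a i _ => sz_reduced_le hN _ _ _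
  exact hvs.size_bdd.add ((hl.mul ((((PolyBdd.const 2).mul (((bdd_unary hD).mul (.const _)).add
    (.const _))).add (.const _)).add (.const _))).add (.const _))

@[fun_prop]
theorem elim {D : α → ℕ} {vs : α → List (List K × List K)} (hD : PolyTime fun a => un (D a))
    (hvs : PolyTime vs) : PolyTime fun a => elim (D a) (vs a) := by
  have : PolyTime fun p : Unary × List (List K × List K) => HitSim.elim p.1.val p.2 := by
    unfold HitSim.elim
    fun_prop
  have h := comp this (prodMk hD hvs)
  exact h

omit [DecidableEq K] in
@[fun_prop]
theorem masked {H : α → CNF} {x : α → ℕ} {L : α → List (List K × List (K × K))} (hH : PolyTime H)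
    (hx : PolyTime x) (hL : PolyTime L) : PolyTime fun a => masked K (H a) (x a) (L a) := by
  unfold HitSim.masked
  fun_prop

@[fun_prop]
theorem lev {H : α → CNF} {k : α → ℕ} (hH : PolyTime H) (hk : PolyTime fun a => un (k a)) :
    PolyTime fun a => lev K (H a) (k a) := by
  obtain ⟨N, hN⟩ := sz_finite_le K
  obtain ⟨N', hN'⟩ := sz_finite_le (K × K)
  have hD : PolyTime fun a => un (HitSim.clauses (H a)).length := by fun_prop
  have hD' := bdd_unary hD
  refine foldl_range (g := fun a L k => HitSim.elim (HitSim.clauses (H a)).length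
      (HitSim.masked K (H a) (HitSim.xv (H a) k) L)) hk ?_ (by fun_prop)
    (fun a => (HitSim.clauses (H a)).length * (((HitSim.clauses (H a)).length * (N + 1) + 1 +
      ((HitSim.clauses (H a)).length * (N' + 1) + 1) + 1) + 1) + 1) ?_ fun a i _ => ?_
  · fun_prop
  · exact ((hD'.mul (((((hD'.mul (.const _)).add (.const _)).add ((hD'.mul (.const _)).add
      (.const _))).add (.const _)).add (.const _))).add (.const _))
  · change sz (HitSim.lev K (H a) i) ≤ _
    cases i with
    | zero =>
      refine sz_tab_le fun j _ => ?_
      rw [sz_prod, sz_nil]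
      have := sz_tab_le (n := (HitSim.clauses (H a)).length)
        (f := fun _ => if j = 0 then (1 : K) else 0) fun i _ => hN _
      omega
    | succ i =>
      rw [lev_succ]
      refine sz_tab_le fun j _ => ?_
      rw [sz_prod]
      refine Nat.add_le_add_right (Nat.add_le_add (sz_tab_le fun i _ => hN _) ?_) 1
      refine (sz_list_le (N := N') fun b _ => hN' b).trans ?_
      rw [List.length_map, length_reduced, HitSim.masked, List.length_map, length_lev]

end PolyTime

end PolyTime

/-! ### Derivations built from segments -/

section Valid

variable {L : Type*} {step : Set L → L → Prop}

/-- Each entry of the list follows by `step` from entries before it and elements of `S`. -/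
def Valid (step : Set L → L → Prop) (S : Set L) (l : List L) : Prop :=
  ∀ pre p post, l = pre ++ p :: post → step (S ∪ {x | x ∈ pre}) p

/-- More premises do no harm. -/
def StepMono (step : Set L → L → Prop) : Prop := ∀ S T p, S ⊆ T → step S p → step T p

theorem Valid.nil (S : Set L) : Valid step S [] := by
  rintro pre p post h
  simp at h

theorem Valid.mono (hm : StepMono step) {S T : Set L} {l : List L} (h : Valid step S l)
    (hST : S ⊆ T) : Valid step T l := fun pre p post hl =>
  hm _ _ _ (Set.union_subset_union_left _ hST) (h pre p post hl)

/-- The second segment is checked over an arbitrary larger set `T`, so its proof needs only the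
membership facts it uses and not its position in the whole derivation. -/
theorem Valid.append (hm : StepMono step) {S : Set L} {l m : List L} (hl : Valid step S l)
    (h : ∀ T, S ⊆ T → (∀ x ∈ l, x ∈ T) → Valid step T m) : Valid step S (l ++ m) := by
  intro pre p post hlm
  rcases List.append_eq_append_iff.1 hlm with ⟨a, rfl, ha⟩ | ⟨b, rfl, hb⟩
  · have := h (S ∪ {x | x ∈ l}) Set.subset_union_left (fun x hx => Or.inr hx) a p post ha
    refine hm _ _ _ ?_ this
    rintro x ((hx | hx) | hx)
    · exact Or.inl hx
    · exact Or.inr (List.mem_append_left _ hx)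
    · exact Or.inr (List.mem_append_right _ hx)
  · cases b with
    | nil =>
      have := h (S ∪ {x | x ∈ pre}) Set.subset_union_left (fun x hx => Or.inr (by simpa using hx))
        [] p post (by simpa using hb.symm)
      simpa using this
    | cons q b =>
      simp only [List.cons_append, List.cons.injEq] at hb
      obtain ⟨rfl, -⟩ := hb
      exact hl pre p b rfl

theorem Valid.singleton {S : Set L} {p : L} (h : step S p) : Valid step S [p] := by
  intro pre q post hl
  cases pre with
  | nil => simp only [List.nil_append, List.cons.injEq] at hl; simpa [← hl.1] using h
  | cons a pre => simp at hl

theorem Valid.cons (hm : StepMono step) {S : Set L} {p : L} {l : List L} (hp : step S p)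
    (h : ∀ T, S ⊆ T → p ∈ T → Valid step T l) : Valid step S (p :: l) :=
  Valid.append (l := [p]) hm (Valid.singleton hp) fun T hT hp => h T hT (hp p (by simp))

theorem Valid.ftab (hm : StepMono step) {S : Set L} {n : ℕ} {f : ℕ → List L}
    (h : ∀ i < n, ∀ T, S ⊆ T → (∀ j < i, ∀ x ∈ f j, x ∈ T) → Valid step T (f i)) :
    Valid step S (ftab n f) := by
  induction n with
  | zero => exact Valid.nil S
  | succ n ih =>
    have : HitSim.ftab (n + 1) f = HitSim.ftab n f ++ f n := by
      simp [HitSim.ftab, List.range_succ]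
    rw [this]
    refine Valid.append hm (ih fun i hi => h i (by omega)) fun T hT hx => ?_
    refine h n (by omega) T hT fun j hj x hxj => hx x ?_
    exact List.mem_flatMap.2 ⟨j, List.mem_range.2 hj, hxj⟩

theorem tab_eq_ftab {β : Type*} (n : ℕ) (f : ℕ → β) : tab n f = ftab n fun i => [f i] := by
  exact (List.flatMap_pure_eq_map f _).symm

theorem Valid.tab (hm : StepMono step) {S : Set L} {n : ℕ} {f : ℕ → L}
    (h : ∀ i < n, ∀ T, S ⊆ T → (∀ j < i, f j ∈ T) → step T (f i)) :
    Valid step S (tab n f) := by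
  rw [tab_eq_ftab]
  refine Valid.ftab hm fun i hi T hT hx => Valid.singleton (h i hi T hT fun j hj => ?_)
  exact hx j hj _ (by simp)

theorem mem_tab {β : Type*} {n : ℕ} {f : ℕ → β} {b : β} : b ∈ tab n f ↔ ∃ i < n, f i = b := by
  simp [HitSim.tab]

theorem mem_ftab {β : Type*} {n : ℕ} {f : ℕ → List β} {b : β} :
    b ∈ ftab n f ↔ ∃ i < n, b ∈ f i := by
  simp [HitSim.ftab]

theorem ftab_succ {β : Type*} (n : ℕ) (f : ℕ → List β) : ftab (n + 1) f = ftab n f ++ f n := by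
  simp [ftab, List.range_succ]

theorem tab_succ {β : Type*} (n : ℕ) (f : ℕ → β) : tab (n + 1) f = tab n f ++ [f n] := by
  simp [tab, List.range_succ]

end Valid

/-! ### Names of the extension variables -/

/-- The name of the `j`-th extension variable at level `k`. -/
def ev (H : CNF) (k j : ℕ) : ℕ :=
  2 ^ j * (2 * (0 :: (vars H).map fun x => 2 * x + 1).getD k 0 + 1)

@[fun_prop]
theorem PolyTime.ev {α : Type*} [TreeCode α] {H : α → CNF} {k j : α → ℕ} (hH : PolyTime H)
    (hk : PolyTime fun a => un (k a)) (hj : PolyTime fun a => un (j a)) :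
    PolyTime fun a => ev (H a) (k a) (j a) := by
  unfold HitSim.ev
  fun_prop

/-- The exponent of 2 in a name encodes `j`, the odd part the level. Level 0 is marked by 0, and a
later level by `2x + 1` for the variable `x` just read. Using `x` instead of `k`, names are computed
by prefixing bits, without conversion from unary to binary. -/
theorem ev_inj {H : CNF} {k k' j j' : ℕ} (hk : k ≤ (vars H).length) (hk' : k' ≤ (vars H).length)
    (h : ev H k j = ev H k' j') : k = k' ∧ j = j' := by
  have aux : ∀ {j j' t t' : ℕ}, 2 ^ j * (2 * t + 1) = 2 ^ j' * (2 * t' + 1) → j ≤ j' →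
      j = j' ∧ t = t' := by
    intro j j' t t' h hjj
    obtain ⟨d, rfl⟩ := Nat.exists_eq_add_of_le hjj
    rw [pow_add, mul_assoc] at h
    have h := Nat.eq_of_mul_eq_mul_left (by positivity) h
    cases d with
    | zero => simp at h; exact ⟨rfl, h⟩
    | succ d => rw [pow_succ', mul_assoc] at h; omega
  have key : j = j' ∧ (0 :: (vars H).map fun x => 2 * x + 1).getD k 0 =
      (0 :: (vars H).map fun x => 2 * x + 1).getD k' 0 := by
    rcases le_total j j' with hjj | hjj
    · exact aux h hjj
    · obtain ⟨h1, h2⟩ := aux h.symm hjj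
      exact ⟨h1.symm, h2.symm⟩
  refine ⟨?_, key.1⟩
  have hS : ∀ k < (vars H).length, (0 :: (vars H).map fun x => 2 * x + 1).getD (k + 1) 0 =
      2 * xv H k + 1 := by
    intro k hk
    rw [List.getD_cons_succ, getD_map_of_lt hk _ 0]
    rfl
  rcases k with _ | k <;> rcases k' with _ | k'
  · rfl
  · have := key.2
    rw [hS k' (by omega), List.getD_cons_zero] at this
    omega
  · have := key.2
    rw [hS k (by omega), List.getD_cons_zero] at this
    omega
  · have := key.2
    rw [hS k (by omega), hS k' (by omega)] at this
    rw [xv_inj (by omega) (by omega) (show xv H k = xv H k' by omega)]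

/-- All names of extension variables, in the order of their definitions. -/
def names (H : CNF) : List ℕ :=
  ftab ((vars H).length + 1) fun k => tab (clauses H).length fun j => ev H k j

theorem nodup_names (H : CNF) : (names H).Nodup := by
  refine List.nodup_flatMap.2 ⟨fun k hk => ?_, ?_⟩
  · have hk := List.mem_range.1 hk
    exact List.nodup_range.map fun j j' h => (ev_inj (by omega) (by omega) h).2
  · refine List.Pairwise.imp_of_mem ?_ (List.nodup_range (n := (vars H).length + 1))
    intro k k' hk hk' hkk y hy hy'
    have hk := List.mem_range.1 hk
    have hk' := List.mem_range.1 hk'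
    obtain ⟨j, -, rfl⟩ := mem_tab.1 hy
    obtain ⟨j', -, h⟩ := mem_tab.1 hy'
    exact hkk (ev_inj (by omega) (by omega) h.symm).1

/-- The first clause of `F` that is contained in `C`. -/
def strengthening (F : CNF) (C : Clause) : Clause :=
  (F.filter fun C' => ∀ l ∈ C', l ∈ C).headD []

theorem strengthening_spec {F : CNF} {C : Clause} (h : ∃ C' ∈ F, C' ⊆ C) :
    strengthening F C ∈ F ∧ strengthening F C ⊆ C := by
  have hs : ∀ C', C' ∈ F.filter (fun C' => ∀ l ∈ C', l ∈ C) ↔ C' ∈ F ∧ C' ⊆ C := by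
    intro C'
    simp [List.mem_filter, List.subset_def]
  obtain ⟨C', h1, h2⟩ := h
  rw [← hs]
  have hne : F.filter (fun C' => ∀ l ∈ C', l ∈ C) ≠ [] :=
    List.ne_nil_of_mem ((hs C').2 ⟨h1, h2⟩)
  unfold strengthening
  cases hF : F.filter (fun C' => ∀ l ∈ C', l ∈ C) with
  | nil => exact absurd hF hne
  | cons D F' => simp

@[fun_prop]
theorem PolyTime.strengthening {α : Type*} [TreeCode α] {F : α → CNF} {C : α → Clause}
    (hF : PolyTime F) (hC : PolyTime C) : PolyTime fun a => strengthening (F a) (C a) := by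
  unfold HitSim.strengthening
  exact headD (filter (P := fun a (C' : Clause) => ∀ l ∈ C', l ∈ C a) hF
    (all (P := fun p l => l ∈ C (Prod.fst p)) (by fun_prop) (by fun_prop))) (const _)

theorem cl_succ_strengthening {F H : CNF} (h : ∀ C ∈ H, ∃ C' ∈ F, C' ⊆ C) {i : ℕ}
    (hi : i < (clauses H).tail.length) :
    strengthening F (cl H (i + 1)) ∈ F ∧ strengthening F (cl H (i + 1)) ⊆ cl H (i + 1) := by
  refine strengthening_spec (h _ ?_)
  have : cl H (i + 1) = (clauses H).tail.getD i [] := by simp [cl, clauses]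
  rw [this]
  exact List.mem_of_mem_filter (getD_mem hi [])

namespace PC

/-! ### The refutation in Ext-PC -/

section Lines

variable (K : Type) [Field K] [DecidableEq K] (F H : CNF)

/-- The variables in the translation of `C` that stem from `x`. -/
def fac (x : ℕ) (C : Clause) : List PVar :=
  if Lit.mk x true ∈ C then [.dual x] else if Lit.mk x false ∈ C then [.orig x] else []

/-- The part of the translation of the `i`-th clause that stems from the first `k` variables. -/
def part (k i : ℕ) : List PVar := ftab k fun t => fac (xv H t) (cl H i)

/-- The definition of the `j`-th extension variable at level `k`, multiplied by `s`. -/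
def extDef (s : K) (k j : ℕ) : Poly K :=
  if k = 0 then if j = 0 then [⟨s, []⟩] else []
  else ftab (clauses H).length fun j' =>
    [⟨s * (coef (lev K H k) j j').1, [.orig (xv H (k - 1)), .ext (ev H (k - 1) j')]⟩,
      ⟨s * (coef (lev K H k) j j').2, [.dual (xv H (k - 1)), .ext (ev H (k - 1) j')]⟩]

/-- The extension axiom for the `j`-th extension variable at level `k`, multiplied by `s`. -/
def defLine (s : K) (k j : ℕ) : Poly K := ⟨s, [.ext (ev H k j)]⟩ :: extDef K H (-s) k j

/-- The axiom `x + x^R - 1`. -/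
def dualLine (k : ℕ) : Poly K :=
  [⟨1, [.orig (xv H k)]⟩, ⟨1, [.dual (xv H k)]⟩, ⟨-1, []⟩]

/-- The axiom `x + x^R - 1` times `s` and an extension variable. -/
def dualTerm (s : K) (k j : ℕ) : Poly K :=
  [⟨s, [.ext (ev H k j), .orig (xv H k)]⟩, ⟨s, [.ext (ev H k j), .dual (xv H k)]⟩,
    ⟨-s, [.ext (ev H k j)]⟩]

/-- The polynomial that equals the product over the first `k` variables for the `i`-th clause. -/
def yPoly (k i : ℕ) : Poly K :=
  tab (clauses H).length fun j => ⟨entry (lev K H k) j i, [.ext (ev H k j)]⟩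

/-- The invariant of the refutation: as a consequence of the axioms, the linear form of clause `i`
at level `k` equals the partial translation of this clause. -/
def prodLine (k i : ℕ) : Poly K := yPoly K H k i ++ [⟨-1, part H k i⟩]

/-- A variable in the translation of the `i`-th clause that stems from the `k`-th variable. -/
def facVar (k i : ℕ) : PVar := (fac (xv H k) (cl H i)).headD (.orig (xv H k))

/-- It matters only for clauses that contain the `k`-th variable; for the others the default in
`facVar` makes it a harmless line. -/
def mulLine (k i : ℕ) : Poly K :=
  (tab (clauses H).length fun j =>
    ⟨entry (lev K H k) j i, [facVar H k i, .ext (ev H k j)]⟩) ++ [⟨-1, facVar H k i :: part H k i⟩]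

/-- Extension axioms of level `k + 1`, weighted by column `i` of the matrix. Partial sums are needed
because the rule combines two lines at a time. -/
def defSum (k i t : ℕ) : Poly K :=
  ftab t fun j => defLine K H (entry (lev K H (k + 1)) j i) (k + 1) j

def dualSum (k i t : ℕ) : Poly K := ftab t fun j => dualTerm K H (entry (lev K H k) j i) k j

def defLines : List (Poly K) :=
  ftab ((vars H).length + 1) fun k => tab (clauses H).length fun j => defLine K H 1 k j

def dualLines : List (Poly K) :=
  ftab (vars H).length fun k => dualLine K H k :: tab (clauses H).length fun j => dualTerm K H 1 k j

/-- The same lines are written whether or not clause `i` mentions the `k`-th variable; only the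
justification of the last one depends on it. -/
def stepLines (k i : ℕ) : List (Poly K) :=
  tab ((clauses H).length + 1) (fun t => defSum K H k i t) ++
    (tab ((clauses H).length + 1) (fun t => dualSum K H k i t) ++
      [defSum K H k i (clauses H).length ++ dualSum K H k i (clauses H).length, mulLine K H k i,
        prodLine K H (k + 1) i])

def clauseVars (i : ℕ) : List PVar := (nub (strengthening F (cl H (i + 1)))).map Lit.toPVar

def otherVars (i : ℕ) : List PVar :=
  (part H (vars H).length (i + 1)).filter fun v => ¬ v ∈ clauseVars F H i

/-- The translation of a clause of `F` is multiplied by the missing variables, one at a time, until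
it is the translation of the clause of `H`. The linear form of that clause follows. -/
def weakLines (i : ℕ) : List (Poly K) :=
  (tab ((otherVars F H i).length + 1) fun t =>
    [⟨1, (tab t fun s => (otherVars F H i).getD s (.orig 0)) ++ clauseVars F H i⟩]) ++
    [yPoly K H (vars H).length (i + 1)]

def lines : List (Poly K) :=
  defLines K H ++ ([[]] ++ (dualLines K H ++ (tab (clauses H).length (fun i => prodLine K H 0 i) ++
    ((ftab (vars H).length fun k => ftab (clauses H).length fun i => stepLines K H k i) ++
      ((ftab (clauses H).tail.length fun i => weakLines K F H i) ++
        ((tab ((clauses H).tail.length + 1) fun t =>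
          ftab t fun i => yPoly K H (vars H).length (i + 1)) ++ [[⟨1, []⟩]]))))))

def defs : List (ℕ × Poly K) :=
  ftab ((vars H).length + 1) fun k => tab (clauses H).length fun j =>
    (ev H k j, extDef K H 1 k j)

end Lines

/-! ### Polynomial-time constructibility of the Ext-PC refutation -/

section PolyTime

variable {α : Type*} [TreeCode α] {F H : α → CNF}

@[fun_prop]
theorem polyTime_fac {x : α → ℕ} {C : α → Clause} (hx : PolyTime x) (hC : PolyTime C) :
    PolyTime fun a => fac (x a) (C a) := by
  unfold fac
  fun_prop

@[fun_prop]
theorem polyTime_part {k i : α → ℕ} (hH : PolyTime H) (hk : PolyTime fun a => un (k a))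
    (hi : PolyTime fun a => un (i a)) : PolyTime fun a => part (H a) (k a) (i a) := by
  have : PolyTime fun p : CNF × Unary × Unary => part p.1 p.2.1.val p.2.2.val := by
    unfold part
    fun_prop
  have h := PolyTime.comp this (.prodMk hH (.prodMk hk hi))
  exact h

@[fun_prop]
theorem polyTime_facVar {k i : α → ℕ} (hH : PolyTime H) (hk : PolyTime fun a => un (k a))
    (hi : PolyTime fun a => un (i a)) : PolyTime fun a => facVar (H a) (k a) (i a) := by
  unfold facVar
  fun_prop

@[fun_prop]
theorem polyTime_clauseVars {i : α → ℕ} (hF : PolyTime F) (hH : PolyTime H)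
    (hi : PolyTime fun a => un (i a)) : PolyTime fun a => clauseVars (F a) (H a) (i a) := by
  unfold clauseVars
  fun_prop

@[fun_prop]
theorem polyTime_otherVars {i : α → ℕ} (hF : PolyTime F) (hH : PolyTime H)
    (hi : PolyTime fun a => un (i a)) : PolyTime fun a => otherVars (F a) (H a) (i a) := by
  have : PolyTime fun p : CNF × CNF × Unary => otherVars p.1 p.2.1 p.2.2.val := by
    unfold otherVars
    exact PolyTime.filter
      (P := fun (p : CNF × CNF × Unary) (v : PVar) => ¬ v ∈ clauseVars p.1 p.2.1 p.2.2.val)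
      (by fun_prop) (by fun_prop)
  have h := PolyTime.comp this (.prodMk hF (.prodMk hH hi))
  exact h

variable {K : Type} [Field K] [DecidableEq K] [Finite K] [TreeCode K]

@[fun_prop]
theorem polyTime_extDef {s : α → K} {k j : α → ℕ} (hH : PolyTime H) (hs : PolyTime s)
    (hk : PolyTime fun a => un (k a)) (hj : PolyTime fun a => un (j a)) :
    PolyTime fun a => extDef K (H a) (s a) (k a) (j a) := by
  have : PolyTime fun p : CNF × K × Unary × Unary =>
      extDef K p.1 p.2.1 p.2.2.1.val p.2.2.2.val := by
    unfold extDef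
    fun_prop
  have h := PolyTime.comp this (.prodMk hH (.prodMk hs (.prodMk hk hj)))
  exact h

@[fun_prop]
theorem polyTime_defLine {s : α → K} {k j : α → ℕ} (hH : PolyTime H) (hs : PolyTime s)
    (hk : PolyTime fun a => un (k a)) (hj : PolyTime fun a => un (j a)) :
    PolyTime fun a => defLine K (H a) (s a) (k a) (j a) := by
  unfold defLine
  fun_prop

omit [DecidableEq K] in
@[fun_prop]
theorem polyTime_dualTerm {s : α → K} {k j : α → ℕ} (hH : PolyTime H) (hs : PolyTime s)
    (hk : PolyTime fun a => un (k a)) (hj : PolyTime fun a => un (j a)) :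
    PolyTime fun a => dualTerm K (H a) (s a) (k a) (j a) := by
  unfold dualTerm
  fun_prop

@[fun_prop]
theorem polyTime_yPoly {k i : α → ℕ} (hH : PolyTime H)
    (hk : PolyTime fun a => un (k a)) (hi : PolyTime fun a => un (i a)) :
    PolyTime fun a => yPoly K (H a) (k a) (i a) := by
  have : PolyTime fun p : CNF × Unary × Unary => yPoly K p.1 p.2.1.val p.2.2.val := by
    unfold yPoly
    fun_prop
  have h := PolyTime.comp this (.prodMk hH (.prodMk hk hi))
  exact h

@[fun_prop]
theorem polyTime_prodLine {k i : α → ℕ} (hH : PolyTime H)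
    (hk : PolyTime fun a => un (k a)) (hi : PolyTime fun a => un (i a)) :
    PolyTime fun a => prodLine K (H a) (k a) (i a) := by
  unfold prodLine
  fun_prop

@[fun_prop]
theorem polyTime_defSum {k i t : α → ℕ} (hH : PolyTime H) (hk : PolyTime fun a => un (k a))
    (hi : PolyTime fun a => un (i a)) (ht : PolyTime fun a => un (t a)) :
    PolyTime fun a => defSum K (H a) (k a) (i a) (t a) := by
  have : PolyTime fun p : CNF × Unary × Unary × Unary =>
      defSum K p.1 p.2.1.val p.2.2.1.val p.2.2.2.val := by
    unfold defSum
    fun_prop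
  have h := PolyTime.comp this (.prodMk hH (.prodMk hk (.prodMk hi ht)))
  exact h

@[fun_prop]
theorem polyTime_dualSum {k i t : α → ℕ} (hH : PolyTime H) (hk : PolyTime fun a => un (k a))
    (hi : PolyTime fun a => un (i a)) (ht : PolyTime fun a => un (t a)) :
    PolyTime fun a => dualSum K (H a) (k a) (i a) (t a) := by
  have : PolyTime fun p : CNF × Unary × Unary × Unary =>
      dualSum K p.1 p.2.1.val p.2.2.1.val p.2.2.2.val := by
    unfold dualSum
    fun_prop
  have h := PolyTime.comp this (.prodMk hH (.prodMk hk (.prodMk hi ht)))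
  exact h

@[fun_prop]
theorem polyTime_stepLines {k i : α → ℕ} (hH : PolyTime H)
    (hk : PolyTime fun a => un (k a)) (hi : PolyTime fun a => un (i a)) :
    PolyTime fun a => stepLines K (H a) (k a) (i a) := by
  have : PolyTime fun p : CNF × Unary × Unary => stepLines K p.1 p.2.1.val p.2.2.val := by
    unfold stepLines mulLine
    fun_prop
  have h := PolyTime.comp this (.prodMk hH (.prodMk hk hi))
  exact h

@[fun_prop]
theorem polyTime_weakLines {i : α → ℕ} (hF : PolyTime F) (hH : PolyTime H)
    (hi : PolyTime fun a => un (i a)) : PolyTime fun a => weakLines K (F a) (H a) (i a) := by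
  have : PolyTime fun p : CNF × CNF × Unary => weakLines K p.1 p.2.1 p.2.2.val := by
    unfold weakLines
    fun_prop
  have h := PolyTime.comp this (.prodMk hF (.prodMk hH hi))
  exact h

theorem polyTime_lines : PolyTime fun p : CNF × CNF => lines K p.1 p.2 := by
  unfold lines defLines dualLines dualLine
  fun_prop

theorem polyTime_defs : PolyTime fun p : CNF × CNF => defs K p.2 := by
  unfold defs
  fun_prop

end PolyTime

end PC

namespace PC

open MvPolynomial

/-! ### Correctness of the refutation in Ext-PC -/

/-! ### The polynomials written by the lines -/

section Values

variable {K : Type} [Field K]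

theorem toMv_nil : Poly.toMv ([] : List (Term K)) = 0 := rfl

theorem toMv_cons (t : Term K) (p : List (Term K)) :
    Poly.toMv (t :: p) = t.toMv + Poly.toMv p := by simp [Poly.toMv]

theorem toMv_append (p q : List (Term K)) :
    Poly.toMv (p ++ q) = Poly.toMv p + Poly.toMv q := by simp [Poly.toMv]

theorem toMv_ftab (n : ℕ) (f : ℕ → List (Term K)) :
    Poly.toMv (ftab n f) = ∑ j ∈ Finset.range n, Poly.toMv (f j) := by
  induction n with
  | zero => rfl
  | succ n ih => rw [ftab_succ, toMv_append, ih, Finset.sum_range_succ]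

theorem toMv_tab (n : ℕ) (f : ℕ → Term K) :
    Poly.toMv (tab n f) = ∑ j ∈ Finset.range n, (f j).toMv := by
  rw [tab_eq_ftab, toMv_ftab]
  simp [toMv_cons, toMv_nil]

theorem term_toMv_cons (s : K) (v : PVar) (m : List PVar) :
    (Term.mk s (v :: m)).toMv = X v * (Term.mk s m).toMv := by
  simp only [Term.toMv, List.map_cons, List.prod_cons]; ring

theorem term_toMv_nil (s : K) : (Term.mk s []).toMv = C s := by simp [Term.toMv]

theorem term_toMv_neg_one (m : List PVar) :
    (Term.mk (-1 : K) m).toMv = - (m.map X).prod := by simp [Term.toMv]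

theorem term_toMv_one (m : List PVar) :
    (Term.mk (1 : K) m).toMv = (m.map X).prod := by simp [Term.toMv]

variable [DecidableEq K] (H : CNF)

theorem toMv_extDef_zero (s : K) (j : ℕ) :
    (extDef K H s 0 j).toMv = if j = 0 then C s else 0 := by
  unfold extDef
  rw [if_pos rfl]
  split_ifs
  · rw [toMv_cons, toMv_nil, term_toMv_nil, add_zero]
  · rfl

theorem toMv_extDef_succ (s : K) (k j : ℕ) :
    (extDef K H s (k + 1) j).toMv = C s * ∑ j' ∈ Finset.range (clauses H).length,
      (C (coef (lev K H (k + 1)) j j').1 * X (.orig (xv H k)) +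
        C (coef (lev K H (k + 1)) j j').2 * X (.dual (xv H k))) * X (.ext (ev H k j')) := by
  unfold extDef
  rw [if_neg k.succ_ne_zero, toMv_ftab, Finset.mul_sum, Nat.add_sub_cancel]
  refine Finset.sum_congr rfl fun j' _ => ?_
  simp only [toMv_cons, toMv_nil, term_toMv_cons, term_toMv_nil, C_mul]
  ring

theorem toMv_extDef (s : K) (k j : ℕ) :
    (extDef K H s k j).toMv = C s * (extDef K H 1 k j).toMv := by
  cases k with
  | zero => rw [toMv_extDef_zero, toMv_extDef_zero]; split_ifs <;> simp
  | succ k => rw [toMv_extDef_succ, toMv_extDef_succ, C_1, one_mul]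

theorem toMv_defLine (s : K) (k j : ℕ) :
    (defLine K H s k j).toMv = C s * (X (.ext (ev H k j)) - (extDef K H 1 k j).toMv) := by
  unfold defLine
  rw [toMv_cons, term_toMv_cons, term_toMv_nil, toMv_extDef, C_neg]
  ring

omit [DecidableEq K] in
theorem toMv_dualTerm (s : K) (k j : ℕ) :
    (dualTerm K H s k j).toMv =
      C s * (X (.ext (ev H k j)) * (X (.orig (xv H k)) + X (.dual (xv H k)) - 1)) := by
  unfold dualTerm
  simp only [toMv_cons, toMv_nil, term_toMv_cons, term_toMv_nil, C_neg]
  ring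

omit [DecidableEq K] in
theorem toMv_dualLine (k : ℕ) :
    (dualLine K H k).toMv = X (.orig (xv H k)) + X (.dual (xv H k)) - 1 := by
  unfold dualLine
  simp only [toMv_cons, toMv_nil, term_toMv_cons, term_toMv_nil, C_neg, C_1]
  ring

theorem toMv_yPoly (k i : ℕ) :
    (yPoly K H k i).toMv = ∑ j ∈ Finset.range (clauses H).length,
      C (entry (lev K H k) j i) * X (.ext (ev H k j)) := by
  unfold yPoly
  rw [toMv_tab]
  refine Finset.sum_congr rfl fun j _ => ?_
  rw [term_toMv_cons, term_toMv_nil, mul_comm]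

theorem toMv_prodLine (k i : ℕ) :
    (prodLine K H k i).toMv = (yPoly K H k i).toMv - ((part H k i).map X).prod := by
  unfold prodLine
  rw [toMv_append, toMv_cons, toMv_nil, term_toMv_neg_one, add_zero, sub_eq_add_neg]

theorem toMv_mulLine (k i : ℕ) :
    (mulLine K H k i).toMv = X (facVar H k i) * (prodLine K H k i).toMv := by
  unfold mulLine
  rw [toMv_prodLine, toMv_append, toMv_cons, toMv_nil, term_toMv_neg_one, toMv_tab, toMv_yPoly,
    mul_sub, Finset.mul_sum, List.map_cons, List.prod_cons, add_zero, sub_eq_add_neg]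
  congr 1
  refine Finset.sum_congr rfl fun j _ => ?_
  rw [term_toMv_cons, term_toMv_cons, term_toMv_nil]
  ring

/-- After the order of summation is exchanged, the coefficient of each lower extension variable is a
sum of coordinates times entries, which elimination identifies as mask times old entry. -/
theorem toMv_defSum (k : ℕ) {i : ℕ} (hi : i < (clauses H).length) :
    (defSum K H k i (clauses H).length).toMv = (yPoly K H (k + 1) i).toMv -
      (C (mask K (xv H k) true (cl H i)) * X (.orig (xv H k)) +
        C (mask K (xv H k) false (cl H i)) * X (.dual (xv H k))) * (yPoly K H k i).toMv := by
  unfold defSum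
  rw [toMv_ftab, toMv_yPoly, toMv_yPoly]
  simp only [toMv_defLine, toMv_extDef_succ, mul_sub, Finset.sum_sub_distrib, C_1, one_mul]
  congr 1
  simp only [Finset.mul_sum]
  rw [Finset.sum_comm]
  refine Finset.sum_congr rfl fun j hj => ?_
  have h1 := sum_coef_mul_entry_lev (K := K) (H := H) k true (Finset.mem_range.1 hj) hi
  have h2 := sum_coef_mul_entry_lev (K := K) (H := H) k false (Finset.mem_range.1 hj) hi
  have h1 := congrArg (C (σ := PVar)) h1
  have h2 := congrArg (C (σ := PVar)) h2
  simp only [map_sum, C_mul, sel, cond_true, cond_false] at h1 h2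
  calc _ = ((∑ j' ∈ Finset.range (clauses H).length, C (coef (lev K H (k + 1)) j' j).1 *
          C (entry (lev K H (k + 1)) j' i)) * X (.orig (xv H k)) +
        (∑ j' ∈ Finset.range (clauses H).length, C (coef (lev K H (k + 1)) j' j).2 *
          C (entry (lev K H (k + 1)) j' i)) * X (.dual (xv H k))) * X (.ext (ev H k j)) := by
        rw [Finset.sum_mul, Finset.sum_mul, ← Finset.sum_add_distrib, Finset.sum_mul]
        refine Finset.sum_congr rfl fun j' _ => ?_
        ring
    _ = _ := by rw [h1, h2]; ring

theorem toMv_dualSum (k i : ℕ) :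
    (dualSum K H k i (clauses H).length).toMv =
      (X (.orig (xv H k)) + X (.dual (xv H k)) - 1) * (yPoly K H k i).toMv := by
  unfold dualSum
  rw [toMv_ftab, toMv_yPoly, Finset.mul_sum]
  refine Finset.sum_congr rfl fun j _ => ?_
  rw [toMv_dualTerm]
  ring

/-- If clause `i` contains the `k`-th variable, exactly one mask is 1, and the factor is the single
variable by which `mulLine` multiplies. Otherwise both masks are 1, the factor is `x + x^R`, and
multiples of the axiom `x + x^R - 1` reduce it to 1. -/
theorem toMv_prodLine_succ (k : ℕ) {i : ℕ} (hi : i < (clauses H).length) :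
    (prodLine K H (k + 1) i).toMv =
        (defSum K H k i (clauses H).length).toMv + (mulLine K H k i).toMv ∨
      (prodLine K H (k + 1) i).toMv = Poly.toMv (defSum K H k i (clauses H).length ++
        dualSum K H k i (clauses H).length) + (prodLine K H k i).toMv := by
  have hpart : ((part H (k + 1) i).map X).prod =
      ((part H k i).map (X (R := K))).prod * ((fac (xv H k) (cl H i)).map X).prod := by
    unfold part
    rw [ftab_succ, List.map_append, List.prod_append]
  rw [toMv_append, toMv_dualSum, toMv_mulLine, toMv_prodLine, toMv_prodLine, hpart,
    toMv_defSum H k hi]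
  by_cases h1 : Lit.mk (xv H k) true ∈ cl H i
  · left
    -- Here tautological clauses would do harm: both masks would be 0, although `fac` still lists a
    -- variable.
    have h2 : Lit.mk (xv H k) false ∉ cl H i := (mem_clauses (getD_mem hi [])).1 _ h1
    simp only [facVar, fac, mask, h1, h2, if_true, if_false, C_0, C_1, List.map_cons, List.map_nil,
      List.prod_cons, List.prod_nil, List.headD_cons]
    ring
  · by_cases h2 : Lit.mk (xv H k) false ∈ cl H i
    · left
      simp only [facVar, fac, mask, h1, h2, if_true, if_false, C_0, C_1, List.map_cons,
        List.map_nil, List.prod_cons, List.prod_nil, List.headD_cons]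
      ring
    · right
      simp only [fac, mask, h1, h2, if_false, C_1, List.map_nil, List.prod_nil]
      ring

/-- At level 0 the form of every clause is `y_{0,0}` and the monomial is 1, so the line is itself an
extension axiom. -/
theorem toMv_prodLine_zero {i : ℕ} (hi : i < (clauses H).length) :
    (prodLine K H 0 i).toMv = X (.ext (ev H 0 0)) - (extDef K H 1 0 0).toMv := by
  rw [toMv_prodLine, toMv_extDef_zero, if_pos rfl, toMv_yPoly]
  have h0 : 0 < (clauses H).length := Nat.succ_pos _
  rw [Finset.sum_eq_single_of_mem 0 (Finset.mem_range.2 h0)]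
  · rw [entry_lev_zero h0 hi, if_pos rfl, C_1, one_mul]
    rfl
  · intro j hj hj0
    rw [entry_lev_zero (Finset.mem_range.1 hj) hi, if_neg hj0, C_0, zero_mul]

theorem part_zero (k : ℕ) : part H k 0 = [] := by
  have : ∀ x, fac x (cl H 0) = [] := fun x => by simp [fac, cl, clauses]
  simp [part, this, ftab]

theorem toPVar_injective : Function.Injective Lit.toPVar := by
  rintro ⟨x, b⟩ ⟨y, c⟩ h
  cases b <;> cases c <;> simp_all [Lit.toPVar]

theorem mem_fac {x : ℕ} {D : Clause} (hD : ∀ l ∈ D, l.neg ∉ D) {v : PVar} :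
    v ∈ fac x D ↔ ∃ l ∈ D, l.var = x ∧ l.toPVar = v := by
  unfold fac
  constructor
  · intro h
    split_ifs at h with h1 h2
    · exact ⟨_, h1, rfl, by simpa [Lit.toPVar, eq_comm] using h⟩
    · exact ⟨_, h2, rfl, by simpa [Lit.toPVar, eq_comm] using h⟩
    · simp at h
  · rintro ⟨⟨y, b⟩, hl, rfl, rfl⟩
    cases b
    · have : Lit.mk y true ∉ D := hD _ hl
      simp [this, hl, Lit.toPVar]
    · simp [hl, Lit.toPVar]

theorem nodup_fac (x : ℕ) (D : Clause) : (fac x D).Nodup := by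
  unfold fac
  split_ifs <;> simp

theorem mem_part {i : ℕ} (hi : i < (clauses H).length) {v : PVar} :
    v ∈ part H (vars H).length i ↔ ∃ l ∈ cl H i, l.toPVar = v := by
  obtain ⟨h1, h2⟩ := mem_clauses (getD_mem hi [])
  unfold part
  rw [mem_ftab]
  constructor
  · rintro ⟨t, -, h⟩
    obtain ⟨l, hl, -, h⟩ := (mem_fac h1).1 h
    exact ⟨l, hl, h⟩
  · rintro ⟨l, hl, h⟩
    obtain ⟨t, ht, hlt⟩ := exists_getD_of_mem (h2 l hl) 0
    exact ⟨t, ht, (mem_fac h1).2 ⟨l, hl, hlt.symm, h⟩⟩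

theorem nodup_part {i : ℕ} (hi : i < (clauses H).length) : (part H (vars H).length i).Nodup := by
  obtain ⟨h1, h2⟩ := mem_clauses (getD_mem hi [])
  refine List.nodup_flatMap.2 ⟨fun t _ => nodup_fac _ _, ?_⟩
  refine List.Pairwise.imp_of_mem ?_ (List.nodup_range (n := (vars H).length))
  intro s t hs ht hst v hv hv'
  obtain ⟨l, -, hx, rfl⟩ := (mem_fac h1).1 hv
  obtain ⟨l', -, hx', h⟩ := (mem_fac h1).1 hv'
  obtain rfl := toPVar_injective h
  exact hst (xv_inj (List.mem_range.1 hs) (List.mem_range.1 ht) (hx.symm.trans hx'))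

omit [DecidableEq K] in
theorem prod_clauseVars (F : CNF) (i : ℕ) :
    ((clauseVars F H i).map (X (R := K))).prod =
      (strengthening F (cl H (i + 1))).toMv K := by
  obtain ⟨h1, h2⟩ := nub_spec (strengthening F (cl H (i + 1)))
  unfold clauseVars Clause.toMv
  rw [List.map_map, ← List.prod_toFinset _ h1]
  refine Finset.prod_congr ?_ fun _ _ => rfl
  ext l
  simp [h2]

omit [DecidableEq K] in
-- Both lists are free of repetitions and have the same elements, the clause of `F` being contained
-- in that of `H`; so they are permutations of each other.
theorem prod_other_mul_clause {F : CNF} {i : ℕ} (hi : i < (clauses H).tail.length)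
    (hF : ∀ C ∈ H, ∃ C' ∈ F, C' ⊆ C) :
    ((otherVars F H i ++ clauseVars F H i).map (X (R := K))).prod =
      ((part H (vars H).length (i + 1)).map X).prod := by
  have hi' : i + 1 < (clauses H).length := by simpa [clauses] using hi
  have hsub := (cl_succ_strengthening hF hi).2
  obtain ⟨h1, h2⟩ := nub_spec (strengthening F (cl H (i + 1)))
  have hcl : ∀ v, v ∈ clauseVars F H i → v ∈ part H (vars H).length (i + 1) := by
    intro v hv
    obtain ⟨l, hl, rfl⟩ := List.mem_map.1 hv
    exact (mem_part H hi').2 ⟨l, hsub ((h2 _).1 hl), rfl⟩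
  refine List.Perm.prod_eq (List.Perm.map _ ?_)
  refine (List.perm_ext_iff_of_nodup ?_ (nodup_part H hi')).2 fun v => ?_
  · refine List.nodup_append.2 ⟨(nodup_part H hi').filter _, h1.map toPVar_injective, ?_⟩
    rintro v hv w hw rfl
    have := (List.mem_filter.1 hv).2
    simp [hw] at this
  · rw [List.mem_append, otherVars, List.mem_filter]
    constructor
    · rintro (h | h)
      exacts [h.1, hcl v h]
    · intro h
      by_cases hv : v ∈ clauseVars F H i
      · exact Or.inr hv
      · exact Or.inl ⟨h, by simpa using hv⟩

/-- The semantic identity has become an equality of coefficients, so it costs no derivation steps.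
-/
theorem sum_toMv_yPoly_last (hH : H.IsHitting) (hU : H.Unsat) :
    ∑ i ∈ Finset.range (clauses H).tail.length,
      (yPoly K H (vars H).length (i + 1)).toMv = (yPoly K H (vars H).length 0).toMv := by
  simp only [toMv_yPoly]
  rw [Finset.sum_comm]
  refine Finset.sum_congr rfl fun j hj => ?_
  rw [← Finset.sum_mul, ← map_sum, sum_entry_lev_last hH hU (Finset.mem_range.1 hj)]

end Values

/-! ### Single steps and sums in Polynomial Calculus -/

section Steps

variable {K : Type} [Field K]

/-- The rules of Polynomial Calculus. -/
def step (Ax : MvPolynomial PVar K → Prop) (S : Set (Poly K)) (p : Poly K) : Prop :=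
  Ax p.toMv ∨
  (∃ q ∈ S, ∃ r ∈ S, ∃ a b : K, p.toMv = C a * q.toMv + C b * r.toMv) ∨
  (∃ q ∈ S, ∃ v : PVar, p.toMv = X v * q.toMv)

theorem step_mono (Ax : MvPolynomial PVar K → Prop) : StepMono (step Ax) := by
  rintro S T p h (h1 | ⟨q, hq, r, hr, h1⟩ | ⟨q, hq, h1⟩)
  exacts [Or.inl h1, Or.inr (Or.inl ⟨q, h hq, r, h hr, h1⟩), Or.inr (Or.inr ⟨q, h hq, h1⟩)]

theorem step_add {Ax : MvPolynomial PVar K → Prop} {S : Set (Poly K)} {p q r : Poly K} (hq : q ∈ S)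
    (hr : r ∈ S) (h : p.toMv = q.toMv + r.toMv) : step Ax S p :=
  Or.inr (Or.inl ⟨q, hq, r, hr, 1, 1, by rw [h, C_1, one_mul, one_mul]⟩)

theorem step_add_smul {Ax : MvPolynomial PVar K → Prop} {S : Set (Poly K)} {p q r : Poly K} (s : K)
    (hq : q ∈ S) (hr : r ∈ S) (h : p.toMv = q.toMv + C s * r.toMv) : step Ax S p :=
  Or.inr (Or.inl ⟨q, hq, r, hr, 1, s, by rw [h, C_1, one_mul]⟩)

theorem valid_sums {Ax : MvPolynomial PVar K → Prop} {S : Set (Poly K)} {n : ℕ}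
    (f : ℕ → Poly K) (g : ℕ → K) (h0 : ([] : Poly K) ∈ S)
    (h : ∀ i < n, ∃ q ∈ S, (f i).toMv = C (g i) * q.toMv) :
    Valid (step Ax) S (tab (n + 1) fun t => ftab t f) := by
  refine Valid.tab (step_mono Ax) fun t ht T hST hT => ?_
  cases t with
  | zero => exact step_add_smul 0 (hST h0) (hST h0) (by rw [C_0, zero_mul, add_zero]; rfl)
  | succ t =>
    obtain ⟨q, hq, hqt⟩ := h t (by omega)
    refine step_add_smul (g t) (hT t (by omega)) (hST hq) ?_
    rw [ftab_succ, toMv_append, hqt]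

end Steps

/-! ### The Ext-PC refutation is correct -/

section Main

variable (K : Type) [Field K] [DecidableEq K] {F H : CNF}

omit [Field K] [DecidableEq K] in
theorem extDefs_of_valid (known : List ℕ) (ds : List (ℕ × Poly K))
    (h1 : (ds.map Prod.fst).Nodup) (h2 : ∀ d ∈ ds, d.1 ∉ known)
    (h3 : Valid (fun (S : Set (ℕ × Poly K)) d =>
      ∀ t ∈ d.2, ∀ j, PVar.ext j ∈ t.mono → j ∈ known ∨ ∃ e ∈ S, e.1 = j) ∅ ds) :
    ExtDefs known ds := by
  induction ds generalizing known with
  | nil => trivial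
  | cons d ds ih =>
    obtain ⟨y, q⟩ := d
    rw [List.map_cons, List.nodup_cons] at h1
    refine ⟨h2 (y, q) (by simp), fun t ht j hj => ?_, ih _ h1.2 ?_ ?_⟩
    · have := h3 [] (y, q) ds rfl t ht j hj
      simpa using this
    · intro d hd h
      rcases List.mem_cons.1 h with h | h
      · exact h1.1 (List.mem_map.2 ⟨d, hd, h⟩)
      · exact h2 d (List.mem_cons_of_mem _ hd) h
    · intro pre p post hds t ht j hj
      have := h3 ((y, q) :: pre) p post (by rw [hds]; rfl) t ht j hj
      rcases this with h | ⟨e, he, h⟩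
      · exact Or.inl (List.mem_cons_of_mem _ h)
      · rcases he with he | he
        · simp at he
        · rcases List.mem_cons.1 he with rfl | he
          · exact Or.inl (h ▸ List.mem_cons_self)
          · exact Or.inr ⟨e, Or.inr he, h⟩

/-- Names are distinct, and a definition at level `k + 1` mentions extension variables of level `k`
only. -/
theorem extDefs_defs : ExtDefs [] (defs K H) := by
  refine extDefs_of_valid K [] _ ?_ (by simp) ?_
  · have : (defs K H).map Prod.fst = names H := by
      simp only [defs, names, ftab, tab, List.map_flatMap, List.map_map, Function.comp_def]
    rw [this]
    exact nodup_names H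
  · have hm : StepMono fun (S : Set (ℕ × Poly K)) (d : ℕ × Poly K) =>
        ∀ t ∈ d.2, ∀ j, PVar.ext j ∈ t.mono → j ∈ ([] : List ℕ) ∨ ∃ e ∈ S, e.1 = j := by
      intro S T d hST h t ht j hj
      rcases h t ht j hj with h | ⟨e, he, h⟩
      exacts [Or.inl h, Or.inr ⟨e, hST he, h⟩]
    refine Valid.ftab hm fun k _ T _ hT => Valid.tab hm fun j _ T' hT' _ => ?_
    intro t ht y hy
    right
    unfold extDef at ht
    cases k with
    | zero =>
      simp only [if_true] at ht
      split_ifs at ht <;> simp at ht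
      subst ht
      simp at hy
    | succ k =>
      simp only [k.succ_ne_zero, if_false, Nat.add_sub_cancel] at ht
      obtain ⟨j', hj', ht⟩ := mem_ftab.1 ht
      have : y = ev H k j' := by
        simp only [List.mem_cons, List.not_mem_nil, or_false] at ht
        rcases ht with rfl | rfl <;> simpa using hy
      exact ⟨_, hT' (hT k (by omega) _ (mem_tab.2 ⟨j', hj', rfl⟩)), this.symm⟩

/-- The axioms for the refutation. -/
def Ax (F H : CNF) (p : MvPolynomial PVar K) : Prop :=
  CNFAxiom K F p ∨ ∃ d ∈ defs K H, p = X (PVar.ext d.1) - d.2.toMv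

variable {K}

theorem ax_def {k j : ℕ} (hk : k ≤ (vars H).length) (hj : j < (clauses H).length) :
    Ax K F H (X (.ext (ev H k j)) - (extDef K H 1 k j).toMv) :=
  Or.inr ⟨(ev H k j, extDef K H 1 k j),
    mem_ftab.2 ⟨k, Nat.lt_succ_of_le hk, mem_tab.2 ⟨j, hj, rfl⟩⟩, rfl⟩

theorem valid_stepLines {T : Set (Poly K)} {k i : ℕ} (hk : k < (vars H).length)
    (hi : i < (clauses H).length) (h0 : ([] : Poly K) ∈ T)
    (hdef : ∀ p ∈ defLines K H, p ∈ T) (hdual : ∀ p ∈ dualLines K H, p ∈ T)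
    (hprod : prodLine K H k i ∈ T) : Valid (step (Ax K F H)) T (stepLines K H k i) := by
  have hm := step_mono (Ax K F H)
  have hD : (clauses H).length < (clauses H).length + 1 := Nat.lt_succ_self _
  refine Valid.append hm (valid_sums _ (fun j => entry (lev K H (k + 1)) j i) h0 fun j hj =>
    ⟨defLine K H 1 (k + 1) j, hdef _ ?_, ?_⟩) fun T hST h1 => ?_
  · exact mem_ftab.2 ⟨k + 1, by omega, mem_tab.2 ⟨j, hj, rfl⟩⟩
  · simp only [toMv_defLine, C_1, one_mul]
  refine Valid.append hm (valid_sums _ (fun j => entry (lev K H k) j i) (hST h0) fun j hj =>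
    ⟨dualTerm K H 1 k j, hST (hdual _ ?_), ?_⟩) fun T' hST' h2 => ?_
  · exact mem_ftab.2 ⟨k, hk, List.mem_cons_of_mem _ (mem_tab.2 ⟨j, hj, rfl⟩)⟩
  · simp only [toMv_dualTerm, C_1, one_mul]
  have hE := hST' (h1 _ (mem_tab.2 ⟨_, hD, rfl⟩))
  have hG := h2 _ (mem_tab.2 ⟨_, hD, rfl⟩)
  refine Valid.cons hm (step_add hE hG (toMv_append _ _)) fun T1 hT1 h3 => ?_
  refine Valid.cons hm (Or.inr (Or.inr ⟨_, hT1 (hST' (hST hprod)), _, toMv_mulLine H k i⟩))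
    fun T2 hT2 h4 => Valid.singleton ?_
  rcases toMv_prodLine_succ (K := K) H k hi with h | h
  · exact step_add (hT2 (hT1 hE)) h4 h
  · exact step_add (hT2 h3) (hT2 (hT1 (hST' (hST hprod)))) h

theorem valid_weakLines {T : Set (Poly K)} {i : ℕ} (hi : i < (clauses H).tail.length)
    (hF : ∀ C ∈ H, ∃ C' ∈ F, C' ⊆ C) (hprod : prodLine K H (vars H).length (i + 1) ∈ T) :
    Valid (step (Ax K F H)) T (weakLines K F H i) := by
  have hm := step_mono (Ax K F H)
  refine Valid.append hm (Valid.tab hm fun t ht T' hT' h => ?_) fun T' hT' h =>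
    Valid.singleton ?_
  · cases t with
    | zero =>
      refine Or.inl (Or.inl ?_)
      have : Poly.toMv [Term.mk (1 : K) ((tab 0 fun s => (otherVars F H i).getD s (.orig 0)) ++
          clauseVars F H i)] = (strengthening F (cl H (i + 1))).toMv K := by
        rw [toMv_cons, toMv_nil, term_toMv_one, add_zero, ← prod_clauseVars]
        rfl
      rw [this]
      exact .clause _ (cl_succ_strengthening hF hi).1
    | succ t =>
      refine Or.inr (Or.inr ⟨_, h t (by omega), (otherVars F H i).getD t (.orig 0), ?_⟩)
      simp only [toMv_cons, toMv_nil, term_toMv_one, tab_succ, List.map_append, List.prod_append,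
        List.map_cons, List.map_nil, List.prod_cons, List.prod_nil]
      ring
  · refine step_add (hT' hprod) (h _ (mem_tab.2 ⟨(otherVars F H i).length, by omega, rfl⟩)) ?_
    have : (tab (otherVars F H i).length fun s => (otherVars F H i).getD s (.orig 0)) =
        otherVars F H i := by
      refine List.ext_getElem (length_tab _ _) fun s h1 h2 => ?_
      simp [tab, List.getD_eq_getElem?_getD, h2]
    rw [toMv_prodLine, this, toMv_cons, toMv_nil, term_toMv_one, prod_other_mul_clause H hi hF]
    ring

theorem valid_lines (h : IsHittingRefutation F H) : Valid (step (Ax K F H)) ∅ (lines K F H) := by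
  obtain ⟨hH, hU, hF⟩ := h
  have hm := step_mono (Ax K F H)
  have h00 : 0 < (clauses H).length := Nat.succ_pos _
  refine Valid.append hm ?_ fun T1 _ hdef => ?_
  · refine Valid.ftab hm fun k hk T _ _ => Valid.tab hm fun j hj T' _ _ => Or.inl ?_
    rw [toMv_defLine, C_1, one_mul]
    exact ax_def (by omega) hj
  have hdef0 := hdef _ (mem_ftab.2 ⟨0, Nat.succ_pos _, mem_tab.2 ⟨0, h00, rfl⟩⟩)
  -- The zero polynomial, with which all partial sums begin, is obtained as `0·p + 0·p`.
  refine Valid.append hm (Valid.singleton (Or.inr (Or.inl ⟨_, hdef0, _, hdef0, 0, 0, ?_⟩)))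
    fun T2 h12 hz => ?_
  · rw [C_0, zero_mul, add_zero]; rfl
  have hz := hz _ List.mem_cons_self
  refine Valid.append hm ?_ fun T3 h23 hdual => ?_
  · refine Valid.ftab hm fun k _ T _ _ => Valid.cons hm (Or.inl (Or.inl ?_)) fun T' _ hd =>
      Valid.tab hm fun j _ T'' hT'' _ => Or.inr (Or.inr ⟨_, hT'' hd, .ext (ev H k j), ?_⟩)
    · rw [toMv_dualLine]
      exact .dual _
    · rw [toMv_dualTerm, toMv_dualLine, C_1, one_mul]
  refine Valid.append hm ?_ fun T4 h34 hprod => ?_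
  · refine Valid.tab hm fun i hi T _ _ => Or.inl ?_
    rw [toMv_prodLine_zero H hi]
    exact ax_def (Nat.zero_le _) h00
  have hprod' : ∀ k ≤ (vars H).length, ∀ i < (clauses H).length, ∀ T, T4 ⊆ T →
      (∀ k' < k, ∀ x ∈ ftab (clauses H).length fun i => stepLines K H k' i, x ∈ T) →
      prodLine K H k i ∈ T := by
    intro k hk i hi T hT hx
    cases k with
    | zero => exact hT (hprod _ (mem_tab.2 ⟨i, hi, rfl⟩))
    | succ k =>
      refine hx k (by omega) _ (mem_ftab.2 ⟨i, hi, ?_⟩)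
      simp [stepLines]
  refine Valid.append hm ?_ fun T5 h45 hsteps => ?_
  · refine Valid.ftab hm fun k hk T hT hx => Valid.ftab hm fun i hi T' hT' _ => ?_
    have h4 : T4 ⊆ T' := hT.trans hT'
    have h3 : T3 ⊆ T' := h34.trans h4
    have h2 : T2 ⊆ T' := h23.trans h3
    exact valid_stepLines hk hi (h2 hz) (fun p hp => h2 (h12 (hdef p hp)))
      (fun p hp => h3 (hdual p hp)) (hT' (hprod' k hk.le i hi T hT hx))
  have hlast : ∀ i < (clauses H).length, prodLine K H (vars H).length i ∈ T5 := fun i hi =>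
    hprod' _ le_rfl i hi T5 h45 fun k hk x hx => hsteps x (mem_ftab.2 ⟨k, hk, hx⟩)
  refine Valid.append hm ?_ fun T6 h56 hweak => ?_
  · refine Valid.ftab hm fun i hi T hT _ => valid_weakLines hi hF (hT (hlast _ ?_))
    simpa [clauses] using hi
  refine Valid.append hm (valid_sums _ (fun _ => 1) (h56 (h45 (h34 (h23 hz)))) fun i hi =>
    ⟨yPoly K H (vars H).length (i + 1), hweak _ (mem_ftab.2 ⟨i, hi, ?_⟩), ?_⟩)
    fun T7 h67 hsum => Valid.singleton ?_
  · simp [weakLines]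
  · rw [C_1, one_mul]
  -- The sum of the vanishing forms equals the form of the empty clause; subtracting that form minus
  -- 1 leaves 1.
  · refine step_add_smul (-1) (hsum _ (mem_tab.2 ⟨_, Nat.lt_succ_self _, rfl⟩))
      (h67 (h56 (hlast 0 h00))) ?_
    rw [toMv_ftab, sum_toMv_yPoly_last H hH hU, toMv_prodLine, part_zero, toMv_cons, toMv_nil,
      term_toMv_one, C_neg, C_1]
    simp

theorem isExtPCRefutation (h : IsHittingRefutation F H) :
    IsExtPCRefutation F (defs K H, lines K F H) := by
  refine ⟨extDefs_defs K, fun pre p post hl => ?_, [⟨1, []⟩], ?_, ?_⟩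
  · have := valid_lines (K := K) h pre p post hl
    rw [Set.empty_union] at this
    exact this
  · simp only [lines, ← List.append_assoc]
    exact List.getLast?_concat
  · rw [toMv_cons, toMv_nil, term_toMv_one]
    simp

end Main

end PC

/-- The tree code of a finite type by the numbers below its cardinality. -/
noncomputable abbrev finiteCode (K : Type) [Finite K] : TreeCode K where
  code k := TreeCode.code (Finite.equivFin K k : ℕ)
  inj := fun a b h => by simpa [Fin.val_inj] using TreeCode.inj h

theorem extPC_pSimulates_hitting (K : Type) [Field K] [Finite K] :
    PSimulates (extPC K) hitting := by
  classical
  let _ := finiteCode K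
  exact ⟨fun p : CNF × CNF => (PC.defs K p.2, PC.lines K p.1 p.2),
    PolyTime.prodMk PC.polyTime_defs PC.polyTime_lines, fun F H h => PC.isExtPCRefutation h⟩

namespace EF

/-! ### Instances of derived rules -/

section Use

variable (S : FregeSystem)

open Classical in
/-- A derivation of the conclusion of a sound rule from its premises, without these premises. -/
noncomputable def derivation (r : Rule) : List (Fml ℕ) :=
  if h : Fml.Entails r.prem r.concl then
    (S.complete _ _ h).choose.filter fun B => B ∉ r.prem
  else []

/-- The lines that derive an instance of a sound rule. -/
noncomputable def use (r : Rule) (args : List (Fml EVar)) : List (Fml EVar) :=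
  (derivation S r).map fun B => B.subst fun n => args.getD n .ff

/-- The formula `B` with the meta-variables replaced. -/
def fill (args : List (Fml EVar)) (B : Fml ℕ) : Fml EVar := B.subst fun n => args.getD n .ff

/-- The rules of a Frege system. -/
def step (T : Set (Fml EVar)) (A : Fml EVar) : Prop :=
  ∃ R ∈ S.rules, ∃ σ : ℕ → Fml EVar, A = R.concl.subst σ ∧ ∀ P ∈ R.prem, P.subst σ ∈ T

theorem step_mono : StepMono (step S) := by
  rintro T T' p h ⟨R, hR, σ, h1, h2⟩
  exact ⟨R, hR, σ, h1, fun P hP => h (h2 P hP)⟩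

theorem subst_subst {U V W : Type} (σ : U → Fml V) (τ : V → Fml W) (A : Fml U) :
    (A.subst σ).subst τ = A.subst fun u => (σ u).subst τ := by
  induction A <;> simp_all [Fml.subst]

variable {S}

/-- Derivations by schemas are closed under substitution. The premises are cut out of the
derivation, because their instances are already available in `T`. -/
theorem valid_use {r : Rule} {args : List (Fml EVar)} {T : Set (Fml EVar)}
    (hr : Fml.Entails r.prem r.concl) (hT : ∀ B ∈ r.prem, fill args B ∈ T) :
    Valid (step S) T (use S r args) := by
  classical
  obtain ⟨h1, -⟩ := (S.complete _ _ hr).choose_spec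
  set l := (S.complete _ _ hr).choose with hl
  have hu : use S r args = (l.filter fun B => B ∉ r.prem).map (fill args) := by
    unfold use derivation
    rw [dif_pos hr]
    rfl
  rw [hu]
  clear hu
  clear_value l
  clear hl
  induction l using List.reverseRecOn with
  | nil => exact Valid.nil _
  | append_singleton l A ih =>
    have ih := ih (fun pre B post h => h1 pre B (post ++ [A]) (by rw [h]; simp))
    by_cases hA : A ∈ r.prem
    · simpa [List.filter_append, hA] using ih
    · rw [List.filter_append, List.map_append]
      refine Valid.append (step_mono S) ih fun T' hT' hx => ?_
      have : [A].filter (fun B => B ∉ r.prem) = [A] := by simp [hA]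
      rw [this]
      refine Valid.singleton ?_
      rcases h1 l A [] (by simp) with h | ⟨R, hR, σ, h2, h3⟩
      · exact absurd h hA
      · refine ⟨R, hR, fun n => fill args (σ n), by rw [h2]; exact subst_subst _ _ _, fun P hP => ?_⟩
        have h4 : P.subst (fun n => fill args (σ n)) = fill args (P.subst σ) :=
          (subst_subst _ _ _).symm
        rw [h4]
        by_cases hP' : P.subst σ ∈ r.prem
        · exact hT' (hT _ hP')
        · exact hx _ (List.mem_map_of_mem (List.mem_filter.2 ⟨h3 P hP, by simpa using hP'⟩))

/-- A conclusion that is also a premise would be cut out, hence the condition. The exact last line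
matters where the refutation must end in falsity. -/
theorem getLast_use {r : Rule} {args : List (Fml EVar)} (hr : Fml.Entails r.prem r.concl)
    (h : r.concl ∉ r.prem) : (use S r args).getLast? = some (fill args r.concl) := by
  classical
  obtain ⟨-, h1⟩ := (S.complete _ _ hr).choose_spec
  unfold use derivation
  rw [dif_pos hr]
  obtain ⟨l, hl⟩ := List.getLast?_eq_some_iff.1 h1
  rw [hl, List.filter_append]
  have : [r.concl].filter (fun B => B ∉ r.prem) = [r.concl] := by simp [h]
  rw [this, List.map_append]
  exact List.getLast?_concat

theorem concl_mem {r : Rule} {args : List (Fml EVar)} {T T' : Set (Fml EVar)}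
    (hr : Fml.Entails r.prem r.concl) (hT : ∀ B ∈ r.prem, fill args B ∈ T) (hTT : T ⊆ T')
    (hu : ∀ x ∈ use S r args, x ∈ T') : fill args r.concl ∈ T' := by
  by_cases h : r.concl ∈ r.prem
  · exact hTT (hT _ h)
  · exact hu _ (List.mem_of_getLast? (getLast_use hr h))

variable {α : Type*} [TreeCode α]

theorem polyTime_use {ι : Type*} [TreeCode ι] [Finite ι] (r : ι → Rule) {e : α → ι}
    {args : α → List (Fml EVar)} (he : PolyTime e) (ha : PolyTime args) :
    PolyTime fun a => use S (r (e a)) (args a) :=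
  PolyTime.finite_case (f := fun i a => use S (r i) (args a)) he
    fun _ => PolyTime.map_subst ha _

@[fun_prop]
theorem polyTime_use_const (r : Rule) {args : α → List (Fml EVar)} (ha : PolyTime args) :
    PolyTime fun a => use S r (args a) := PolyTime.map_subst ha _

end Use

/-! ### Linear forms as formulas -/

noncomputable instance : TreeCode (ZMod 2) := finiteCode (ZMod 2)

/-- The Boolean constant for an element of the field with two elements. -/
def cst {V : Type} (a : ZMod 2) : Fml V := if a = 0 then .ff else .tt

/-- The sum of `a.1 x` and `a.2 (1 - x)`. -/
def sel2 {V : Type} (a : ZMod 2 × ZMod 2) (x : Fml V) : Fml V :=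
  .or (.and (cst a.1) x) (.and (cst a.2) (.neg x))

/-- The product of `a.1 x + a.2 (1 - x)` and `c`. -/
def term {V : Type} (a : ZMod 2 × ZMod 2) (x c : Fml V) : Fml V := .and (sel2 a x) c

/-- A sum of terms. -/
def lin (n : ℕ) (w : ℕ → ZMod 2 × ZMod 2) (x : Fml EVar) (c : ℕ → Fml EVar) : Fml EVar :=
  (tab n fun j => term (w j) x (c j)).foldl .xor .ff

theorem lin_succ (n : ℕ) (w : ℕ → ZMod 2 × ZMod 2) (x : Fml EVar) (c : ℕ → Fml EVar) :
    lin (n + 1) w x c = .xor (lin n w x c) (term (w n) x (c n)) := by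
  rw [lin, tab_succ, List.foldl_append]
  rfl

theorem lin_congr {n : ℕ} {w w' : ℕ → ZMod 2 × ZMod 2} (x : Fml EVar) (c : ℕ → Fml EVar)
    (h : ∀ j < n, w j = w' j) : lin n w x c = lin n w' x c := by
  induction n with
  | zero => rfl
  | succ n ih => rw [lin_succ, lin_succ, ih fun j hj => h j (by omega), h n (by omega)]

theorem fill_cst (args : List (Fml EVar)) (a : ZMod 2) : fill args (cst a) = cst a := by
  unfold cst
  split_ifs <;> rfl

theorem fill_sel2 (args : List (Fml EVar)) (a : ZMod 2 × ZMod 2) (x : Fml ℕ) :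
    fill args (sel2 a x) = sel2 a (fill args x) := by
  simp only [sel2, ← fill_cst args]
  rfl

theorem fill_term (args : List (Fml EVar)) (a : ZMod 2 × ZMod 2) (x c : Fml ℕ) :
    fill args (term a x c) = term a (fill args x) (fill args c) := by
  simp only [term, ← fill_sel2 args]
  rfl

/-- Componentwise `w + b a`. -/
def addMul (w : ZMod 2 × ZMod 2) (b : ZMod 2) (a : ZMod 2 × ZMod 2) : ZMod 2 × ZMod 2 :=
  (w.1 + b * a.1, w.2 + b * a.2)

theorem eval_cst {V : Type} (a : ZMod 2) (v : V → Bool) : (cst a).eval v = decide (a ≠ 0) := by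
  unfold cst
  split_ifs with h <;> simp [h, Fml.eval]

/-! ### The rules that the refutation uses -/

/-- Facts about long sums are proved by a base rule and a step rule that appends one term. The field
and Boolean parameters of the rules range over finite types, so only finitely many schematic
derivations are ever needed. -/
def zeroRule : Rule := ⟨[], .neg .ff⟩

def zeroStepRule : Rule := ⟨[.neg (.var 0)], .neg (.xor (.var 0) (term 0 (.var 1) (.var 2)))⟩

def addRule (b : ZMod 2) : Rule := ⟨[], .iff (.xor .ff (.and (cst b) .ff)) .ff⟩

/-- Metavariables 0, 1, 2 stand for the sums so far with weights `w`, `a` and `w + b a`; 3 is the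
selecting formula and 4 the new summand. -/
def addStepRule (w : ZMod 2 × ZMod 2) (b : ZMod 2) (a : ZMod 2 × ZMod 2) : Rule :=
  ⟨[.iff (.xor (.var 0) (.and (cst b) (.var 1))) (.var 2)],
    .iff (.xor (.xor (.var 0) (term w (.var 3) (.var 4)))
      (.and (cst b) (.xor (.var 1) (term a (.var 3) (.var 4)))))
      (.xor (.var 2) (term (addMul w b a) (.var 3) (.var 4)))⟩

def combRule : Rule := ⟨[.neg (.var 0)], .iff .ff (.var 0)⟩

/-- The extension variable 2 is replaced by its definition 3 in a linear form, with weight `b`. A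
pair `(b, 0)` selected by truth acts as the scalar `b`. -/
def combStepRule (b : ZMod 2) : Rule :=
  ⟨[.iff (.var 0) (.var 1), .iff (.var 2) (.var 3),
      .iff (.xor (.var 1) (.and (cst b) (.var 3))) (.var 4)],
    .iff (.xor (.var 0) (term (b, 0) .tt (.var 2))) (.var 4)⟩

def splitRule : Rule := ⟨[], .iff .ff (.and (.var 0) .ff)⟩

/-- Distributivity: the common factor given by the masks `m` is pulled out of one more summand. -/
def splitStepRule (m : ZMod 2 × ZMod 2) (b : ZMod 2) : Rule :=
  ⟨[.iff (.var 0) (.and (sel2 m (.var 2)) (.var 1))],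
    .iff (.xor (.var 0) (term (m.1 * b, m.2 * b) (.var 2) (.var 3)))
      (.and (sel2 m (.var 2)) (.xor (.var 1) (term (b, 0) .tt (.var 3))))⟩

def transRule : Rule := ⟨[.iff (.var 0) (.var 1), .iff (.var 1) (.var 2)], .iff (.var 0) (.var 2)⟩

def oneRule : Rule := ⟨[.iff (.var 0) .tt], .xor .ff (term (1, 0) .tt (.var 0))⟩

def oneStepRule : Rule := ⟨[.var 0], .xor (.var 0) (term (0, 0) .tt (.var 1))⟩

/-- For the empty clause both masks are 1, so the factor is a tautology and truth passes to the next
level. -/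
def upRule : Rule :=
  ⟨[.iff (.var 0) (.and (sel2 (1, 1) (.var 1)) (.var 2)), .var 2], .var 0⟩

def reflRule : Rule := ⟨[], .imp (.var 0) (.var 0)⟩

def downRule : Rule :=
  ⟨[.imp (.var 0) (.var 1), .iff (.var 1) (.and (.var 2) (.var 3))], .imp (.var 0) (.var 3)⟩

def maskRule : Rule :=
  ⟨[.imp (.var 0) (.var 1), .iff (.var 1) (.and (.var 2) (.var 3))], .imp (.var 0) (.var 2)⟩

def litRule (m : ZMod 2 × ZMod 2) (p : Bool) : Rule :=
  ⟨[.imp (.var 0) (sel2 m (.var 1))],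
    .imp (.var 0) (.neg (if p then .var 1 else .neg (.var 1)))⟩

def clauseRule : Rule := ⟨[], .imp (.var 0) (.neg .ff)⟩

def clauseStepRule : Rule :=
  ⟨[.imp (.var 0) (.neg (.var 1)), .imp (.var 0) (.neg (.var 2))],
    .imp (.var 0) (.neg (.or (.var 1) (.var 2)))⟩

def refuteRule : Rule := ⟨[.imp (.var 0) (.neg (.var 1)), .var 1], .neg (.var 0)⟩

def sumRule : Rule :=
  ⟨[.neg (.var 0), .neg (.var 1), .iff (.xor (.var 0) (.and (cst 1) (.var 1))) (.var 2)],
    .neg (.var 2)⟩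

def contraRule : Rule := ⟨[.var 0, .neg (.var 0)], .ff⟩

/-- A rule whose premises imply its conclusion. -/
def Sound (r : Rule) : Prop := Fml.Entails r.prem r.concl

theorem zeroRule_sound : Sound zeroRule := fun v _ => by simp [zeroRule, Fml.eval]

theorem zeroStepRule_sound : Sound zeroStepRule := by
  intro v
  simp only [zeroStepRule, List.forall_mem_cons, Fml.eval, term, sel2, eval_cst]
  generalize v 0 = p; generalize v 1 = q; generalize v 2 = r
  revert p q r; simp

theorem addRule_sound (b : ZMod 2) : Sound (addRule b) := fun v _ => by
  simp [addRule, Fml.eval]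

set_option maxRecDepth 20000 in
theorem addStepRule_sound (w : ZMod 2 × ZMod 2) (b : ZMod 2) (a : ZMod 2 × ZMod 2) :
    Sound (addStepRule w b a) := by
  intro v
  simp only [addStepRule, List.forall_mem_cons, List.not_mem_nil, false_implies, implies_true,
    and_true, Fml.eval, term, sel2, eval_cst, addMul]
  obtain ⟨w1, w2⟩ := w
  obtain ⟨a1, a2⟩ := a
  generalize v 0 = p; generalize v 1 = q; generalize v 2 = r
  generalize v 3 = s; generalize v 4 = t
  revert w1 w2 b a1 a2 p q r s t
  decide

theorem combRule_sound : Sound combRule := fun v h => by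
  simpa [combRule, Fml.eval] using h

theorem combStepRule_sound (b : ZMod 2) : Sound (combStepRule b) := by
  intro v
  simp only [combStepRule, List.forall_mem_cons, List.not_mem_nil, false_implies, implies_true,
    and_true, Fml.eval, term, sel2, eval_cst]
  generalize v 0 = p; generalize v 1 = q; generalize v 2 = r
  generalize v 3 = s; generalize v 4 = t
  revert b p q r s t
  decide

theorem splitRule_sound : Sound splitRule := fun v _ => by simp [splitRule, Fml.eval]

set_option maxRecDepth 20000 in
theorem splitStepRule_sound (m : ZMod 2 × ZMod 2) (b : ZMod 2) : Sound (splitStepRule m b) := by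
  intro v
  simp only [splitStepRule, List.forall_mem_cons, List.not_mem_nil, false_implies, implies_true,
    and_true, Fml.eval, term, sel2, eval_cst]
  obtain ⟨m1, m2⟩ := m
  generalize v 0 = p; generalize v 1 = q; generalize v 2 = r; generalize v 3 = s
  revert m1 m2 b p q r s
  decide

theorem transRule_sound : Sound transRule := fun v h => by
  simp_all [transRule, Fml.eval]

theorem oneRule_sound : Sound oneRule := fun v h => by
  simp_all [oneRule, Fml.eval, term, sel2, eval_cst]

theorem oneStepRule_sound : Sound oneStepRule := fun v h => by
  simp_all [oneStepRule, Fml.eval, term, sel2, eval_cst]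

theorem upRule_sound : Sound upRule := fun v h => by
  simp_all [upRule, Fml.eval, sel2, eval_cst]

theorem reflRule_sound : Sound reflRule := fun v _ => by simp [reflRule, Fml.eval]

theorem downRule_sound : Sound downRule := by
  intro v
  simp only [downRule, List.forall_mem_cons, List.not_mem_nil, false_implies, implies_true,
    and_true, Fml.eval]
  generalize v 0 = p; generalize v 1 = q; generalize v 2 = r; generalize v 3 = s
  revert p q r s
  decide

theorem maskRule_sound : Sound maskRule := by
  intro v
  simp only [maskRule, List.forall_mem_cons, List.not_mem_nil, false_implies, implies_true,
    and_true, Fml.eval]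
  generalize v 0 = p; generalize v 1 = q; generalize v 2 = r; generalize v 3 = s
  revert p q r s
  decide

theorem litRule_sound {m : ZMod 2 × ZMod 2} {p : Bool} (h : sel p m = 0) : Sound (litRule m p) := by
  intro v
  obtain ⟨m1, m2⟩ := m
  cases p <;> simp only [sel, cond_true, cond_false] at h <;> subst h <;>
    simp only [litRule, List.forall_mem_cons, List.not_mem_nil, false_implies, implies_true,
      and_true, Fml.eval, sel2, eval_cst, if_true, Bool.false_eq_true, if_false] <;>
    cases v 0 <;> cases v 1 <;> simp

theorem clauseRule_sound : Sound clauseRule := fun v _ => by simp [clauseRule, Fml.eval]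

theorem clauseStepRule_sound : Sound clauseStepRule := by
  intro v
  simp only [clauseStepRule, List.forall_mem_cons, List.not_mem_nil, false_implies, implies_true,
    and_true, Fml.eval]
  generalize v 0 = p; generalize v 1 = q; generalize v 2 = r
  revert p q r
  decide

theorem refuteRule_sound : Sound refuteRule := fun v h => by
  simp only [refuteRule, List.forall_mem_cons, Fml.eval] at h ⊢
  revert h
  cases v 0 <;> cases v 1 <;> simp

theorem sumRule_sound : Sound sumRule := fun v h => by
  simp only [sumRule, List.forall_mem_cons, Fml.eval, eval_cst] at h ⊢
  revert h
  cases v 0 <;> cases v 1 <;> cases v 2 <;> simp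

theorem contraRule_sound : Sound contraRule := fun v h => by
  simp_all [contraRule, Fml.eval]

end EF

@[fun_prop]
theorem PolyTime.unary_sub {α : Type*} [TreeCode α] {m n : α → ℕ}
    (hm : PolyTime fun a => un (m a)) (hn : PolyTime fun a => un (n a)) :
    PolyTime fun a => un (m a - n a) := by
  have h : ∀ a, ((HitSim.tab (m a) fun _ => true).drop (n a)).length = m a - n a := fun a => by
    rw [List.length_drop, length_tab]
  simp only [← h]
  fun_prop

namespace EF

/-! ### The refutation in Extended Frege -/

section Lines

variable (S : FregeSystem) (F H : CNF)

/-- The extension variables. -/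
def cv (k j : ℕ) : Fml EVar := .var (.ext (ev H k j))

/-- The original variables of `H`. -/
def xf (k : ℕ) : Fml EVar := .var (.orig (xv H k))

/-- The definition of the `j`-th extension variable at level `k`. -/
def extFml (k j : ℕ) : Fml EVar :=
  if k = 0 then if j = 0 then .tt else .ff
  else lin (clauses H).length (fun j' => coef (lev (ZMod 2) H k) j j') (xf H (k - 1)) (cv H (k - 1))

/-- The coefficients of the linear form for the `i`-th clause at level `k`. -/
def yw (k i j : ℕ) : ZMod 2 × ZMod 2 := (entry (lev (ZMod 2) H k) j i, 0)

/-- The formula for the part of the translation of the `i`-th clause that stems from the first `k`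
variables. -/
def yf (k i : ℕ) : Fml EVar := lin (clauses H).length (yw H k i) .tt (cv H k)

/-- The values of the part of the translation of the `i`-th clause that stems from `x_k`. -/
def mw (k i : ℕ) : ZMod 2 × ZMod 2 :=
  (mask (ZMod 2) (xv H k) true (cl H i), mask (ZMod 2) (xv H k) false (cl H i))

/-- The part of the translation of the `i`-th clause that stems from `x_k`. -/
def gf (k i : ℕ) : Fml EVar := sel2 (mw H k i) (xf H k)

/-- The extension axioms. -/
def axioms : List (Fml EVar) :=
  ftab ((vars H).length + 1) fun k => tab (clauses H).length fun j =>
    .iff (cv H k j) (extFml H k j)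

/-- A derivation of the negation of the zero form. -/
noncomputable def zeroLines (x : Fml EVar) (k : ℕ) : List (Fml EVar) :=
  use S zeroRule [] ++ ftab (clauses H).length fun s =>
    use S zeroStepRule [lin s (fun _ => (0, 0)) x (cv H k), x, cv H k s]

/-- A derivation of the additivity of linear forms. -/
noncomputable def addLines (x : Fml EVar) (k : ℕ) (w : ℕ → ZMod 2 × ZMod 2) (b : ZMod 2)
    (a : ℕ → ZMod 2 × ZMod 2) : List (Fml EVar) :=
  use S (addRule b) [] ++ ftab (clauses H).length fun s =>
    use S (addStepRule (w s) b (a s)) [lin s w x (cv H k), lin s a x (cv H k),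
      lin s (fun j => addMul (w j) b (a j)) x (cv H k), x, cv H k s]

/-- A partial sum of the coefficients that the extension axioms yield for the `i`-th clause. -/
def combW (k i t j : ℕ) : ZMod 2 × ZMod 2 :=
  (∑ j' ∈ Finset.range t, (coef (lev (ZMod 2) H (k + 1)) j' j).1 *
      entry (lev (ZMod 2) H (k + 1)) j' i,
    ∑ j' ∈ Finset.range t, (coef (lev (ZMod 2) H (k + 1)) j' j).2 *
      entry (lev (ZMod 2) H (k + 1)) j' i)

def combF (k i t : ℕ) : Fml EVar := lin (clauses H).length (combW H k i t) (xf H k) (cv H k)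

/-- A derivation of the form of the `i`-th clause at level `k + 1` in terms of level `k`. -/
noncomputable def combLines (k i : ℕ) : List (Fml EVar) :=
  zeroLines S H (xf H k) k ++ (use S combRule [combF H k i 0] ++ ftab (clauses H).length fun t =>
    addLines S H (xf H k) k (combW H k i t) (entry (lev (ZMod 2) H (k + 1)) t i)
      (coef (lev (ZMod 2) H (k + 1)) t) ++
    use S (combStepRule (entry (lev (ZMod 2) H (k + 1)) t i))
      [lin t (yw H (k + 1) i) .tt (cv H (k + 1)), combF H k i t, cv H (k + 1) t,
        extFml H (k + 1) t, combF H k i (t + 1)])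

/-- By the elimination identity these are the weights that remain when all extension axioms have
been combined, that is, the final `combW`. -/
def splitW (k i j : ℕ) : ZMod 2 × ZMod 2 :=
  ((mw H k i).1 * entry (lev (ZMod 2) H k) j i, (mw H k i).2 * entry (lev (ZMod 2) H k) j i)

/-- A derivation of the recursion for the parts of the translation of the `i`-th clause. -/
noncomputable def splitLines (k i : ℕ) : List (Fml EVar) :=
  use S splitRule [gf H k i] ++ ((ftab (clauses H).length fun s =>
    use S (splitStepRule (mw H k i) (entry (lev (ZMod 2) H k) s i))
      [lin s (splitW H k i) (xf H k) (cv H k), lin s (yw H k i) .tt (cv H k), xf H k, cv H k s]) ++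
    use S transRule [yf H (k + 1) i, combF H k i (clauses H).length, .and (gf H k i) (yf H k i)])

/-- A derivation of the translation of the empty clause. -/
noncomputable def oneLines : List (Fml EVar) :=
  use S oneRule [cv H 0 0] ++ ((ftab (clauses H).tail.length fun s =>
    use S oneStepRule [lin (s + 1) (yw H 0 0) .tt (cv H 0), cv H 0 (s + 1)]) ++
    ftab (vars H).length fun k => use S upRule [yf H (k + 1) 0, xf H k, yf H k 0])

/-- A derivation, from the translation of the `i`-th clause, of its factors. -/
noncomputable def downLines (i : ℕ) : List (Fml EVar) :=
  use S reflRule [yf H (vars H).length i] ++ ftab (vars H).length fun t =>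
    use S downRule [yf H (vars H).length i, yf H ((vars H).length - t) i,
      gf H ((vars H).length - (t + 1)) i, yf H ((vars H).length - (t + 1)) i] ++
    use S maskRule [yf H (vars H).length i, yf H ((vars H).length - t) i,
      gf H ((vars H).length - (t + 1)) i, yf H ((vars H).length - (t + 1)) i]

/-- A derivation of the negation of the clause `C` from the assumption that all literals of `D`
are false. -/
noncomputable def negLines (A : Fml EVar) (C D : Clause) : List (Fml EVar) :=
  use S clauseRule [A] ++ ((ftab C.length fun t =>
    use S (litRule (mask (ZMod 2) (C.getD (C.length - (t + 1)) ⟨0, true⟩).var true D,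
        mask (ZMod 2) (C.getD (C.length - (t + 1)) ⟨0, true⟩).var false D)
        (C.getD (C.length - (t + 1)) ⟨0, true⟩).pos)
      [A, .var (.orig (C.getD (C.length - (t + 1)) ⟨0, true⟩).var)] ++
    use S clauseStepRule [A, (C.getD (C.length - (t + 1)) ⟨0, true⟩).toFml,
      Clause.toFml (C.drop (C.length - t))]) ++
    use S refuteRule [A, C.toFml])

/-- A refutation of the translation of the `i + 1`-st clause. -/
noncomputable def clauseLines (i : ℕ) : List (Fml EVar) :=
  downLines S H (i + 1) ++ negLines S (yf H (vars H).length (i + 1))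
    (strengthening F (cl H (i + 1))) (cl H (i + 1))

def sumW (t j : ℕ) : ZMod 2 × ZMod 2 :=
  (∑ i ∈ Finset.range t, entry (lev (ZMod 2) H (vars H).length) j (i + 1), 0)

def sumF (t : ℕ) : Fml EVar := lin (clauses H).length (sumW H t) .tt (cv H (vars H).length)

/-- A derivation of the negation of the sum of the translations of the clauses. -/
noncomputable def sumLines : List (Fml EVar) :=
  zeroLines S H .tt (vars H).length ++ ftab (clauses H).tail.length fun t =>
    addLines S H .tt (vars H).length (sumW H t) 1 (yw H (vars H).length (t + 1)) ++
    use S sumRule [sumF H t, yf H (vars H).length (t + 1), sumF H (t + 1)]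

/-- The lines after the extension axioms and the clauses. -/
noncomputable def mainLines : List (Fml EVar) :=
  (ftab (vars H).length fun k => ftab (clauses H).length fun i =>
    combLines S H k i ++ splitLines S H k i) ++ (oneLines S H ++
    ((ftab (clauses H).tail.length fun i => clauseLines S F H i) ++ (sumLines S H ++
    use S contraRule [yf H (vars H).length 0])))

noncomputable def lines : List (Fml EVar) := axioms H ++ (F.map Clause.toFml ++ mainLines S F H)

end Lines

/-! ### Polynomial-time constructibility of the Extended Frege refutation -/

section PolyTime

variable {α : Type*} [TreeCode α] {F H : α → CNF}

@[fun_prop]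
theorem polyTime_cst {V : Type} [TreeCode V] {a : α → ZMod 2} (ha : PolyTime a) :
    PolyTime fun x => (cst (a x) : Fml V) :=
  PolyTime.finite_case (f := fun a (_ : α) => (cst a : Fml V)) ha fun _ => PolyTime.const _

@[fun_prop]
theorem polyTime_sel2 {V : Type} [TreeCode V] {a : α → ZMod 2 × ZMod 2} {x : α → Fml V}
    (ha : PolyTime a) (hx : PolyTime x) : PolyTime fun p => sel2 (a p) (x p) := by
  unfold sel2
  fun_prop

@[fun_prop]
theorem polyTime_addMul {w a : α → ZMod 2 × ZMod 2} {b : α → ZMod 2} (hw : PolyTime w)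
    (hb : PolyTime b) (ha : PolyTime a) : PolyTime fun p => addMul (w p) (b p) (a p) := by
  unfold addMul
  fun_prop

@[fun_prop]
theorem polyTime_cv {k j : α → ℕ} (hH : PolyTime H) (hk : PolyTime fun a => un (k a))
    (hj : PolyTime fun a => un (j a)) : PolyTime fun a => cv (H a) (k a) (j a) := by
  unfold cv
  fun_prop

@[fun_prop]
theorem polyTime_xf {k : α → ℕ} (hH : PolyTime H) (hk : PolyTime fun a => un (k a)) :
    PolyTime fun a => xf (H a) (k a) := by
  unfold xf
  fun_prop

@[fun_prop]
theorem polyTime_lin {n k : α → ℕ} {w : α → ℕ → ZMod 2 × ZMod 2} {x : α → Fml EVar}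
    (hH : PolyTime H) (hn : PolyTime fun a => un (n a)) (hk : PolyTime fun a => un (k a))
    (hw : PolyTime fun p : α × Unary => w p.1 p.2.val) (hx : PolyTime x) :
    PolyTime fun a => lin (n a) (w a) (x a) (cv (H a) (k a)) := by
  have hk' : PolyTime fun p : α × Unary => un (k p.1) :=
    PolyTime.comp (g := fun a => un (k a)) hk (.fst .id)
  exact PolyTime.foldl_xor (PolyTime.tab (f := fun a j => term (w a j) (x a) (cv (H a) (k a) j)) hn
    (.fml_and (polyTime_sel2 hw (by fun_prop)) (polyTime_cv (by fun_prop) hk' (by fun_prop))))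
    (.const _)

@[fun_prop]
theorem polyTime_yw {k i j : α → ℕ} (hH : PolyTime H) (hk : PolyTime fun a => un (k a))
    (hi : PolyTime fun a => un (i a)) (hj : PolyTime fun a => un (j a)) :
    PolyTime fun a => yw (H a) (k a) (i a) (j a) := by
  unfold yw
  fun_prop

@[fun_prop]
theorem polyTime_mw {k i : α → ℕ} (hH : PolyTime H) (hk : PolyTime fun a => un (k a))
    (hi : PolyTime fun a => un (i a)) : PolyTime fun a => mw (H a) (k a) (i a) := by
  unfold mw
  fun_prop

@[fun_prop]
theorem polyTime_gf {k i : α → ℕ} (hH : PolyTime H) (hk : PolyTime fun a => un (k a))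
    (hi : PolyTime fun a => un (i a)) : PolyTime fun a => gf (H a) (k a) (i a) := by
  unfold gf
  fun_prop

@[fun_prop]
theorem polyTime_extFml {k j : α → ℕ} (hH : PolyTime H) (hk : PolyTime fun a => un (k a))
    (hj : PolyTime fun a => un (j a)) : PolyTime fun a => extFml (H a) (k a) (j a) := by
  have : PolyTime fun p : CNF × Unary × Unary => extFml p.1 p.2.1.val p.2.2.val := by
    unfold extFml
    fun_prop
  have h := PolyTime.comp this (.prodMk hH (.prodMk hk hj))
  exact h

@[fun_prop]
theorem polyTime_yf {k i : α → ℕ} (hH : PolyTime H) (hk : PolyTime fun a => un (k a))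
    (hi : PolyTime fun a => un (i a)) : PolyTime fun a => yf (H a) (k a) (i a) := by
  have : PolyTime fun p : CNF × Unary × Unary => yf p.1 p.2.1.val p.2.2.val := by
    unfold yf
    fun_prop
  have h := PolyTime.comp this (.prodMk hH (.prodMk hk hi))
  exact h

@[fun_prop]
theorem polyTime_combW {k i t j : α → ℕ} (hH : PolyTime H) (hk : PolyTime fun a => un (k a))
    (hi : PolyTime fun a => un (i a)) (ht : PolyTime fun a => un (t a))
    (hj : PolyTime fun a => un (j a)) : PolyTime fun a => combW (H a) (k a) (i a) (t a) (j a) := by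
  have : PolyTime fun p : CNF × Unary × Unary × Unary × Unary =>
      combW p.1 p.2.1.val p.2.2.1.val p.2.2.2.1.val p.2.2.2.2.val := by
    unfold combW
    fun_prop
  have h := PolyTime.comp this (.prodMk hH (.prodMk hk (.prodMk hi (.prodMk ht hj))))
  exact h

@[fun_prop]
theorem polyTime_combF {k i t : α → ℕ} (hH : PolyTime H) (hk : PolyTime fun a => un (k a))
    (hi : PolyTime fun a => un (i a)) (ht : PolyTime fun a => un (t a)) :
    PolyTime fun a => combF (H a) (k a) (i a) (t a) := by
  have : PolyTime fun p : CNF × Unary × Unary × Unary =>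
      combF p.1 p.2.1.val p.2.2.1.val p.2.2.2.val := by
    unfold combF
    fun_prop
  have h := PolyTime.comp this (.prodMk hH (.prodMk hk (.prodMk hi ht)))
  exact h

@[fun_prop]
theorem polyTime_splitW {k i j : α → ℕ} (hH : PolyTime H) (hk : PolyTime fun a => un (k a))
    (hi : PolyTime fun a => un (i a)) (hj : PolyTime fun a => un (j a)) :
    PolyTime fun a => splitW (H a) (k a) (i a) (j a) := by
  unfold splitW
  fun_prop

@[fun_prop]
theorem polyTime_sumW {t j : α → ℕ} (hH : PolyTime H) (ht : PolyTime fun a => un (t a))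
    (hj : PolyTime fun a => un (j a)) : PolyTime fun a => sumW (H a) (t a) (j a) := by
  have : PolyTime fun p : CNF × Unary × Unary => sumW p.1 p.2.1.val p.2.2.val := by
    unfold sumW
    fun_prop
  have h := PolyTime.comp this (.prodMk hH (.prodMk ht hj))
  exact h

@[fun_prop]
theorem polyTime_sumF {t : α → ℕ} (hH : PolyTime H) (ht : PolyTime fun a => un (t a)) :
    PolyTime fun a => sumF (H a) (t a) := by
  have : PolyTime fun p : CNF × Unary => sumF p.1 p.2.val := by
    unfold sumF
    fun_prop
  have h := PolyTime.comp this (.prodMk hH ht)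
  exact h

variable (S : FregeSystem)

@[fun_prop]
theorem polyTime_zeroLines {x : α → Fml EVar} {k : α → ℕ} (hH : PolyTime H) (hx : PolyTime x)
    (hk : PolyTime fun a => un (k a)) : PolyTime fun a => zeroLines S (H a) (x a) (k a) := by
  have : PolyTime fun p : CNF × Fml EVar × Unary => zeroLines S p.1 p.2.1 p.2.2.val := by
    unfold zeroLines
    fun_prop
  have h := PolyTime.comp this (.prodMk hH (.prodMk hx hk))
  exact h

@[fun_prop]
theorem polyTime_addStep {args : α → List (Fml EVar)} {w a : α → ZMod 2 × ZMod 2} {b : α → ZMod 2}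
    (hargs : PolyTime args) (hw : PolyTime w) (hb : PolyTime b) (ha : PolyTime a) :
    PolyTime fun p => use S (addStepRule (w p) (b p) (a p)) (args p) :=
  polyTime_use (fun q : (ZMod 2 × ZMod 2) × ZMod 2 × ZMod 2 × ZMod 2 =>
    addStepRule q.1 q.2.1 q.2.2) (.prodMk hw (.prodMk hb ha)) hargs

@[fun_prop]
theorem polyTime_add {args : α → List (Fml EVar)} {b : α → ZMod 2}
    (hargs : PolyTime args) (hb : PolyTime b) :
    PolyTime fun p => use S (addRule (b p)) (args p) := polyTime_use addRule hb hargs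

@[fun_prop]
theorem polyTime_combStep {args : α → List (Fml EVar)} {b : α → ZMod 2}
    (hargs : PolyTime args) (hb : PolyTime b) :
    PolyTime fun p => use S (combStepRule (b p)) (args p) := polyTime_use combStepRule hb hargs

@[fun_prop]
theorem polyTime_splitStep {args : α → List (Fml EVar)} {m : α → ZMod 2 × ZMod 2}
    {b : α → ZMod 2} (hargs : PolyTime args) (hm : PolyTime m) (hb : PolyTime b) :
    PolyTime fun p => use S (splitStepRule (m p) (b p)) (args p) :=
  polyTime_use (fun q : (ZMod 2 × ZMod 2) × ZMod 2 => splitStepRule q.1 q.2) (.prodMk hm hb) hargs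

@[fun_prop]
theorem polyTime_lit {args : α → List (Fml EVar)} {m : α → ZMod 2 × ZMod 2}
    {b : α → Bool} (hargs : PolyTime args) (hm : PolyTime m) (hb : PolyTime b) :
    PolyTime fun p => use S (litRule (m p) (b p)) (args p) :=
  polyTime_use (fun q : (ZMod 2 × ZMod 2) × Bool => litRule q.1 q.2) (.prodMk hm hb) hargs

@[fun_prop]
theorem polyTime_addLines {x : α → Fml EVar} {k : α → ℕ} {w a : α → ℕ → ZMod 2 × ZMod 2}
    {b : α → ZMod 2} (hH : PolyTime H) (hx : PolyTime x) (hk : PolyTime fun a => un (k a))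
    (hw : PolyTime fun p : α × Unary => w p.1 p.2.val) (hb : PolyTime b)
    (ha : PolyTime fun p : α × Unary => a p.1 p.2.val) :
    PolyTime fun p => addLines S (H p) (x p) (k p) (w p) (b p) (a p) := by
  have hw' : PolyTime fun p : (α × Unary) × Unary => w p.1.1 p.2.val :=
    PolyTime.comp (g := fun p : α × Unary => w p.1 p.2.val) hw (.prodMk (.fst (.fst .id)) (.snd .id))
  have ha' : PolyTime fun p : (α × Unary) × Unary => a p.1.1 p.2.val :=
    PolyTime.comp (g := fun p : α × Unary => a p.1 p.2.val) ha (.prodMk (.fst (.fst .id)) (.snd .id))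
  have hk' : PolyTime fun p : α × Unary => un (k p.1) :=
    PolyTime.comp (g := fun a => un (k a)) hk (.fst .id)
  unfold addLines
  refine PolyTime.append (by fun_prop) (PolyTime.ftab (by fun_prop) ?_)
  refine polyTime_addStep S (PolyTime.cons (polyTime_lin ?_ ?_ hk' hw' ?_) (.cons
    (polyTime_lin ?_ ?_ hk' ha' ?_) (.cons (polyTime_lin ?_ ?_ hk' (polyTime_addMul hw' ?_ ha') ?_)
      (.cons ?_ (.cons (polyTime_cv ?_ hk' ?_) (.const _)))))) hw ?_ ha <;> fun_prop

@[fun_prop]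
theorem polyTime_combLines {k i : α → ℕ} (hH : PolyTime H) (hk : PolyTime fun a => un (k a))
    (hi : PolyTime fun a => un (i a)) : PolyTime fun a => combLines S (H a) (k a) (i a) := by
  have : PolyTime fun p : CNF × Unary × Unary => combLines S p.1 p.2.1.val p.2.2.val := by
    unfold combLines
    fun_prop
  have h := PolyTime.comp this (.prodMk hH (.prodMk hk hi))
  exact h

@[fun_prop]
theorem polyTime_splitLines {k i : α → ℕ} (hH : PolyTime H) (hk : PolyTime fun a => un (k a))
    (hi : PolyTime fun a => un (i a)) : PolyTime fun a => splitLines S (H a) (k a) (i a) := by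
  have : PolyTime fun p : CNF × Unary × Unary => splitLines S p.1 p.2.1.val p.2.2.val := by
    unfold splitLines
    fun_prop
  have h := PolyTime.comp this (.prodMk hH (.prodMk hk hi))
  exact h

@[fun_prop]
theorem polyTime_oneLines (hH : PolyTime H) : PolyTime fun a => oneLines S (H a) := by
  unfold oneLines
  fun_prop

@[fun_prop]
theorem polyTime_downLines {i : α → ℕ} (hH : PolyTime H) (hi : PolyTime fun a => un (i a)) :
    PolyTime fun a => downLines S (H a) (i a) := by
  have : PolyTime fun p : CNF × Unary => downLines S p.1 p.2.val := by
    unfold downLines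
    fun_prop
  have h := PolyTime.comp this (.prodMk hH hi)
  exact h

@[fun_prop]
theorem polyTime_negLines {A : α → Fml EVar} {C D : α → Clause} (hA : PolyTime A)
    (hC : PolyTime C) (hD : PolyTime D) : PolyTime fun a => negLines S (A a) (C a) (D a) := by
  have : PolyTime fun p : Fml EVar × Clause × Clause => negLines S p.1 p.2.1 p.2.2 := by
    unfold negLines
    fun_prop
  have h := PolyTime.comp this (.prodMk hA (.prodMk hC hD))
  exact h

@[fun_prop]
theorem polyTime_clauseLines {i : α → ℕ} (hF : PolyTime F) (hH : PolyTime H)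
    (hi : PolyTime fun a => un (i a)) : PolyTime fun a => clauseLines S (F a) (H a) (i a) := by
  unfold clauseLines
  fun_prop

theorem polyTime_lines : PolyTime fun p : CNF × CNF => lines S p.1 p.2 := by
  unfold lines axioms mainLines sumLines
  fun_prop

end PolyTime

end EF

namespace EF

/-! ### Correctness of the refutation in Extended Frege -/

/-! ### Composition of derivations with stated goals -/

section Derives

variable {S : FregeSystem} {T T' G G' : Set (Fml EVar)} {l m : List (Fml EVar)}

/-- The lines `l` are a derivation of the formulas in `G` from those in `T`. -/
def Derives (S : FregeSystem) (T : Set (Fml EVar)) (l : List (Fml EVar)) (G : Set (Fml EVar)) :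
    Prop := Valid (step S) T l ∧ G ⊆ T ∪ {x | x ∈ l}

theorem Derives.mono (h : Derives S T l G) (hT : T ⊆ T') (hG : G' ⊆ G) : Derives S T' l G' :=
  ⟨h.1.mono (step_mono S) hT, hG.trans (h.2.trans (Set.union_subset_union_left _ hT))⟩

theorem Derives.append (hl : Derives S T l G) (hm : Derives S (T ∪ G) m G') :
    Derives S T (l ++ m) (G ∪ G') := by
  refine ⟨hl.1.append (step_mono S) fun T' hT hx => hm.1.mono (step_mono S)
    (Set.union_subset hT fun x h => ?_), ?_⟩
  · exact (hl.2 h).elim (fun h => hT h) (hx x)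
  · rintro x (h | h)
    · exact (hl.2 h).imp id (List.mem_append_left _)
    · rcases hm.2 h with (h | h) | h
      · exact Or.inl h
      · exact (hl.2 h).imp id (List.mem_append_left _)
      · exact Or.inr (List.mem_append_right _ h)

theorem Derives.trans (hl : Derives S T l G) (hm : Derives S (T ∪ G) m G') :
    Derives S T (l ++ m) G' :=
  (hl.append hm).mono subset_rfl Set.subset_union_right

theorem Derives.of_mem {A : Fml EVar} (h : A ∈ T) : Derives S T [] {A} :=
  ⟨Valid.nil _, fun x hx => Or.inl (by rwa [Set.mem_singleton_iff.1 hx])⟩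

theorem Derives.use {r : Rule} {args : List (Fml EVar)} {A : Fml EVar} (hr : Sound r)
    (hA : fill args r.concl = A) (h : ∀ B ∈ r.prem, fill args B ∈ T) :
    Derives S T (use S r args) {A} := by
  refine ⟨valid_use hr h, Set.singleton_subset_iff.2 ?_⟩
  rw [← hA]
  exact concl_mem hr h Set.subset_union_left fun x hx => Or.inr hx

theorem Derives.ftab {n : ℕ} {f : ℕ → List (Fml EVar)} {G : ℕ → Set (Fml EVar)}
    (h : ∀ i < n, Derives S (T ∪ {A | ∃ j < i, A ∈ G j}) (f i) (G i)) :
    Derives S T (ftab n f) {A | ∃ j < n, A ∈ G j} := by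
  induction n with
  | zero => exact ⟨Valid.nil _, fun A hA => by simp at hA⟩
  | succ n ih =>
    rw [ftab_succ]
    refine ((ih fun i hi => h i (by omega)).append (h n (Nat.lt_succ_self _))).mono subset_rfl ?_
    rintro A ⟨j, hj, hA⟩
    rcases Nat.lt_succ_iff_lt_or_eq.1 hj with hj | rfl
    · exact Or.inl ⟨j, hj, hA⟩
    · exact Or.inr hA

theorem Derives.chain {n : ℕ} {f : ℕ → List (Fml EVar)} {P : ℕ → Fml EVar} (h0 : P 0 ∈ T)
    (h : ∀ i < n, Derives S (T ∪ {P i}) (f i) {P (i + 1)}) :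
    Derives S T (HitSim.ftab n f) {P n} := by
  induction n with
  | zero => exact .of_mem h0
  | succ n ih =>
    rw [ftab_succ]
    exact (ih fun i hi => h i (by omega)).trans (h n (Nat.lt_succ_self _))

end Derives

section Fill

variable (args : List (Fml EVar)) (A B : Fml ℕ)

theorem fill_var (n : ℕ) : fill args (.var n) = args.getD n .ff := rfl
theorem fill_tt : fill args .tt = .tt := rfl
theorem fill_ff : fill args .ff = .ff := rfl
theorem fill_neg : fill args (.neg A) = .neg (fill args A) := rfl
theorem fill_and : fill args (.and A B) = .and (fill args A) (fill args B) := rfl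
theorem fill_or : fill args (.or A B) = .or (fill args A) (fill args B) := rfl
theorem fill_imp : fill args (.imp A B) = .imp (fill args A) (fill args B) := rfl
theorem fill_iff : fill args (.iff A B) = .iff (fill args A) (fill args B) := rfl
theorem fill_xor : fill args (.xor A B) = .xor (fill args A) (fill args B) := rfl

attribute [simp] fill_var fill_tt fill_ff fill_neg fill_and fill_or fill_imp fill_iff fill_xor
  fill_cst fill_sel2 fill_term

end Fill

/-! ### Derivations of the linear forms and of the contradiction -/

section Main

variable {S : FregeSystem} {F H : CNF} {T : Set (Fml EVar)}

theorem lin_zero (w : ℕ → ZMod 2 × ZMod 2) (x : Fml EVar) (c : ℕ → Fml EVar) :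
    lin 0 w x c = .ff := rfl

theorem derives_zeroLines (x : Fml EVar) (k : ℕ) :
    Derives S T (zeroLines S H x k)
      {.neg (lin (clauses H).length (fun _ => (0, 0)) x (cv H k))} := by
  refine (Derives.use zeroRule_sound rfl (by simp [zeroRule])).trans
    (Derives.chain (P := fun s => .neg (lin s (fun _ => (0, 0)) x (cv H k))) ?_ fun s _ =>
      Derives.use zeroStepRule_sound ?_ ?_)
  · exact Or.inr rfl
  · simp [zeroStepRule, lin_succ]; rfl
  · simp [zeroStepRule]

theorem derives_addLines (x : Fml EVar) (k : ℕ) (w : ℕ → ZMod 2 × ZMod 2) (b : ZMod 2)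
    (a : ℕ → ZMod 2 × ZMod 2) :
    Derives S T (addLines S H x k w b a)
      {.iff (.xor (lin (clauses H).length w x (cv H k))
        (.and (cst b) (lin (clauses H).length a x (cv H k))))
        (lin (clauses H).length (fun j => addMul (w j) b (a j)) x (cv H k))} := by
  refine (Derives.use (addRule_sound b) rfl (by simp [addRule])).trans
    (Derives.chain (P := fun s => .iff (.xor (lin s w x (cv H k))
        (.and (cst b) (lin s a x (cv H k)))) (lin s (fun j => addMul (w j) b (a j)) x (cv H k)))
      ?_ fun s _ => Derives.use (addStepRule_sound _ _ _) ?_ ?_)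
  · exact Or.inr (by simp [addRule, lin_zero])
  · simp [addStepRule, lin_succ]
  · simp [addStepRule]

theorem combW_zero (k i : ℕ) : combW H k i 0 = fun _ => (0, 0) := by
  funext j
  simp [combW]

theorem combW_succ (k i t : ℕ) : combW H k i (t + 1) = fun j =>
    addMul (combW H k i t j) (entry (lev (ZMod 2) H (k + 1)) t i)
      (coef (lev (ZMod 2) H (k + 1)) t j) := by
  funext j
  simp only [combW, addMul, Finset.sum_range_succ, mul_comm]

theorem extFml_succ (k j : ℕ) : extFml H (k + 1) j =
    lin (clauses H).length (coef (lev (ZMod 2) H (k + 1)) j) (xf H k) (cv H k) := by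
  unfold extFml
  rw [if_neg k.succ_ne_zero]
  rfl

/-- Induction on the number `t` of extension axioms used: the `t`-th definition, weighted by its
entry in column `i`, is added to the form over the lower level. -/
theorem derives_combLines {k i : ℕ}
    (hT : ∀ j < (clauses H).length, .iff (cv H (k + 1) j) (extFml H (k + 1) j) ∈ T) :
    Derives S T (combLines S H k i)
      {.iff (yf H (k + 1) i) (combF H k i (clauses H).length)} := by
  -- At `t = 0` the form is not literally falsity but a sum with one zero-weight term per extension
  -- variable, which must first be refuted.
  refine (derives_zeroLines _ _).trans ((Derives.use combRule_sound rfl ?_).trans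
    (Derives.chain (P := fun t => .iff (lin t (yw H (k + 1) i) .tt (cv H (k + 1)))
      (combF H k i t)) ?_ fun t ht => (derives_addLines _ _ _ _ _).trans
        (Derives.use (combStepRule_sound _) ?_ ?_)))
  · simp [combRule, combF, combW_zero]
  · exact Or.inr rfl
  · simp [combStepRule, lin_succ, yw]
  · simp only [combStepRule, List.forall_mem_cons, List.not_mem_nil, false_implies, implies_true,
      and_true]
    refine ⟨?_, ?_, ?_⟩
    · exact Or.inl (Or.inr (by simp))
    · exact Or.inl (Or.inl (Or.inl (Or.inl (by simpa using hT t ht))))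
    · refine Or.inr ?_
      simp [combF, combW_succ, extFml_succ]

theorem derives_splitLines {k i : ℕ} (hi : i < (clauses H).length)
    (hT : .iff (yf H (k + 1) i) (combF H k i (clauses H).length) ∈ T) :
    Derives S T (splitLines S H k i) {.iff (yf H (k + 1) i) (.and (gf H k i) (yf H k i))} := by
  -- Equal weights give the same formula, so the linear algebra needs no lines of the proof.
  have h : combF H k i (clauses H).length =
      lin (clauses H).length (splitW H k i) (xf H k) (cv H k) := by
    refine lin_congr _ _ fun j hj => ?_
    have h1 := sum_coef_mul_entry_lev (K := ZMod 2) k true hj hi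
    have h2 := sum_coef_mul_entry_lev (K := ZMod 2) k false hj hi
    exact Prod.ext h1 h2
  refine (Derives.use splitRule_sound rfl (by simp [splitRule])).trans (Derives.trans
    (Derives.chain (P := fun s => .iff (lin s (splitW H k i) (xf H k) (cv H k))
      (.and (gf H k i) (lin s (yw H k i) .tt (cv H k)))) ?_ fun s _ =>
        Derives.use (splitStepRule_sound _ _) ?_ ?_) (Derives.use transRule_sound ?_ ?_))
  · exact Or.inr rfl
  · simp [splitStepRule, lin_succ, gf, splitW, yw]
  · simp [splitStepRule, gf]
  · simp [transRule]
  · simp only [transRule, List.forall_mem_cons, List.not_mem_nil, false_implies, implies_true,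
      and_true]
    exact ⟨Or.inl (Or.inl (by simpa using hT)), Or.inr (by simp [yf, h])⟩

/-- At level 0 only `y_{0,0}`, defined as truth, has a nonzero weight. From there truth climbs the
levels, since all factors of the empty clause are tautologies. -/
theorem derives_oneLines (hT : .iff (cv H 0 0) .tt ∈ T)
    (hY : ∀ k < (vars H).length, .iff (yf H (k + 1) 0) (.and (gf H k 0) (yf H k 0)) ∈ T) :
    Derives S T (oneLines S H) {yf H (vars H).length 0} := by
  have h0 : 0 < (clauses H).length := Nat.succ_pos _
  have hg : ∀ k, gf H k 0 = sel2 (1, 1) (xf H k) := fun k => by simp [gf, mw, mask, cl, clauses]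
  refine (Derives.use oneRule_sound rfl ?_).trans (Derives.trans
    (Derives.chain (P := fun s => lin (s + 1) (yw H 0 0) .tt (cv H 0)) ?_ fun s hs =>
      Derives.use oneStepRule_sound ?_ ?_)
    (Derives.chain (P := fun k => yf H k 0) ?_ fun k hk => Derives.use upRule_sound ?_ ?_))
  · simpa [oneRule] using hT
  · refine Or.inr ?_
    simp [oneRule, lin_succ, yw, entry_lev_zero h0 h0]
    rfl
  · have : s + 1 < (clauses H).length := by simpa [clauses] using hs
    simp [oneStepRule, lin_succ, yw, entry_lev_zero this h0]
  · simp [oneStepRule]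
  · exact Or.inr rfl
  · simp [upRule]
  · have := hY k hk
    rw [hg] at this
    simp [upRule, this]

/-- Starting from the reflexive implication at the last level, the recursion is unwound downwards;
each level peels off one factor. -/
theorem derives_downLines {i : ℕ}
    (hY : ∀ k < (vars H).length, .iff (yf H (k + 1) i) (.and (gf H k i) (yf H k i)) ∈ T) :
    Derives S T (downLines S H i)
      {A | ∃ k < (vars H).length, A = .imp (yf H (vars H).length i) (gf H k i)} := by
  refine (Derives.use reflRule_sound rfl (by simp [reflRule])).trans ((Derives.ftab (G := fun t =>
    {.imp (yf H (vars H).length i) (yf H ((vars H).length - (t + 1)) i)} ∪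
      {.imp (yf H (vars H).length i) (gf H ((vars H).length - (t + 1)) i)}) fun t ht => ?_).mono
          subset_rfl ?_)
  · have hk : (vars H).length - t = (vars H).length - (t + 1) + 1 := by omega
    have h1 := hY ((vars H).length - (t + 1)) (by omega)
    rw [← hk] at h1
    have h2 : ∀ U, .imp (yf H (vars H).length i) (yf H ((vars H).length - t) i) ∈
        T ∪ {fill [yf H (vars H).length i] reflRule.concl} ∪ {A | ∃ j < t, A ∈
          ({.imp (yf H (vars H).length i) (yf H ((vars H).length - (j + 1)) i)} ∪
            {.imp (yf H (vars H).length i) (gf H ((vars H).length - (j + 1)) i)} : Set _)} ∪ U := by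
      intro U
      cases t with
      | zero => exact Or.inl (Or.inl (Or.inr (by simp [reflRule])))
      | succ t => exact Or.inl (Or.inr ⟨t, by omega, Or.inl rfl⟩)
    refine Derives.append (Derives.use downRule_sound (by simp [downRule]) ?_)
      (Derives.use maskRule_sound (by simp [maskRule]) ?_)
    · simp only [downRule, List.forall_mem_cons, List.not_mem_nil, false_implies, implies_true,
        and_true]
      exact ⟨by simpa using h2 ∅, Or.inl (Or.inl (by simpa using h1))⟩
    · simp only [maskRule, List.forall_mem_cons, List.not_mem_nil, false_implies, implies_true,
        and_true]
      exact ⟨h2 _, Or.inl (Or.inl (Or.inl (by simpa using h1)))⟩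
  · rintro A ⟨k, hk, rfl⟩
    refine ⟨(vars H).length - (k + 1), by omega, Or.inr ?_⟩
    rw [show (vars H).length - ((vars H).length - (k + 1) + 1) = k by omega]
    rfl

/-- A literal of `C` lies in `D`, so the mask at the value making it true is 0 and the factor
implies its negation. Hence `A` contradicts the clause `C`. -/
theorem derives_negLines {A : Fml EVar} {C D : Clause} (hCD : C ⊆ D) (hC : C.toFml ∈ T)
    (hD : ∀ l ∈ D, .imp A (sel2 (mask (ZMod 2) l.var true D, mask (ZMod 2) l.var false D)
      (.var (.orig l.var))) ∈ T) : Derives S T (negLines S A C D) {.neg A} := by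
  refine (Derives.use clauseRule_sound rfl (by simp [clauseRule])).trans (Derives.trans
    -- Literals are processed from the end, since a clause is a disjunction nested to the right.
    (Derives.chain (P := fun t => .imp A (.neg (Clause.toFml (C.drop (C.length - t)))))
      ?_ fun t ht => ?_) (Derives.use refuteRule_sound ?_ ?_))
  · exact Or.inr (by simp [clauseRule, Clause.toFml])
  · have hk : C.length - (t + 1) < C.length := by omega
    have hd : C.drop (C.length - (t + 1)) =
        C.getD (C.length - (t + 1)) ⟨0, true⟩ :: C.drop (C.length - t) := by
      rw [List.drop_eq_getElem_cons hk, show C.length - (t + 1) + 1 = C.length - t by omega]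
      simp [List.getD_eq_getElem?_getD, hk]
    have hl := getD_mem hk ⟨0, true⟩
    rw [hd]
    generalize C.getD (C.length - (t + 1)) ⟨0, true⟩ = l at hl
    have hlit : fill [A, .var (.orig l.var)] (litRule (mask (ZMod 2) l.var true D,
        mask (ZMod 2) l.var false D) l.pos).concl = .imp A (.neg l.toFml) := by
      obtain ⟨x, b⟩ := l
      cases b <;> rfl
    refine (Derives.use (litRule_sound ?_) hlit ?_).trans (Derives.use clauseStepRule_sound ?_ ?_)
    · obtain ⟨x, b⟩ := l
      cases b <;> simpa [sel, mask] using hCD hl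
    · simpa [litRule] using Or.inr (Or.inr (hD l (hCD hl)))
    · simp [clauseStepRule, Clause.toFml]
    · simp [clauseStepRule]
  · simp [refuteRule]
  · simp [refuteRule, hC]

theorem derives_clauseLines {i : ℕ} (hF : ∀ C ∈ H, ∃ C' ∈ F, C' ⊆ C)
    (hi : i < (clauses H).tail.length) (hT : ∀ C ∈ F, C.toFml ∈ T)
    (hY : ∀ k < (vars H).length,
      .iff (yf H (k + 1) (i + 1)) (.and (gf H k (i + 1)) (yf H k (i + 1))) ∈ T) :
    Derives S T (clauseLines S F H i) {.neg (yf H (vars H).length (i + 1))} := by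
  obtain ⟨h1, h2⟩ := cl_succ_strengthening hF hi
  refine (derives_downLines hY).trans (derives_negLines h2 (Or.inl (hT _ h1)) fun l hl => ?_)
  have hi' : i + 1 < (clauses H).length := by simpa [clauses] using hi
  obtain ⟨k, hk, hk'⟩ := exists_getD_of_mem ((mem_clauses (getD_mem hi' [])).2 l hl) 0
  have hk' : xv H k = l.var := hk'
  rw [← hk']
  exact Or.inr ⟨k, hk, rfl⟩

theorem derives_sumLines (h : IsHittingRefutation F H)
    (hT : ∀ i < (clauses H).tail.length, .neg (yf H (vars H).length (i + 1)) ∈ T) :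
    Derives S T (sumLines S H) {.neg (yf H (vars H).length 0)} := by
  have h0 : sumW H 0 = fun _ => (0, 0) := by
    funext j
    simp [sumW]
  have hs : ∀ t, sumW H (t + 1) = fun j => addMul (sumW H t j) 1 (yw H (vars H).length (t + 1) j) := by
    intro t
    funext j
    simp [sumW, addMul, yw, Finset.sum_range_succ]
  -- By the column identity, the form of the empty clause and the full sum of the other forms are
  -- the same formula.
  have hy : yf H (vars H).length 0 = sumF H (clauses H).tail.length :=
    lin_congr _ _ fun j hj => Prod.ext (sum_entry_lev_last h.1 h.2.1 hj).symm rfl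
  rw [hy]
  refine (derives_zeroLines _ _).trans (Derives.chain (P := fun t => .neg (sumF H t)) ?_
    fun t ht => (derives_addLines _ _ _ _ _).trans (Derives.use sumRule_sound ?_ ?_))
  · exact Or.inr (by simp [sumF, h0])
  · simp [sumRule]
  · simp only [sumRule, List.forall_mem_cons, List.not_mem_nil, false_implies, implies_true,
      and_true]
    refine ⟨Or.inl (Or.inr (by simp)), Or.inl (Or.inl (Or.inl (by simpa using hT t ht))),
      Or.inr ?_⟩
    simp [sumF, hs, yf]

theorem derives_mainLines (h : IsHittingRefutation F H) (hA : ∀ A ∈ axioms H, A ∈ T)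
    (hC : ∀ C ∈ F, C.toFml ∈ T) : Derives S T (mainLines S F H) {.ff} := by
  have hE : ∀ k ≤ (vars H).length, ∀ j < (clauses H).length,
      .iff (cv H k j) (extFml H k j) ∈ T := fun k hk j hj =>
    hA _ (mem_ftab.2 ⟨k, by omega, mem_tab.2 ⟨j, hj, rfl⟩⟩)
  have hD : ∀ i < (clauses H).tail.length, i + 1 < (clauses H).length := fun i hi => by
    simpa [clauses] using hi
  have h0 : 0 < (clauses H).length := Nat.succ_pos _
  refine (Derives.ftab (G := fun k => {A | ∃ i < (clauses H).length,
    A = .iff (yf H (k + 1) i) (.and (gf H k i) (yf H k i))}) fun k hk =>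
      (Derives.ftab (G := fun i => {.iff (yf H (k + 1) i) (.and (gf H k i) (yf H k i))})
        fun i hi => ?_).mono subset_rfl fun A hA => hA).trans ?_
  · exact (derives_combLines fun j hj => Or.inl (Or.inl (hE (k + 1) hk j hj))).trans
      (derives_splitLines hi (Or.inr rfl))
  refine ((derives_oneLines (Or.inl (hE 0 (Nat.zero_le _) 0 h0))
    fun k hk => Or.inr ⟨k, hk, 0, h0, rfl⟩).append ((Derives.ftab (G := fun i =>
      {.neg (yf H (vars H).length (i + 1))}) fun i hi => derives_clauseLines h.2.2 hi
        (fun C hC' => Or.inl (Or.inl (Or.inl (hC C hC'))))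
        fun k hk => Or.inl (Or.inl (Or.inr ⟨k, hk, i + 1, hD i hi, rfl⟩))).trans
      ((derives_sumLines h fun i hi => Or.inr ⟨i, hi, rfl⟩).trans
        (Derives.use contraRule_sound (A := .ff) rfl ?_)))).mono subset_rfl Set.subset_union_right
  simp [contraRule]

theorem getLast_lines : (lines S F H).getLast? = some .ff := by
  obtain ⟨l, hl⟩ := List.getLast?_eq_some_iff.1
    (getLast_use (S := S) (args := [yf H (vars H).length 0]) contraRule_sound (by simp [contraRule]))
  simp only [lines, mainLines, hl, ← List.append_assoc]
  exact List.getLast?_concat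

/-! ### The extension axioms -/

theorem occurs_lin {n : ℕ} {w : ℕ → ZMod 2 × ZMod 2} {x : Fml EVar} {c : ℕ → Fml EVar} {v : EVar}
    (h : (lin n w x c).Occurs v) : x.Occurs v ∨ ∃ j < n, (c j).Occurs v := by
  have hcst : ∀ a : ZMod 2, ¬ (cst a : Fml EVar).Occurs v := fun a h => by
    unfold cst at h
    split_ifs at h <;> exact h
  induction n with
  | zero => exact absurd h id
  | succ n ih =>
    rw [lin_succ] at h
    rcases h with h | ((h | h) | (h | h)) | h
    · exact (ih h).imp id fun ⟨j, hj, h⟩ => ⟨j, by omega, h⟩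
    · exact absurd h (hcst _)
    · exact Or.inl h
    · exact absurd h (hcst _)
    · exact Or.inl h
    · exact Or.inr ⟨n, Nat.lt_succ_self _, h⟩

/-- The definitions of the extension variables. -/
def defs (H : CNF) : List (ℕ × Fml EVar) :=
  ftab ((vars H).length + 1) fun k => tab (clauses H).length fun j => (ev H k j, extFml H k j)

/-- Freshness follows from distinct names: a name occurring in a definition is the name of a
strictly earlier one. -/
theorem extAxiom_of_valid {ds : List (ℕ × Fml EVar)} (hd : (ds.map Prod.fst).Nodup)
    (hv : Valid (fun T d => ∀ y, d.2.Occurs (.ext y) → ∃ d' ∈ T, d'.1 = y) ∅ ds)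
    {pre post : List (ℕ × Fml EVar)} {d : ℕ × Fml EVar} (h : ds = pre ++ d :: post) :
    ExtAxiom (pre.map fun d => .iff (.var (.ext d.1)) d.2) (.iff (.var (.ext d.1)) d.2) := by
  rw [h, List.map_append, List.map_cons, List.nodup_append] at hd
  have hn : ∀ d' ∈ pre, d'.1 ≠ d.1 := fun d' hd' =>
    hd.2.2 _ (List.mem_map_of_mem hd') _ List.mem_cons_self
  refine ⟨d.1, d.2, rfl, fun ho => ?_, fun D hD => ?_⟩
  · obtain ⟨d', hd' | hd', h'⟩ := hv pre d post h _ ho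
    · exact hd'
    · exact hn d' hd' h'
  · obtain ⟨e, he, rfl⟩ := List.mem_map.1 hD
    rintro (ho | ho)
    · exact hn e he (by simpa [Fml.Occurs, eq_comm] using ho)
    -- If the new name occurred in an earlier definition, a still earlier one would already bear it.
    · obtain ⟨s, t, rfl⟩ := List.append_of_mem he
      obtain ⟨d', hd' | hd', h'⟩ := hv s e (t ++ d :: post) (by rw [h]; simp) _ ho
      · exact hd'
      · exact hn d' (List.mem_append_left _ hd') h'

theorem valid_defs : Valid (fun T d => ∀ y, d.2.Occurs (.ext y) → ∃ d' ∈ T, d'.1 = y) ∅ (defs H) := by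
  have hm : StepMono fun (T : Set (ℕ × Fml EVar)) (d : ℕ × Fml EVar) =>
      ∀ y, d.2.Occurs (.ext y) → ∃ d' ∈ T, d'.1 = y := fun T T' d hT h y hy => by
    obtain ⟨d', h1, h2⟩ := h y hy
    exact ⟨d', hT h1, h2⟩
  refine Valid.ftab hm fun k hk T _ hT => Valid.tab hm fun j hj T' hTT' _ y hy => ?_
  cases k with
  | zero =>
    simp only [extFml, if_true] at hy
    split_ifs at hy <;> exact absurd hy id
  | succ k =>
    simp only [extFml_succ] at hy
    rcases occurs_lin hy with h | ⟨j', hj', h⟩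
    · simp [xf, Fml.Occurs] at h
    · have h : y = ev H k j' := by simpa [cv, Fml.Occurs] using h
      exact ⟨_, hTT' (hT k (Nat.lt_succ_self _) _ (mem_tab.2 ⟨j', hj', rfl⟩)), h.symm⟩

theorem map_defs {β : Type*} (f : ℕ × Fml EVar → β) : (defs H).map f =
    ftab ((vars H).length + 1) fun k => tab (clauses H).length fun j =>
      f (ev H k j, extFml H k j) := by
  simp [defs, ftab, tab, List.map_flatMap, Function.comp_def]

theorem split_append {β : Type*} {l m pre post : List β} {p : β}
    (h : l ++ m = pre ++ p :: post) :
    (∃ post', l = pre ++ p :: post') ∨ ∃ pre', pre = l ++ pre' ∧ m = pre' ++ p :: post := by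
  rcases List.append_eq_append_iff.1 h with ⟨a, h1, h2⟩ | ⟨c, h1, h2⟩
  · exact Or.inr ⟨a, h1, h2⟩
  · cases c with
    | nil => exact Or.inr ⟨[], by simpa using h1.symm, by simpa using h2.symm⟩
    | cons q c =>
      simp only [List.cons_append, List.cons.injEq] at h2
      exact Or.inl ⟨c, by rw [h1, h2.1]⟩

/-- All extension axioms stand at the front, so their freshness has to be checked against one
another only. The clauses of `F` and the rule instances follow. -/
theorem lines_correct (h : IsHittingRefutation F H) {pre post : List (Fml EVar)} {B : Fml EVar}
    (hl : lines S F H = pre ++ B :: post) :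
    (∃ C ∈ F, B = Clause.toFml C) ∨ FregeStep S.rules pre B ∨ ExtAxiom pre B := by
  have hax : axioms H = (defs H).map fun d => .iff (.var (.ext d.1)) d.2 :=
    (map_defs (H := H) fun d : ℕ × Fml EVar => Fml.iff (.var (EVar.ext d.1)) d.2).symm
  have hnd : ((defs H).map Prod.fst).Nodup := by
    rw [map_defs]
    exact nodup_names H
  rcases split_append hl with ⟨post, hA⟩ | ⟨a, rfl, ha⟩
  · rw [hax] at hA
    obtain ⟨p, q, hd, rfl, hq⟩ := List.map_eq_append_iff.1 hA
    obtain ⟨d, r, rfl, rfl, -⟩ := List.map_eq_cons_iff.1 hq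
    exact Or.inr (Or.inr (extAxiom_of_valid hnd valid_defs hd))
  rcases split_append ha with ⟨post, hC⟩ | ⟨b, rfl, hb⟩
  · obtain ⟨C, hC, hB⟩ := List.mem_map.1 (show B ∈ F.map Clause.toFml by rw [hC]; simp)
    exact Or.inl ⟨C, hC, hB.symm⟩
  · have hv := (derives_mainLines (S := S) (T := {x | x ∈ axioms H ++ F.map Clause.toFml}) h
      (fun A hA => List.mem_append_left _ hA)
      fun C hC => List.mem_append_right _ (List.mem_map_of_mem hC)).1 b B post hb
    obtain ⟨R, hR, σ, h1, h2⟩ := hv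
    refine Or.inr (Or.inl ⟨R, hR, σ, h1, fun P hP => ?_⟩)
    rw [← List.append_assoc]
    exact List.mem_append.2 (h2 P hP)

end Main

end EF

theorem extFrege_pSimulates_hitting (S : FregeSystem) : PSimulates (extFrege S) hitting :=
  ⟨fun p : CNF × CNF => EF.lines S p.1 p.2, EF.polyTime_lines S, fun _ _ h =>
    ⟨fun _ _ _ hl => EF.lines_correct h hl, EF.getLast_lines⟩⟩

end HitSim

theorem mainTheorem4 :
    (∀ (K : Type) [Field K] [Finite K], HitSim.PSimulates (HitSim.extPC K) HitSim.hitting) ∧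
    (∀ S : HitSim.FregeSystem, HitSim.PSimulates (HitSim.extFrege S) HitSim.hitting) :=
  ⟨fun K _ _ => HitSim.extPC_pSimulates_hitting K, HitSim.extFrege_pSimulates_hitting⟩
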